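/- Let $C$ be a metric space homeomorphic to $S^2$ whose metric is a length metric (the distance of two points is the infimum of the lengths of the paths joining them), such that every point of $C$ either has a ball about it isometric to a disk in the Euclidean plane, or is a cone point of positive curvature, that is, has a ball about it isometric to a ball about the apex of a Euclidean cone of cone-angle $\theta$ with $0<\theta<2\pi$. (The cone points are then isolated, hence finite in number.) Then $C$ admits a geodesic triangulation whose vertex set is exactly the set of cone points. Here a geodesic triangulation is a finite family of nondegenerate Euclidean triangles together with continuous maps of the (closed) triangles to $C$ that are locally isometric away from the corners and that exhibit $C$ as the space obtained from the triangles by gluing their edges isometrically in pairs; each edge is paired with a different edge, possibly of the same triangle, so vertices and edges of a triangle may be identified in $C$. Moreover, the triangulation can be obtained by subdividing the Delaunay decomposition dual to the Voronoi diagram of the cone points, in the following sense. For $x\in C$ let $r(x)$ be the distance from $x$ to the set of cone points. Call $x$ a Voronoi vertex if there are at least three arcs of length $r(x)$ from $x$ to cone points, and a point of a Voronoi edge if there are exactly two. A Delaunay disk at $x$ is a continuous map $D$ of a closed Euclidean disk of radius $r(x)>0$ onto the closed ball of radius $r(x)$ about $x$, which takes the centre to $x$, is locally isometric on the open disk, and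 takes no point of the open disk to a cone point; its cell is the convex hull of those points of the boundary circle that $D$ maps to cone points. Then: 1. for each triangle there is a Delaunay disk $D$ at some Voronoi vertex such that the corners of the triangle lie on the boundary circle of the disk, are mapped by $D$ to cone points, and the map of the triangle to $C$ is the restriction of $D$; 2. at each Voronoi vertex there is a Delaunay disk $D$ whose cell is a union of triangles of the triangulation, each with its corners among the points of the boundary circle that $D$ maps to cone points, and each mapped to $C$ by the restriction of $D$; 3. at each point of a Voronoi edge there is a Delaunay disk $D$ whose cell (a chord) has as its image in $C$ an edge of the triangulation. -/

import Mathlib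

noncomputable section

/-- The Euclidean plane. -/
abbrev Plane : Type := EuclideanSpace ℝ (Fin 2)

/-! ### Euclidean cone metrics -/

section ConeMetrics

/-- The distance between the points with polar coordinates `(r, a)` and `(r', a')` in the Euclidean
cone of cone-angle `θ`. The angular coordinate lives on the circle `ℝ / θℤ` of length `θ`, and
`‖a - a'‖` is the length of the shorter arc between `a` and `a'`. -/
def coneDist (θ r : ℝ) (a : AddCircle θ) (r' : ℝ) (a' : AddCircle θ) : ℝ :=
  Real.sqrt (r ^ 2 + r' ^ 2 - 2 * r * r' * Real.cos (min ‖a - a'‖ Real.pi))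

variable (C : Type*) [MetricSpace C]

/-- The metric of `C` is a length metric: the distance of two points is the infimum of the lengths
of the paths that join them. -/
def IsLengthMetric : Prop :=
  ∀ x y : C, edist x y = ⨅ γ : Path x y, eVariationOn (fun t => γ t) Set.univ

variable {C}

/-- Some ball about `p` is isometric to a disk of the Euclidean plane of the same radius. -/
def LocallyEuclideanAt (p : C) : Prop :=
  ∃ ε : ℝ, 0 < ε ∧ Nonempty (Metric.ball p ε ≃ᵢ Metric.ball (0 : Plane) ε)

/-- Some ball about `p` is isometric to the ball of the same radius about the apex of the cone of
cone-angle `θ`, with `p` corresponding to the apex; `φ r a` is the point of `C` with polar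
coordinates `(r, a)`. -/
def HasConeAngleAt (p : C) (θ : ℝ) : Prop :=
  ∃ (ε : ℝ) (φ : ℝ → AddCircle θ → C), 0 < ε ∧ (∀ a, φ 0 a = p) ∧
    (∀ r ∈ Set.Ico 0 ε, ∀ r' ∈ Set.Ico 0 ε, ∀ a a',
      dist (φ r a) (φ r' a') = coneDist θ r a r' a') ∧
    ∀ q ∈ Metric.ball p ε, ∃ r ∈ Set.Ico 0 ε, ∃ a, φ r a = q

/-- `p` is a cone point of positive curvature `2 * π - θ`. -/
def IsPositiveConePoint (p : C) : Prop :=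
  ∃ θ : ℝ, 0 < θ ∧ θ < 2 * Real.pi ∧ HasConeAngleAt p θ

variable (C)

/-- The set of cone points of positive curvature. -/
def conePoints : Set C := {p | IsPositiveConePoint p}

/-- A length metric that is locally Euclidean except at cone points of positive curvature. (Such
cone points are isolated, as the cone is locally Euclidean away from its apex.) -/
structure IsPositiveEuclideanConeMetric : Prop where
  isLengthMetric : IsLengthMetric C
  locally_cone : ∀ p : C, LocallyEuclideanAt p ∨ IsPositiveConePoint p

end ConeMetrics

/-! ### Geodesic triangulations -/

/-- `f` restricted to some neighbourhood of `x` in `s` preserves distances. -/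
def IsIsometricNear {C : Type*} [MetricSpace C] (f : Plane → C) (s : Set Plane) (x : Plane) :
    Prop :=
  ∃ U ∈ nhdsWithin x s, ∀ y ∈ U, ∀ z ∈ U, dist (f y) (f z) = dist y z

/-- A finite family of Euclidean triangles with a pairing of their edges. The edge `(i, k)` is the
edge of the `i`-th triangle opposite to its `k`-th vertex. Each edge is glued to another edge
(possibly of the same triangle) of the same length. -/
structure TrianglePairing where
  /-- the number of triangles -/
  numFaces : ℕ
  /-- the three vertices of each triangle -/
  corner : Fin numFaces → Fin 3 → Plane
  nondegenerate : ∀ i, AffineIndependent ℝ (corner i)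
  /-- the edge to which an edge is glued -/
  mate : Fin numFaces × Fin 3 → Fin numFaces × Fin 3
  mate_mate : ∀ e, mate (mate e) = e
  mate_ne : ∀ e, mate e ≠ e
  /-- whether the parameter of the edge is reversed by the gluing -/
  flip : Fin numFaces × Fin 3 → Bool
  flip_mate : ∀ e, flip (mate e) = flip e
  mate_length : ∀ e,
    dist (corner (mate e).1 ((mate e).2 + 1)) (corner (mate e).1 ((mate e).2 + 2)) =
      dist (corner e.1 (e.2 + 1)) (corner e.1 (e.2 + 2))

namespace TrianglePairing

variable (P : TrianglePairing)

/-- The `i`-th (closed) triangle. -/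
def face (i : Fin P.numFaces) : Set Plane := convexHull ℝ (Set.range (P.corner i))

/-- The edge `e`, as a closed segment in the plane. -/
def edge (e : Fin P.numFaces × Fin 3) : Set Plane :=
  segment ℝ (P.corner e.1 (e.2 + 1)) (P.corner e.1 (e.2 + 2))

/-- The point with affine parameter `t ∈ [0, 1]` on the edge `e`. -/
def edgePoint (e : Fin P.numFaces × Fin 3) (t : ℝ) : Plane :=
  AffineMap.lineMap (P.corner e.1 (e.2 + 1)) (P.corner e.1 (e.2 + 2)) t

/-- The elementary identifications between points of the triangles: each edge is glued
isometrically to its mate. A pair `(i, x)` stands for the point `x` of the `i`-th triangle. -/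
def Glued (p q : Fin P.numFaces × Plane) : Prop :=
  ∃ e : Fin P.numFaces × Fin 3, ∃ t ∈ Set.Icc (0 : ℝ) 1,
    p = (e.1, P.edgePoint e t) ∧
    q = ((P.mate e).1, P.edgePoint (P.mate e) (if P.flip e then 1 - t else t))

end TrianglePairing

/-- A geodesic triangulation of `C`, possibly with identifications of vertices and edges: Euclidean
triangles are mapped to `C`, locally isometrically away from the vertices, so that `C` is what
results from the triangles when their edges are glued in pairs. -/
structure GeodesicTriangulation (C : Type*) [MetricSpace C] extends TrianglePairing where
  /-- the map of the `i`-th triangle to `C` (only its values on the triangle matter) -/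
  toFun : Fin numFaces → Plane → C
  continuousOn : ∀ i, ContinuousOn (toFun i) (toTrianglePairing.face i)
  isometric : ∀ i, ∀ x ∈ toTrianglePairing.face i, x ∉ Set.range (corner i) →
    IsIsometricNear (toFun i) (toTrianglePairing.face i) x
  covers : ∀ p : C, ∃ i, ∃ x ∈ toTrianglePairing.face i, toFun i x = p
  identifications : ∀ i, ∀ x ∈ toTrianglePairing.face i, ∀ j, ∀ y ∈ toTrianglePairing.face j,
    (toFun i x = toFun j y ↔ Relation.EqvGen toTrianglePairing.Glued (i, x) (j, y))

/-- The vertex set of a geodesic triangulation. -/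
def GeodesicTriangulation.vertexSet {C : Type*} [MetricSpace C] (T : GeodesicTriangulation C) :
    Set C :=
  {p | ∃ i k, T.toFun i (T.corner i k) = p}

/-! ### The Voronoi diagram and the Delaunay decomposition -/

section Delaunay

variable {C : Type*} [MetricSpace C]

/-- The distance from `x` to the set of cone points. -/
def coneRadius (x : C) : ℝ := Metric.infDist x (conePoints C)

/-- The shortest arcs from `x` to cone points, parametrized by arc length. -/
def shortestArcs (x : C) : Set (Set.Icc (0 : ℝ) (coneRadius x) → C) :=
  {γ | Isometry γ ∧ γ ⟨0, le_rfl, Metric.infDist_nonneg⟩ = x ∧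
    γ ⟨coneRadius x, Metric.infDist_nonneg, le_rfl⟩ ∈ conePoints C}

/-- `x` lies on an (open) Voronoi edge: it has exactly two shortest arcs to cone points. -/
def IsVoronoiEdgePoint (x : C) : Prop := (shortestArcs x).encard = 2

/-- `x` is a Voronoi vertex: it has three or more shortest arcs to cone points. -/
def IsVoronoiVertex (x : C) : Prop := 3 ≤ (shortestArcs x).encard

/-- `D` maps a Euclidean disk with centre `c` to `C`, isometrically immersing its interior, and the
image is the largest metric disk about `D c` whose interior contains no cone points. -/
structure IsDelaunayDisk (c : Plane) (D : Plane → C) : Prop where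
  radius_pos : 0 < coneRadius (D c)
  continuousOn : ContinuousOn D (Metric.closedBall c (coneRadius (D c)))
  isometric : ∀ y ∈ Metric.ball c (coneRadius (D c)),
    IsIsometricNear D (Metric.ball c (coneRadius (D c))) y
  image_eq : D '' Metric.closedBall c (coneRadius (D c)) =
    Metric.closedBall (D c) (coneRadius (D c))
  empty_interior : ∀ y ∈ Metric.ball c (coneRadius (D c)), D y ∉ conePoints C

/-- The points on the boundary of the Euclidean disk that map to cone points. -/
def markedPoints (c : Plane) (D : Plane → C) : Set Plane :=
  {v ∈ Metric.sphere c (coneRadius (D c)) | D v ∈ conePoints C}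

/-- The Delaunay cell (before it is mapped to `C`): the chord dual to a Voronoi edge if `D c` is
on a Voronoi edge, and the convex polygon dual to `D c` if `D c` is a Voronoi vertex. -/
def delaunayCell (c : Plane) (D : Plane → C) : Set Plane := convexHull ℝ (markedPoints c D)

/-- The triangulation arises from the Delaunay decomposition dual to the Voronoi diagram by
subdividing its polygons into triangles with vertices among those of the polygon. -/
structure GeodesicTriangulation.IsDelaunay (T : GeodesicTriangulation C) : Prop where
  /-- Each triangle is part of the polygon dual to a Voronoi vertex. -/
  face_in_cell : ∀ i, ∃ (c : Plane) (D : Plane → C), IsDelaunayDisk c D ∧ IsVoronoiVertex (D c) ∧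
    (∀ k, T.corner i k ∈ markedPoints c D) ∧ Set.EqOn (T.toFun i) D (T.face i)
  /-- The polygon dual to each Voronoi vertex is subdivided into triangles of `T`. -/
  cell_subdivided : ∀ x : C, IsVoronoiVertex x → ∃ (c : Plane) (D : Plane → C),
    IsDelaunayDisk c D ∧ D c = x ∧ ∃ I : Set (Fin T.numFaces),
      delaunayCell c D = ⋃ i ∈ I, T.face i ∧
      ∀ i ∈ I, (∀ k, T.corner i k ∈ markedPoints c D) ∧ Set.EqOn (T.toFun i) D (T.face i)
  /-- The chord dual to each Voronoi edge is an edge of `T`. -/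
  edge_dual : ∀ x : C, IsVoronoiEdgePoint x → ∃ (c : Plane) (D : Plane → C),
    IsDelaunayDisk c D ∧ D c = x ∧
      ∃ e : Fin T.numFaces × Fin 3, D '' delaunayCell c D = T.toFun e.1 '' T.edge e

end Delaunay

end

open Set Metric Filter Topology

/-! The argument takes place in the plane, by developing. A flat map is a local isometry from an
open part of the plane to the complement of the cone points. A flat map on a connected set is
determined by one germ (`IsFlatOn.eqOn`), and a germ at `c` extends to the open disk whose radius is
the distance to the cone points (`IsFlatOn.exists_extension`), because charts have a uniform size on
compact sets free of cone points. Extending continuously to the closed disk gives a Delaunay disk.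
Its marked points correspond to the shortest arcs from the image of the centre to cone points
(`encard_shortestArcs`), so Voronoi vertices and edges are recognized by counting marked points.
Cone points do exist (`conePoints_nonempty`): otherwise the developing map would be a covering of
the sphere by the plane, and a section of it would have compact open image in the plane.

The cells cover `C` (`exists_zero_mem_delaunayCell`). Develop a point as the origin and consider all
flat disks around it. For a disk with centre `c` and radius `r`, the quantity `r² - ‖c‖²` equals
`‖m‖² - 2⟪m, c⟫` for each boundary point `m`, hence is affine in `c` while `m` stays on the circle.
Take a disk that maximizes it and, among these, one of maximal radius. First-order maximality puts
the origin in the convex hull of the marked points; maximality of the radius excludes two or fewer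
marked points.

Cells meet properly because the disks are empty. If two Delaunay disks are developed consistently
into one plane, no marked point of either lies inside the other, so the radical axis separates the
two sets of marked points (`IsDelaunayDisk.exists_separating`) and triangles inscribed in them can
meet only in an edge or in corners. Triangles of the same cell come from a fan (`exists_fan`) and
are separated by lines too.

It remains to glue. Each edge has a partner on its other side, by covering and compactness
(`exists_adjacent_edge`), and only one, as three triangles cannot lie pairwise on opposite sides of
an edge (`Adjacent.not_cyclic`). Points other than corners are therefore identified only across one
edge, and corners over the same cone point are identified through a chain of edges because a
punctured cone ball is connected (`eqvGen_corner`). -/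

namespace ConeSphere

variable {C : Type*} [MetricSpace C]

/-! ### Distance-preserving maps of plane disks -/

/-- `f` preserves distances on `s`. -/
def IsoOn {X Y : Type*} [MetricSpace X] [MetricSpace Y] (f : X → Y) (s : Set X) : Prop :=
  ∀ z ∈ s, ∀ w ∈ s, dist (f z) (f w) = dist z w

theorem IsoOn.mono {X Y : Type*} [MetricSpace X] [MetricSpace Y] {f : X → Y} {s t : Set X}
    (h : IsoOn f t) (hst : s ⊆ t) : IsoOn f s :=
  fun z hz w hw => h z (hst hz) w (hst hw)

theorem IsoOn.congr {X Y : Type*} [MetricSpace X] [MetricSpace Y] {f g : X → Y} {s : Set X}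
    (h : IsoOn f s) (hfg : EqOn g f s) : IsoOn g s :=
  fun z hz w hw => by rw [hfg hz, hfg hw, h z hz w hw]

theorem IsoOn.injOn {X Y : Type*} [MetricSpace X] [MetricSpace Y] {f : X → Y} {s : Set X}
    (h : IsoOn f s) : InjOn f s := fun z hz w hw hzw => by
  have := h z hz w hw
  rw [hzw, dist_self] at this
  exact (dist_eq_zero.1 this.symm)

theorem IsoOn.continuousOn {X Y : Type*} [MetricSpace X] [MetricSpace Y] {f : X → Y} {s : Set X}
    (h : IsoOn f s) : ContinuousOn f s :=
  (LipschitzOnWith.of_dist_le_mul (K := 1) fun z hz w hw => by simp [h z hz w hw]).continuousOn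

/-- A distance-preserving map between parts of the plane that is defined on a disk is the
restriction of a rigid motion. -/
theorem IsoOn.exists_affineIsometryEquiv {f : Plane → Plane} {y : Plane} {δ : ℝ} (hδ : 0 < δ)
    (hf : IsoOn f (ball y δ)) : ∃ A : Plane ≃ᵃⁱ[ℝ] Plane, EqOn f A (ball y δ) := by
  set g : Plane → Plane := fun v => f (y + v) - f y with hg
  have hy : y ∈ ball y δ := mem_ball_self hδ
  have hmem : ∀ v : Plane, ‖v‖ < δ → y + v ∈ ball y δ := fun v hv => by simpa using hv
  have hn : ∀ v, ‖v‖ < δ → ‖g v‖ = ‖v‖ := fun v hv => by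
    have := hf _ (hmem v hv) _ hy
    simpa [hg, dist_eq_norm] using this
  have hd : ∀ v w, ‖v‖ < δ → ‖w‖ < δ → ‖g v - g w‖ = ‖v - w‖ := fun v w hv hw => by
    have := hf _ (hmem v hv) _ (hmem w hw)
    simpa [hg, dist_eq_norm] using this
  -- Polarization: norms and distances determine inner products, so the images of an orthogonal
  -- frame and inner products with it recover `g`.
  have hi : ∀ v w, ‖v‖ < δ → ‖w‖ < δ → inner ℝ (g v) (g w) = inner ℝ v w := fun v w hv hw => by
    rw [real_inner_eq_norm_mul_self_add_norm_mul_self_sub_norm_sub_mul_self_div_two,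
      real_inner_eq_norm_mul_self_add_norm_mul_self_sub_norm_sub_mul_self_div_two,
      hd v w hv hw, hn v hv, hn w hw]
  let b := EuclideanSpace.basisFun (Fin 2) ℝ
  -- The basis vectors are shrunk so that they lie where `g` is controlled; the factor `s⁻¹` undoes
  -- this afterwards.
  set s : ℝ := δ / 2 with hs
  have hs0 : 0 < s := by positivity
  have hsb : ∀ i, ‖s • b i‖ < δ := fun i => by
    rw [norm_smul, b.norm_eq_one, Real.norm_of_nonneg hs0.le]; linarith
  have hon : Orthonormal ℝ (fun i => s⁻¹ • g (s • b i)) := by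
    rw [orthonormal_iff_ite]
    intro i j
    rw [inner_smul_left, inner_smul_right, hi _ _ (hsb i) (hsb j), inner_smul_left,
      inner_smul_right, orthonormal_iff_ite.1 b.orthonormal i j]
    simp only [RCLike.conj_to_real]
    split_ifs <;> field_simp
  let b' : OrthonormalBasis (Fin 2) ℝ Plane :=
    OrthonormalBasis.mk hon (by
      rw [LinearIndependent.span_eq_top_of_card_eq_finrank hon.linearIndependent (by simp)])
  let Lin := b.equiv b' (Equiv.refl _)
  have hL : ∀ v, ‖v‖ < δ → g v = Lin v := fun v hv => by
    refine b'.repr.injective (PiLp.ext fun i => ?_)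
    rw [b'.repr_apply_apply, b'.repr_apply_apply]
    have h1 : b' i = Lin (b i) := by simp [Lin]
    have h2 : b' i = s⁻¹ • g (s • b i) := by simp [b']
    rw [h2, inner_smul_left, hi _ _ (hsb i) hv, ← h2, h1, LinearIsometryEquiv.inner_map_map,
      inner_smul_left]
    simp only [RCLike.conj_to_real]
    field_simp
  refine ⟨Lin.toAffineIsometryEquiv.trans (AffineIsometryEquiv.constVAdd ℝ Plane (f y - Lin y)),
    fun z hz => ?_⟩
  have := hL (z - y) (by simpa [dist_eq_norm] using hz)
  simp only [hg, add_sub_cancel, map_sub] at this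
  simp only [AffineIsometryEquiv.coe_trans, LinearIsometryEquiv.coe_toAffineIsometryEquiv,
    Function.comp, AffineIsometryEquiv.coe_constVAdd, vadd_eq_add]
  rw [← sub_add_cancel (f z) (f y), this]; abel

/-- The linear parts agree on short vectors, hence on all vectors by homogeneity. -/
theorem affineIsometryEquiv_eq_of_eventuallyEq {A B : Plane ≃ᵃⁱ[ℝ] Plane} {y : Plane}
    (h : A =ᶠ[𝓝 y] B) : A = B := by
  obtain ⟨δ, hδ, hb⟩ := Metric.eventually_nhds_iff_ball.1 h
  have h0 : ∀ v : Plane, A.linearIsometryEquiv v = B.linearIsometryEquiv v := by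
    intro v
    obtain ⟨t, ht, htv⟩ : ∃ t : ℝ, 0 < t ∧ ‖t • v‖ < δ := by
      refine ⟨δ / 2 / (‖v‖ + 1), by positivity, ?_⟩
      rw [norm_smul, Real.norm_of_nonneg (by positivity), div_mul_eq_mul_div, div_lt_iff₀ (by positivity)]
      nlinarith [norm_nonneg v]
    have h1 := hb (t • v +ᵥ y) (by simpa using htv)
    rw [A.map_vadd, B.map_vadd, hb y (mem_ball_self hδ)] at h1
    have h2 := vadd_right_cancel _ h1
    rw [map_smul, map_smul] at h2
    exact smul_right_injective _ ht.ne' h2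
  ext z : 1
  have : z = (z -ᵥ y) +ᵥ y := by simp
  rw [this, A.map_vadd, B.map_vadd, h0, hb y (mem_ball_self hδ)]

/-! ### Charts -/

/-- `ψ` maps the disk of radius `ε` about the origin isometrically onto the ball about `p`. -/
structure IsChart (ψ : Plane → C) (p : C) (ε : ℝ) : Prop where
  pos : 0 < ε
  zero : ψ 0 = p
  iso : IsoOn ψ (ball 0 ε)
  image : ψ '' ball 0 ε = ball p ε

theorem IsChart.mono {ψ : Plane → C} {p : C} {ε δ : ℝ} (h : IsChart ψ p ε) (hδ : 0 < δ)
    (hδε : δ ≤ ε) : IsChart ψ p δ := by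
  refine ⟨hδ, h.zero, h.iso.mono (ball_subset_ball hδε), ?_⟩
  have hd : ∀ z ∈ ball (0 : Plane) ε, dist (ψ z) p = dist z 0 := fun z hz => by
    rw [← h.zero, h.iso z hz 0 (mem_ball_self h.pos)]
  ext q
  constructor
  · rintro ⟨z, hz, rfl⟩
    rw [mem_ball, hd z (ball_subset_ball hδε hz)]
    exact hz
  · intro hq
    obtain ⟨z, hz, rfl⟩ : q ∈ ψ '' ball 0 ε := h.image ▸ ball_subset_ball hδε hq
    exact ⟨z, by rw [mem_ball, ← hd z hz]; exact hq, rfl⟩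

/-- Distances to the centre are preserved, so the image lies in the ball automatically; only
surjectivity has to be supplied. -/
theorem exists_iso_of_image_ball {ψ : Plane → C} {c : Plane} {ε : ℝ} (hε : 0 < ε)
    (h : IsoOn ψ (ball c ε)) (h' : ball (ψ c) ε ⊆ ψ '' ball c ε) :
    IsChart (fun z => ψ (c + z)) (ψ c) ε := by
  have hm : ∀ z, z ∈ ball (0 : Plane) ε ↔ c + z ∈ ball c ε := fun z => by simp
  refine ⟨hε, by simp, fun z hz w hw => ?_, ?_⟩
  · rw [h _ ((hm z).1 hz) _ ((hm w).1 hw), dist_add_left]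
  · apply Subset.antisymm
    · rintro _ ⟨z, hz, rfl⟩
      have := h _ ((hm z).1 hz) c (mem_ball_self hε)
      rw [mem_ball, this]
      exact (hm z).1 hz
    · intro q hq
      obtain ⟨z, hz, rfl⟩ := h' hq
      exact ⟨z - c, by rw [hm]; simpa using hz, by simp⟩

theorem IsChart.shift {ψ : Plane → C} {p : C} {ε : ℝ} (h : IsChart ψ p ε) {z : Plane} {δ : ℝ}
    (hδ : 0 < δ) (hz : ‖z‖ + δ ≤ ε) : IsChart (fun w => ψ (z + w)) (ψ z) δ := by
  have hsub : ball z δ ⊆ ball 0 ε := ball_subset_ball' (by rw [dist_zero_right]; linarith)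
  have hz0 : z ∈ ball z δ := mem_ball_self hδ
  refine exists_iso_of_image_ball hδ (h.iso.mono hsub) fun q hq => ?_
  have hq' : q ∈ ball p ε := by
    have h1 : dist (ψ z) p = ‖z‖ := by
      rw [← h.zero, h.iso z (hsub hz0) 0 (mem_ball_self h.pos), dist_zero_right]
    have h2 := dist_triangle q (ψ z) p
    rw [mem_ball] at hq ⊢
    linarith
  rw [← h.image] at hq'
  obtain ⟨w, hw, rfl⟩ := hq'
  refine ⟨w, ?_, rfl⟩
  rw [mem_ball, ← h.iso w hw z (hsub hz0)]
  exact hq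

theorem IsChart.locallyEuclideanAt {ψ : Plane → C} {p : C} {ε : ℝ} (h : IsChart ψ p ε) :
    LocallyEuclideanAt p := by
  refine ⟨ε, h.pos, ⟨IsometryEquiv.symm ?_⟩⟩
  have hq : ∀ q : ball p ε, q.1 ∈ ψ '' ball 0 ε := fun q => by rw [h.image]; exact q.2
  refine IsometryEquiv.mk' (α := ball (0 : Plane) ε) (β := ball p ε)
    (fun z => ⟨ψ z, by rw [← h.image]; exact mem_image_of_mem ψ z.2⟩)
    (fun q => ⟨(hq q).choose, (hq q).choose_spec.1⟩) (fun q => ?_) ?_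
  · exact Subtype.ext (hq q).choose_spec.2
  · exact Isometry.of_dist_eq fun z w => h.iso z z.2 w w.2

/-- The given isometry of balls is not assumed to send `p` to the centre, but it must: all points of
the ball are closer than `ε` to `p`, whereas a noncentral point of a Euclidean disk has points of
the disk farther away than `ε`. -/
theorem exists_isChart {p : C} (h : LocallyEuclideanAt p) :
    ∃ (ψ : Plane → C) (ε : ℝ), IsChart ψ p ε := by
  obtain ⟨ε, hε, ⟨e⟩⟩ := h
  have hp : p ∈ ball p ε := mem_ball_self hε
  set z0 : ball (0 : Plane) ε := e ⟨p, hp⟩ with hz0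
  have hzero : z0.1 = 0 := by
    by_contra hne
    have hn : 0 < ‖z0.1‖ := norm_pos_iff.2 hne
    have hlt : ‖z0.1‖ < ε := mem_ball_zero_iff.1 z0.2
    -- With this factor `-(t • z0)` still lies in the disk, while its distance from `z0` is `ε +
    -- ‖z0‖ / 2`.
    set t : ℝ := (ε - ‖z0.1‖ / 2) / ‖z0.1‖ with ht
    have ht0 : 0 < t := div_pos (by linarith) hn
    have hnt : ‖-(t • z0.1)‖ = ε - ‖z0.1‖ / 2 := by
      rw [norm_neg, norm_smul, Real.norm_of_nonneg ht0.le, ht, div_mul_cancel₀ _ hn.ne']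
    set w : ball (0 : Plane) ε := ⟨-(t • z0.1), by rw [mem_ball, dist_zero_right, hnt]; linarith⟩
    have h1 : dist (e.symm w) ⟨p, hp⟩ = dist w z0 := by
      rw [hz0, ← e.dist_eq, e.apply_symm_apply]
    have h2 : dist (e.symm w) ⟨p, hp⟩ < ε := (e.symm w).2
    have h3 : dist w z0 = ε + ‖z0.1‖ / 2 := by
      rw [Subtype.dist_eq, dist_eq_norm]
      have : -(t • z0.1) - z0.1 = (-(t + 1)) • z0.1 := by
        rw [neg_smul, add_smul, one_smul]; abel
      change ‖-(t • z0.1) - z0.1‖ = _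
      rw [this, norm_smul, norm_neg, Real.norm_of_nonneg (by linarith), add_mul, one_mul, ht,
        div_mul_cancel₀ _ hn.ne']
      ring
    linarith
  classical
  refine ⟨fun z => if hz : z ∈ ball (0 : Plane) ε then (e.symm ⟨z, hz⟩ : C) else p, ε, hε, ?_, ?_, ?_⟩
  · have h0 : (0 : Plane) ∈ ball (0 : Plane) ε := mem_ball_self hε
    rw [dif_pos h0]
    have : (⟨0, h0⟩ : ball (0 : Plane) ε) = z0 := Subtype.ext hzero.symm
    rw [this, hz0, e.symm_apply_apply]
  · intro z hz w hw
    dsimp only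
    rw [dif_pos hz, dif_pos hw, ← Subtype.dist_eq, e.symm.dist_eq, Subtype.dist_eq]
  · ext q
    constructor
    · rintro ⟨z, hz, rfl⟩
      dsimp only
      rw [dif_pos hz]
      exact (e.symm ⟨z, hz⟩).2
    · intro hq
      refine ⟨e ⟨q, hq⟩, (e ⟨q, hq⟩).2, ?_⟩
      dsimp only
      rw [dif_pos (e ⟨q, hq⟩).2]
      simp

theorem isOpen_locallyEuclidean : IsOpen {p : C | LocallyEuclideanAt p} := by
  rw [Metric.isOpen_iff]
  intro p hp
  obtain ⟨ψ, ε, h⟩ := exists_isChart hp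
  refine ⟨ε, h.pos, fun q hq => ?_⟩
  rw [← h.image] at hq
  obtain ⟨z, hz, rfl⟩ := hq
  have hz' : ‖z‖ < ε := by simpa using hz
  exact (h.shift (δ := ε - ‖z‖) (by linarith) (by linarith)).locallyEuclideanAt

/-! ### Euclidean cones -/

theorem exists_coe_eq_abs_eq_norm {θ : ℝ} (x : AddCircle θ) :
    ∃ β : ℝ, (β : AddCircle θ) = x ∧ |β| = ‖x‖ := by
  induction x using QuotientAddGroup.induction_on with
  | H x =>
    refine ⟨x - round (θ⁻¹ * x) * θ, ?_, (AddCircle.norm_eq θ).symm⟩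
    rw [AddCircle.coe_sub, sub_eq_self, ← zsmul_eq_mul, AddCircle.coe_zsmul, AddCircle.coe_period,
      smul_zero]

theorem norm_le_half {θ : ℝ} (hθ : 0 < θ) (x : AddCircle θ) : ‖x‖ ≤ θ / 2 := by
  simpa [abs_of_pos hθ] using AddCircle.norm_le_half_period θ (x := x) hθ.ne'

/-- Angular distances are at most `θ / 2 < π`, so the truncation at `π` in `coneDist` never acts
when the curvature is positive. -/
theorem coneDist_eq_of_norm {θ : ℝ} (hθ : 0 < θ) (hθ' : θ < 2 * Real.pi) (r r' : ℝ)
    (a a' : AddCircle θ) :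
    coneDist θ r a r' a' = Real.sqrt (r ^ 2 + r' ^ 2 - 2 * r * r' * Real.cos ‖a - a'‖) := by
  rw [coneDist, min_eq_left]
  linarith [norm_le_half hθ (a - a')]

theorem coneDist_zero_right {θ r : ℝ} (hr : 0 ≤ r) (a a' : AddCircle θ) :
    coneDist θ r a 0 a' = r := by
  simp [coneDist, Real.sqrt_sq hr]

/-- Law of cosines in polar coordinates, the form in which plane distances are compared with
`coneDist`. -/
theorem norm_sub_sq_polar (z w : ℂ) :
    ‖z - w‖ ^ 2 = ‖z‖ ^ 2 + ‖w‖ ^ 2 - 2 * ‖z‖ * ‖w‖ * Real.cos (z.arg - w.arg) := by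
  have h1 := Complex.norm_mul_cos_arg z
  have h2 := Complex.norm_mul_sin_arg z
  have h3 := Complex.norm_mul_cos_arg w
  have h4 := Complex.norm_mul_sin_arg w
  have e : 2 * ‖z‖ * ‖w‖ * Real.cos (z.arg - w.arg) = 2 * (z.re * w.re + z.im * w.im) := by
    rw [Real.cos_sub, ← h1, ← h2, ← h3, ← h4]; ring
  rw [e, ← Complex.normSq_eq_norm_sq, ← Complex.normSq_eq_norm_sq, ← Complex.normSq_eq_norm_sq,
    Complex.normSq_apply, Complex.normSq_apply, Complex.normSq_apply]
  simp only [Complex.sub_re, Complex.sub_im]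
  ring

/-- Opposite points on a small circle about the centre of a Euclidean disk are two radii apart. On a
cone of angle less than `2π` two points of that circle subtend an angle less than `π`, so they are
closer than that. -/
theorem not_isPositiveConePoint {p : C} (h : LocallyEuclideanAt p) : ¬ IsPositiveConePoint p := by
  rintro ⟨θ, hθ, hθ', ε', φ, hε', hφ0, hφd, hφs⟩
  obtain ⟨ψ, ε, hψ⟩ := exists_isChart h
  set s : ℝ := min ε ε' / 2 with hs
  have hs0 : 0 < s := by have := lt_min hψ.pos hε'; positivity
  have hsε : s < ε := by have := min_le_left ε ε'; have := hψ.pos; linarith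
  have hsε' : s < ε' := by have := min_le_right ε ε'; linarith
  set z : Plane := s • EuclideanSpace.basisFun (Fin 2) ℝ 0 with hz
  have hzn : ‖z‖ = s := by
    rw [hz, norm_smul, OrthonormalBasis.norm_eq_one, Real.norm_of_nonneg hs0.le, mul_one]
  have hzm : z ∈ ball (0 : Plane) ε := by rw [mem_ball_zero_iff, hzn]; exact hsε
  have hzm' : -z ∈ ball (0 : Plane) ε := by rw [mem_ball_zero_iff, norm_neg, hzn]; exact hsε
  have h0m : (0 : Plane) ∈ ball (0 : Plane) ε := mem_ball_self hψ.pos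
  have hdz : dist (ψ z) p = s := by rw [← hψ.zero, hψ.iso z hzm 0 h0m, dist_zero_right, hzn]
  have hdz' : dist (ψ (-z)) p = s := by
    rw [← hψ.zero, hψ.iso _ hzm' 0 h0m, dist_zero_right, norm_neg, hzn]
  have hdd : dist (ψ z) (ψ (-z)) = 2 * s := by
    rw [hψ.iso z hzm _ hzm', dist_eq_norm, sub_neg_eq_add, ← two_smul ℝ, norm_smul, hzn]; simp
  obtain ⟨r, hr, a, ha⟩ := hφs (ψ z) (by rw [mem_ball, hdz]; exact hsε')
  obtain ⟨r', hr', a', ha'⟩ := hφs (ψ (-z)) (by rw [mem_ball, hdz']; exact hsε')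
  have h1 : r = s := by
    rw [← hdz, ← hφ0 0, ← ha, hφd r hr 0 ⟨le_rfl, hε'⟩, coneDist_zero_right hr.1]
  have h2 : r' = s := by
    rw [← hdz', ← hφ0 0, ← ha', hφd r' hr' 0 ⟨le_rfl, hε'⟩, coneDist_zero_right hr'.1]
  have h3 : coneDist θ s a s a' = 2 * s := by
    rw [← hdd, ← ha, ← ha', hφd r hr r' hr', h1, h2]
  rw [coneDist_eq_of_norm hθ hθ'] at h3
  have h4 := norm_le_half hθ (a - a')
  have h5 : -1 < Real.cos ‖a - a'‖ := by
    rw [← Real.cos_pi]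
    exact Real.cos_lt_cos_of_nonneg_of_le_pi (norm_nonneg _) le_rfl (by linarith)
  have h6 := Real.sqrt_eq_iff_mul_self_eq_of_pos (by linarith : 0 < 2 * s) |>.1 h3
  nlinarith [mul_pos (mul_pos hs0 hs0) (by linarith : 0 < 1 + Real.cos ‖a - a'‖)]

/-- Near a point other than the apex of a cone ball there are charts in which the distance to the
apex is the distance to a point of the plane. -/
structure IsConeRadius (v : C) (ε : ℝ) : Prop where
  pos : 0 < ε
  exists_chart : ∀ q ∈ ball v ε, q ≠ v → ∃ (ψ : Plane → C) (δ : ℝ) (z₀ : Plane),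
    IsChart ψ q δ ∧ ∀ z ∈ ball (0 : Plane) δ, dist (ψ z) v = dist z z₀
  isPreconnected : ∀ ρ ≤ ε, IsPreconnected (ball v ρ \ {v})
  nonempty : ∀ ρ, 0 < ρ → (ball v ρ \ {v}).Nonempty

theorem IsConeRadius.mono {v : C} {ε δ : ℝ} (h : IsConeRadius v ε) (hδ : 0 < δ) (hδε : δ ≤ ε) :
    IsConeRadius v δ :=
  ⟨hδ, fun q hq => h.exists_chart q (ball_subset_ball hδε hq),
    fun ρ hρ => h.isPreconnected ρ (hρ.trans hδε), h.nonempty⟩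

/-- Directions differing by at most `θ / 2` are joined by the short way round, so such a part of the
cone unrolls isometrically into the plane. -/
theorem coneDist_polar {θ : ℝ} (hθ : 0 < θ) (hθ' : θ < 2 * Real.pi) (a : AddCircle θ) {z w : ℂ}
    (h : |z.arg - w.arg| ≤ θ / 2) :
    coneDist θ ‖z‖ (a + (z.arg : ℝ)) ‖w‖ (a + (w.arg : ℝ)) = dist z w := by
  rw [coneDist_eq_of_norm hθ hθ', add_sub_add_left_eq_sub, ← AddCircle.coe_sub,
    (AddCircle.norm_coe_eq_abs_iff θ hθ.ne').2 (by rwa [abs_of_pos hθ]), Real.cos_abs,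
    ← norm_sub_sq_polar, Real.sqrt_sq (norm_nonneg _), dist_eq_norm]

/-- A sector about the ray through `q` is unrolled by complex polar coordinates. The apex
corresponds to the origin of `ℂ`, which becomes `z₀` once the chart is recentred at `q`. -/
theorem exists_chart_of_cone {p q : C} {θ ε : ℝ} {φ : ℝ → AddCircle θ → C} (hθ : 0 < θ)
    (hθ' : θ < 2 * Real.pi) (hφ0 : ∀ a, φ 0 a = p)
    (hφd : ∀ r ∈ Set.Ico 0 ε, ∀ r' ∈ Set.Ico 0 ε, ∀ a a',
      dist (φ r a) (φ r' a') = coneDist θ r a r' a')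
    (hφs : ∀ q ∈ Metric.ball p ε, ∃ r ∈ Set.Ico 0 ε, ∃ a, φ r a = q)
    (hq : q ∈ ball p ε) (hqp : q ≠ p) :
    ∃ (ψ : Plane → C) (δ : ℝ) (z₀ : Plane),
      IsChart ψ q δ ∧ ∀ z ∈ ball (0 : Plane) δ, dist (ψ z) p = dist z z₀ := by
  obtain ⟨s, hs, a, rfl⟩ := hφs q hq
  have hε : 0 < ε := hs.1.trans_lt hs.2
  have hs0 : 0 < s := by
    rcases hs.1.eq_or_lt with h | h
    · exact absurd (by rw [← h, hφ0]) hqp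
    · exact h
  -- The bound `θ / 4` on each argument bounds differences of arguments by `θ / 2`.
  have harg : ∀ᶠ z : ℂ in 𝓝 (s : ℂ), |z.arg| < θ / 4 := by
    have hc := (Complex.continuousAt_arg (x := (s : ℂ)) (by simp [Complex.slitPlane, hs0])).abs
    have h0 : |(s : ℂ).arg| < θ / 4 := by
      rw [Complex.arg_ofReal_of_nonneg hs0.le, abs_zero]; positivity
    exact hc.eventually (gt_mem_nhds h0)
  obtain ⟨δ₀, hδ₀, hδarg⟩ := Metric.eventually_nhds_iff_ball.1 harg
  set δ := min δ₀ (ε - s) with hδ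
  have hδpos : 0 < δ := lt_min hδ₀ (by linarith [hs.2])
  have hsC : ‖(s : ℂ)‖ = s := by rw [Complex.norm_real, Real.norm_of_nonneg hs0.le]
  have hargb : ∀ z ∈ ball (s : ℂ) δ, |z.arg| < θ / 4 := fun z hz =>
    hδarg z (ball_subset_ball (min_le_left _ _) hz)
  have hnb : ∀ z ∈ ball (s : ℂ) δ, ‖z‖ ∈ Ico 0 ε := fun z hz => by
    refine ⟨norm_nonneg _, ?_⟩
    have h1 : dist z s < ε - s := (mem_ball.1 hz).trans_le (min_le_right _ _)
    have h2 := norm_le_norm_add_norm_sub' z (s : ℂ)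
    rw [dist_eq_norm] at h1
    linarith
  let J : ℂ ≃ₗᵢ[ℝ] Plane := Complex.orthonormalBasisOneI.repr
  have hJ : ∀ z, z ∈ ball (J s) δ ↔ J.symm z ∈ ball (s : ℂ) δ := fun z => by
    rw [mem_ball, mem_ball, ← J.symm.dist_map z, J.symm_apply_apply]
  let ψ : Plane → C := fun z => φ ‖J.symm z‖ (a + ((J.symm z).arg : ℝ))
  have hψs : ψ (J s) = φ s a := by
    simp only [ψ, J.symm_apply_apply, hsC, Complex.arg_ofReal_of_nonneg hs0.le,
      AddCircle.coe_zero, add_zero]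
  have hiso : IsoOn ψ (ball (J s) δ) := fun z hz w hw => by
    have hz' := (hJ z).1 hz
    have hw' := (hJ w).1 hw
    simp only [ψ]
    rw [hφd _ (hnb _ hz') _ (hnb _ hw'), coneDist_polar hθ hθ', J.symm.dist_map]
    have := abs_sub (J.symm z).arg (J.symm w).arg
    linarith [hargb _ hz', hargb _ hw']
  refine ⟨fun z => ψ (J s + z), δ, -J s, ?_, fun z hz => ?_⟩
  · rw [← hψs]
    refine exists_iso_of_image_ball hδpos hiso fun q hq => ?_
    rw [hψs] at hq
    have hqε : q ∈ ball p ε := by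
      have h1 : dist (φ s a) p = s := by
        rw [← hφ0 0, hφd s hs 0 ⟨le_rfl, hε⟩, coneDist_zero_right hs.1]
      have h2 := dist_triangle q (φ s a) p
      have h3 : dist q (φ s a) < ε - s := (mem_ball.1 hq).trans_le (min_le_right _ _)
      rw [mem_ball]
      linarith
    obtain ⟨s', hs', a', rfl⟩ := hφs q hqε
    obtain ⟨β, hβ, hβn⟩ := exists_coe_eq_abs_eq_norm (a' - a)
    have hβθ : |β| ≤ θ / 2 := hβn ▸ norm_le_half hθ _
    have ha' : a' = a + (β : ℝ) := by rw [hβ]; abel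
    -- If the point were the apex, then `s < δ`, and the disk about `s` would contain negative
    -- numbers, whose argument `π` violates the bound `θ / 4`.
    rcases hs'.1.eq_or_lt with h0 | h0
    · subst h0
      exfalso
      rw [mem_ball, dist_comm, hφd s hs 0 hs', coneDist_zero_right hs.1] at hq
      have h1 : (0 : ℂ) ∈ ball (s : ℂ) (δ₀ ⊓ δ₀) := by
        rw [mem_ball, dist_comm, dist_zero_right, hsC, inf_idem]
        exact hq.trans_le (min_le_left _ _)
      have h2 : ∀ t ∈ Ioo (0 : ℝ) (δ - s), False := by
        intro t ht
        have h3 : ((-t : ℝ) : ℂ) ∈ ball (s : ℂ) δ := by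
          rw [mem_ball, dist_eq_norm, ← Complex.ofReal_sub, Complex.norm_real, Real.norm_eq_abs,
            abs_lt]
          constructor <;> linarith [ht.1, ht.2]
        have h4 := hargb _ h3
        rw [Complex.arg_ofReal_of_neg (by linarith [ht.1]), abs_of_pos Real.pi_pos] at h4
        linarith
      exact h2 ((δ - s) / 2) ⟨by linarith, by linarith⟩
    · set z : ℂ := s' * (Complex.cos β + Complex.sin β * Complex.I) with hz
      have hzn : ‖z‖ = s' := by
        rw [hz, ← Complex.exp_mul_I, norm_mul, Complex.norm_real, Complex.norm_exp_ofReal_mul_I,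
          Real.norm_of_nonneg h0.le, mul_one]
      have hpi : θ / 2 < Real.pi := by linarith
      have hza : z.arg = β :=
        Complex.arg_mul_cos_add_sin_mul_I h0 ⟨by linarith [neg_le_of_abs_le hβθ],
          by linarith [le_of_abs_le hβθ]⟩
      have hzδ : z ∈ ball (s : ℂ) δ := by
        rw [mem_ball, ← coneDist_polar hθ hθ' a]
        · rw [hzn, hza, hsC, Complex.arg_ofReal_of_nonneg hs0.le, AddCircle.coe_zero, add_zero,
            ← ha', ← hφd s' hs' s hs]
          exact hq
        · rwa [hza, Complex.arg_ofReal_of_nonneg hs0.le, sub_zero]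
      refine ⟨J z, by rw [hJ, J.symm_apply_apply]; exact hzδ, ?_⟩
      simp only [ψ, J.symm_apply_apply, hzn, hza, ha']
  · have hz' : J s + z ∈ ball (J s) δ := by simpa using hz
    have hz'' := hnb _ ((hJ _).1 hz')
    simp only [ψ]
    rw [← hφ0 0, hφd _ hz'' 0 ⟨le_rfl, hε⟩, coneDist_zero_right hz''.1, J.symm.norm_map,
      dist_eq_norm, sub_neg_eq_add, add_comm]

/-- In polar coordinates the punctured ball is the image of an interval times a circle, hence
connected. -/
theorem IsPositiveConePoint.exists_isConeRadius {p : C} (h : IsPositiveConePoint p) :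
    ∃ ε, IsConeRadius p ε := by
  obtain ⟨θ, hθ, hθ', ε, φ, hε, hφ0, hφd, hφs⟩ := h
  have hdp : ∀ r ∈ Ico 0 ε, ∀ a, dist (φ r a) p = r := fun r hr a => by
    rw [← hφ0 0, hφd r hr 0 ⟨le_rfl, hε⟩, coneDist_zero_right hr.1]
  refine ⟨ε, hε, fun q hq hqp => exists_chart_of_cone hθ hθ' hφ0 hφd hφs hq hqp,
    fun ρ hρ => ?_, fun ρ hρ => ?_⟩
  · have himg : ball p ρ \ {p} = (fun x : ℝ × AddCircle θ => φ x.1 x.2) '' (Ioo 0 ρ ×ˢ univ) := by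
      ext q
      constructor
      · rintro ⟨hq, hqp⟩
        obtain ⟨r, hr, a, rfl⟩ := hφs q (ball_subset_ball hρ hq)
        have hrq := hdp r hr a
        refine ⟨(r, a), ⟨⟨?_, ?_⟩, trivial⟩, rfl⟩
        · rw [← hrq]; exact dist_pos.2 hqp
        · rw [← hrq]; exact hq
      · rintro ⟨⟨r, a⟩, ⟨hr, -⟩, rfl⟩
        have hrq := hdp r ⟨hr.1.le, hr.2.trans_le hρ⟩ a
        refine ⟨by rw [mem_ball]; simpa only [hrq] using hr.2, fun h => ?_⟩
        rw [mem_singleton_iff] at h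
        dsimp only at h
        rw [h, dist_self] at hrq
        exact hr.1.ne hrq
    rw [himg]
    refine (isPreconnected_Ioo.prod isPreconnected_univ).image _ ?_
    rintro ⟨r, a⟩ ⟨hr, -⟩
    rw [ContinuousWithinAt, tendsto_iff_dist_tendsto_zero]
    have hcont : Continuous fun x : ℝ × AddCircle θ => coneDist θ x.1 x.2 r a := by
      unfold coneDist
      fun_prop
    have h0 : coneDist θ r a r a = 0 := by
      rw [coneDist_eq_of_norm hθ hθ', sub_self, norm_zero, Real.cos_zero]
      have : r ^ 2 + r ^ 2 - 2 * r * r * 1 = 0 := by ring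
      rw [this, Real.sqrt_zero]
    have ht : Tendsto (fun x : ℝ × AddCircle θ => coneDist θ x.1 x.2 r a)
        (𝓝[Ioo 0 ρ ×ˢ univ] (r, a)) (𝓝 0) := by
      rw [← h0]
      exact hcont.continuousAt.tendsto.mono_left nhdsWithin_le_nhds
    refine ht.congr' ?_
    filter_upwards [self_mem_nhdsWithin] with x hx
    rw [hφd _ ⟨hx.1.1.le, hx.1.2.trans_le hρ⟩ _ ⟨hr.1.le, hr.2.trans_le hρ⟩]
  · have hm : 0 < min ε ρ := lt_min hε hρ
    have hr : min ε ρ / 2 ∈ Ico 0 ε := ⟨by positivity, by linarith [min_le_left ε ρ]⟩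
    have := hdp _ hr 0
    refine ⟨φ (min ε ρ / 2) 0, ?_, fun h => ?_⟩
    · rw [mem_ball, this]; linarith [min_le_right ε ρ]
    · rw [mem_singleton_iff] at h
      rw [h, dist_self] at this
      linarith

theorem exists_pos_forall_le {ι : Type*} {s : Set ι} (hs : s.Finite) {f : ι → ℝ}
    (hf : ∀ i ∈ s, 0 < f i) : ∃ η > 0, ∀ i ∈ s, η ≤ f i := by
  rcases s.eq_empty_or_nonempty with rfl | hne
  · exact ⟨1, one_pos, by simp⟩
  · obtain ⟨i, hi, h⟩ := Set.exists_min_image s f hs hne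
    exact ⟨f i, hf i hi, h⟩

/-! ### The cone points -/

theorem locallyEuclideanAt_of_notMem (hC : IsPositiveEuclideanConeMetric C) {p : C}
    (hp : p ∉ conePoints C) : LocallyEuclideanAt p :=
  (hC.locally_cone p).resolve_right hp

theorem notMem_conePoints {p : C} (h : LocallyEuclideanAt p) : p ∉ conePoints C :=
  not_isPositiveConePoint h

theorem isClosed_conePoints (hC : IsPositiveEuclideanConeMetric C) : IsClosed (conePoints C) := by
  have : (conePoints C)ᶜ = {p | LocallyEuclideanAt p} :=
    Subset.antisymm (fun _ hp => locallyEuclideanAt_of_notMem hC hp)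
      fun _ hp => notMem_conePoints hp
  exact ⟨this ▸ isOpen_locallyEuclidean⟩

/-- Cone points are isolated: every other point of a cone ball has a chart, hence is not a cone
point. -/
theorem IsConeRadius.eq_of_mem_conePoints {v : C} {ε : ℝ} (h : IsConeRadius v ε) {q : C}
    (hq : q ∈ ball v ε) (hqV : q ∈ conePoints C) : q = v := by
  by_contra hne
  obtain ⟨ψ, δ, z₀, hψ, -⟩ := h.exists_chart q hq hne
  exact notMem_conePoints hψ.locallyEuclideanAt hqV

theorem finite_conePoints [CompactSpace C] (hC : IsPositiveEuclideanConeMetric C) :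
    (conePoints C).Finite := by
  have hcpt : IsCompact (conePoints C) := (isClosed_conePoints hC).isCompact
  choose! ε hε using fun (v : C) (hv : v ∈ conePoints C) =>
    IsPositiveConePoint.exists_isConeRadius hv
  obtain ⟨t, ht, hcov⟩ := hcpt.elim_nhds_subcover (fun v => ball v (ε v))
    fun v hv => ball_mem_nhds v (hε v hv).pos
  refine t.finite_toSet.subset fun q hq => ?_
  obtain ⟨v, hv, hqv⟩ := mem_iUnion₂.1 (hcov hq)
  rwa [(hε v (ht v hv)).eq_of_mem_conePoints hqv hq]

/-- A common cone radius for all cone points. -/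
theorem exists_isConeRadius [CompactSpace C] (hC : IsPositiveEuclideanConeMetric C) :
    ∃ ε > 0, ∀ v ∈ conePoints C, IsConeRadius v ε := by
  choose! ε hε using fun (v : C) (hv : v ∈ conePoints C) =>
    IsPositiveConePoint.exists_isConeRadius hv
  obtain ⟨η, hη, h⟩ := exists_pos_forall_le (finite_conePoints hC) fun v hv => (hε v hv).pos
  exact ⟨η, hη, fun v hv => (hε v hv).mono hη (h v hv)⟩

theorem IsChart.notMem_conePoints {ψ : Plane → C} {p : C} {ε : ℝ} (h : IsChart ψ p ε) {z : Plane}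
    (hz : z ∈ ball (0 : Plane) ε) : ψ z ∉ conePoints C := by
  have hz' : ‖z‖ < ε := mem_ball_zero_iff.1 hz
  exact ConeSphere.notMem_conePoints
    (h.shift (δ := ε - ‖z‖) (by linarith) (by linarith)).locallyEuclideanAt

/-- Charts about the points of a compact set can be chosen of the same radius. -/
theorem exists_uniform_isChart (hC : IsPositiveEuclideanConeMetric C) {K : Set C}
    (hK : IsCompact K) (hKV : Disjoint K (conePoints C)) :
    ∃ ε > 0, ∀ p ∈ K, ∃ ψ : Plane → C, IsChart ψ p ε := by
  have key : ∀ p ∈ K, ∃ ε > 0, ∀ q ∈ ball p ε, ∃ ψ : Plane → C, IsChart ψ q ε := by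
    intro p hp
    obtain ⟨ψ, ε, h⟩ := exists_isChart
      (locallyEuclideanAt_of_notMem hC (disjoint_left.1 hKV hp))
    refine ⟨ε / 2, half_pos h.pos, fun q hq => ?_⟩
    rw [← (h.mono (half_pos h.pos) (half_le_self h.pos.le)).image] at hq
    obtain ⟨z, hz, rfl⟩ := hq
    exact ⟨_, h.shift (half_pos h.pos) (by linarith [mem_ball_zero_iff.1 hz])⟩
  choose! ε hε h using key
  obtain ⟨t, ht, hcov⟩ := hK.elim_nhds_subcover (fun v => ball v (ε v))
    fun v hv => ball_mem_nhds v (hε v hv)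
  obtain ⟨η, hη, hηt⟩ := exists_pos_forall_le t.finite_toSet fun v hv => hε v (ht v hv)
  refine ⟨η, hη, fun p hp => ?_⟩
  obtain ⟨v, hv, hpv⟩ := mem_iUnion₂.1 (hcov hp)
  obtain ⟨ψ, hψ⟩ := h v (ht v hv) p hpv
  exact ⟨ψ, hψ.mono hη (hηt v hv)⟩

/-! ### Flat maps -/

/-- `D` maps the open set `U` locally isometrically to the complement of the cone points. -/
def IsFlatOn (D : Plane → C) (U : Set Plane) : Prop :=
  ∀ y ∈ U, D y ∉ conePoints C ∧ ∃ δ > 0, ball y δ ⊆ U ∧ IsoOn D (ball y δ)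

theorem IsFlatOn.isOpen {D : Plane → C} {U : Set Plane} (h : IsFlatOn D U) : IsOpen U :=
  Metric.isOpen_iff.2 fun y hy => by
    obtain ⟨-, δ, hδ, hδU, -⟩ := h y hy
    exact ⟨δ, hδ, hδU⟩

theorem IsFlatOn.continuousAt {D : Plane → C} {U : Set Plane} (h : IsFlatOn D U) {y : Plane}
    (hy : y ∈ U) : ContinuousAt D y := by
  obtain ⟨-, δ, hδ, -, hi⟩ := h y hy
  exact hi.continuousOn.continuousAt (ball_mem_nhds y hδ)

theorem IsFlatOn.continuousOn {D : Plane → C} {U : Set Plane} (h : IsFlatOn D U) :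
    ContinuousOn D U := fun _ hy => (h.continuousAt hy).continuousWithinAt

theorem IsFlatOn.mono {D : Plane → C} {U W : Set Plane} (h : IsFlatOn D U) (hW : IsOpen W)
    (hWU : W ⊆ U) : IsFlatOn D W := fun y hy => by
  obtain ⟨hV, δ, hδ, -, hi⟩ := h y (hWU hy)
  obtain ⟨δ', hδ', hW'⟩ := Metric.isOpen_iff.1 hW y hy
  exact ⟨hV, min δ δ', lt_min hδ hδ', (ball_subset_ball (min_le_right _ _)).trans hW',
    hi.mono (ball_subset_ball (min_le_left _ _))⟩

theorem IsFlatOn.congr {D E : Plane → C} {U : Set Plane} (h : IsFlatOn D U) (hE : EqOn E D U) :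
    IsFlatOn E U := fun y hy => by
  obtain ⟨hV, δ, hδ, hU, hi⟩ := h y hy
  exact ⟨by rwa [hE hy], δ, hδ, hU, hi.congr (hE.mono hU)⟩

theorem IsChart.isFlatOn {ψ : Plane → C} {p : C} {ε : ℝ} (h : IsChart ψ p ε) :
    IsFlatOn ψ (ball 0 ε) := fun y hy => by
  obtain ⟨δ, hδ, hb⟩ := Metric.isOpen_iff.1 isOpen_ball y hy
  exact ⟨h.notMem_conePoints hy, δ, hδ, hb, h.iso.mono hb⟩

theorem IsFlatOn.comp {D : Plane → C} {U : Set Plane} (h : IsFlatOn D U)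
    (A : Plane ≃ᵃⁱ[ℝ] Plane) : IsFlatOn (D ∘ A) (A ⁻¹' U) := fun y hy => by
  obtain ⟨hV, δ, hδ, hU, hi⟩ := h (A y) hy
  have hm : ∀ z ∈ ball y δ, A z ∈ ball (A y) δ := fun z hz => by
    rw [mem_ball, A.dist_map]; exact hz
  exact ⟨hV, δ, hδ, fun z hz => hU (hm z hz), fun z hz w hw => by
    simp only [Function.comp]
    rw [hi _ (hm z hz) _ (hm w hw), A.dist_map]⟩

theorem IsChart.isFlatOn_comp {ψ : Plane → C} {p : C} {ε : ℝ} (h : IsChart ψ p ε)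
    {A : Plane ≃ᵃⁱ[ℝ] Plane} {y : Plane} (hA : A y = 0) : IsFlatOn (ψ ∘ A) (ball y ε) := by
  have : ball y ε = A ⁻¹' ball 0 ε := by
    ext z
    rw [mem_preimage, mem_ball, mem_ball, ← hA, A.dist_map]
  rw [this]
  exact h.isFlatOn.comp A

/-- Following `D` by the inverse of the chart gives a distance-preserving map between parts of the
plane, which is a rigid motion. Thus a flat map is locally a chart, up to a rigid motion. -/
theorem IsFlatOn.exists_eventuallyEq_chart {D : Plane → C} {U : Set Plane} (h : IsFlatOn D U)
    {y : Plane} (hy : y ∈ U) {ψ : Plane → C} {ε : ℝ} (hψ : IsChart ψ (D y) ε) :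
    ∃ A : Plane ≃ᵃⁱ[ℝ] Plane, A y = 0 ∧ D =ᶠ[𝓝 y] ψ ∘ A := by
  obtain ⟨-, δ, hδ, -, hi⟩ := h y hy
  set δ' := min δ ε with hδ'
  have hδ'pos : 0 < δ' := lt_min hδ hψ.pos
  have hy' : y ∈ ball y δ' := mem_ball_self hδ'pos
  have hsub : ball y δ' ⊆ ball y δ := ball_subset_ball (min_le_left _ _)
  have hex : ∀ z ∈ ball y δ', ∃ w ∈ ball (0 : Plane) ε, ψ w = D z := fun z hz => by
    have : D z ∈ ball (D y) ε := by
      rw [mem_ball, hi z (hsub hz) y (hsub hy')]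
      exact (mem_ball.1 hz).trans_le (min_le_right _ _)
    rwa [← hψ.image] at this
  choose! f hf hfD using hex
  have hfi : IsoOn f (ball y δ') := fun z hz w hw => by
    rw [← hψ.iso _ (hf z hz) _ (hf w hw), hfD z hz, hfD w hw, hi z (hsub hz) w (hsub hw)]
  obtain ⟨A, hA⟩ := hfi.exists_affineIsometryEquiv hδ'pos
  refine ⟨A, ?_, ?_⟩
  · rw [← hA hy']
    refine hψ.iso.injOn (hf y hy') (mem_ball_self hψ.pos) ?_
    rw [hfD y hy', hψ.zero]
  · filter_upwards [ball_mem_nhds y hδ'pos] with z hz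
    rw [Function.comp, ← hA hz, hfD z hz]

/-- Unique continuation. -/
theorem IsFlatOn.eqOn (hC : IsPositiveEuclideanConeMetric C) {D E : Plane → C} {U : Set Plane}
    (hU : IsPreconnected U) (hD : IsFlatOn D U) (hE : IsFlatOn E U) {y : Plane} (hy : y ∈ U)
    (h : D =ᶠ[𝓝 y] E) : EqOn D E U := by
  -- The set where the germs agree is open by definition; the work is to show that it is closed in
  -- `U`.
  have hsub : U ⊆ {z | D =ᶠ[𝓝 z] E} := by
    refine hU.subset_of_closure_inter_subset ?_ ⟨y, hy, h⟩ ?_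
    · exact isOpen_iff_mem_nhds.2 fun z hz => eventually_eventually_nhds.2 hz
    · rintro z ⟨hz, hzU⟩
      have hDE : D z = E z := by
        have := mem_closure_iff_nhdsWithin_neBot.1 hz
        refine tendsto_nhds_unique_of_eventuallyEq ((hD.continuousAt hzU).tendsto.mono_left
          nhdsWithin_le_nhds) ((hE.continuousAt hzU).tendsto.mono_left nhdsWithin_le_nhds)
          (?_ : ∀ᶠ w in 𝓝[{z | D =ᶠ[𝓝 z] E}] z, D w = E w)
        filter_upwards [self_mem_nhdsWithin] with w hw
        exact EventuallyEq.eq_of_nhds hw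
      obtain ⟨ψ, ε, hψ⟩ := exists_isChart (locallyEuclideanAt_of_notMem hC (hD z hzU).1)
      obtain ⟨A, hA0, hA⟩ := hD.exists_eventuallyEq_chart hzU hψ
      obtain ⟨B, hB0, hB⟩ := hE.exists_eventuallyEq_chart hzU (hDE ▸ hψ)
      have hA' : ∀ᶠ w in 𝓝 z, A w ∈ ball (0 : Plane) ε :=
        A.continuous.continuousAt.eventually (by rw [hA0]; exact ball_mem_nhds _ hψ.pos)
      have hB' : ∀ᶠ w in 𝓝 z, B w ∈ ball (0 : Plane) ε :=
        B.continuous.continuousAt.eventually (by rw [hB0]; exact ball_mem_nhds _ hψ.pos)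
      have hall := eventually_eventually_nhds.2 (hA.and (hB.and (hA'.and hB')))
      obtain ⟨w, hwu, hw⟩ := ((mem_closure_iff_frequently.1 hz).and_eventually hall).exists
      -- Near the limit point the maps are the same chart composed with `A` and with `B`; these
      -- rigid motions agree near the point `w` of the set, hence everywhere.
      have hAB : A = B := by
        refine affineIsometryEquiv_eq_of_eventuallyEq (y := w) ?_
        filter_upwards [hw, hwu] with x ⟨h1, h2, h3, h4⟩ h5
        exact hψ.iso.injOn h3 h4 (by rw [← Function.comp_apply (f := ψ), ← h1, h5, h2]; rfl)
      subst hAB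
      exact hA.trans hB.symm
  exact fun z hz => EventuallyEq.eq_of_nhds (hsub hz)

/-- Unique continuation spreads the germ identity over the convex overlap, so the size of the region
depends only on the chart and on `U`. -/
theorem IsFlatOn.exists_eqOn_chart (hC : IsPositiveEuclideanConeMetric C) {D : Plane → C}
    {U : Set Plane} (h : IsFlatOn D U) (hU : Convex ℝ U) {y : Plane} (hy : y ∈ U)
    {ψ : Plane → C} {ε : ℝ} (hψ : IsChart ψ (D y) ε) :
    ∃ A : Plane ≃ᵃⁱ[ℝ] Plane, A y = 0 ∧ EqOn D (ψ ∘ A) (U ∩ ball y ε) := by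
  obtain ⟨A, hA0, hA⟩ := h.exists_eventuallyEq_chart hy hψ
  have ho : IsOpen (U ∩ ball y ε) := h.isOpen.inter isOpen_ball
  exact ⟨A, hA0, IsFlatOn.eqOn hC (hU.inter (convex_ball y ε)).isPreconnected
    (h.mono ho inter_subset_left) ((hψ.isFlatOn_comp hA0).mono ho inter_subset_right)
    ⟨hy, mem_ball_self hψ.pos⟩ hA⟩

/-- Two flat maps with a common value differ by a rigid motion. -/
theorem IsFlatOn.exists_overlay (hC : IsPositiveEuclideanConeMetric C) {D E : Plane → C}
    {U W : Set Plane} (hD : IsFlatOn D U) (hE : IsFlatOn E W) {y z : Plane} (hy : y ∈ U)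
    (hz : z ∈ W) (h : D y = E z) :
    ∃ A : Plane ≃ᵃⁱ[ℝ] Plane, A y = z ∧ D =ᶠ[𝓝 y] E ∘ A := by
  obtain ⟨ψ, ε, hψ⟩ := exists_isChart (locallyEuclideanAt_of_notMem hC (hD y hy).1)
  obtain ⟨A, hA0, hA⟩ := hD.exists_eventuallyEq_chart hy hψ
  obtain ⟨B, hB0, hB⟩ := hE.exists_eventuallyEq_chart hz (h ▸ hψ)
  have hBz : B.symm 0 = z := by rw [← hB0, B.symm_apply_apply]
  refine ⟨A.trans B.symm, by simp [hA0, hBz], ?_⟩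
  have ht : Tendsto (A.trans B.symm) (𝓝 y) (𝓝 z) := by
    have := (A.trans B.symm).continuous.tendsto y
    simpa [hA0, hBz] using this
  filter_upwards [hA, ht.eventually hB] with w h1 h2
  rw [Function.comp, h1, h2]
  simp

/-- Gluing of flat maps that agree where both are defined. -/
theorem exists_isFlatOn_iUnion [Nonempty C] {ι : Type*} {U : ι → Set Plane} {D : ι → Plane → C}
    (hD : ∀ i, IsFlatOn (D i) (U i)) (h : ∀ i j, EqOn (D i) (D j) (U i ∩ U j)) :
    ∃ E : Plane → C, IsFlatOn E (⋃ i, U i) ∧ ∀ i, EqOn E (D i) (U i) := by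
  classical
  let E : Plane → C := fun z =>
    if hz : ∃ i, z ∈ U i then D hz.choose z else Classical.arbitrary C
  have hE : ∀ i, EqOn E (D i) (U i) := fun i z hz => by
    have hex : ∃ i, z ∈ U i := ⟨i, hz⟩
    simp only [E, dif_pos hex]
    exact h _ _ ⟨hex.choose_spec, hz⟩
  refine ⟨E, fun y hy => ?_, hE⟩
  obtain ⟨i, hi⟩ := mem_iUnion.1 hy
  obtain ⟨hV, δ, hδ, hU, hiso⟩ := (hD i).congr (hE i) y hi
  exact ⟨hV, δ, hδ, hU.trans (subset_iUnion _ _), hiso⟩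

/-! ### Flat maps of disks -/

/-- A local isometry does not lengthen segments. The bound is propagated along the segment by
continuous induction: the parameters for which it holds form a closed set, and local isometry pushes
it further to the right. -/
theorem IsFlatOn.dist_le {D : Plane → C} {U : Set Plane} (h : IsFlatOn D U) (hU : Convex ℝ U)
    {y z : Plane} (hy : y ∈ U) (hz : z ∈ U) : dist (D y) (D z) ≤ dist y z := by
  set g : ℝ → Plane := fun t => AffineMap.lineMap y z t with hg
  have hgU : ∀ t ∈ Icc (0 : ℝ) 1, g t ∈ U := fun t ht => hU.lineMap_mem hy hz ht
  have hgd : ∀ s t, dist (g s) (g t) = |s - t| * dist y z := fun s t => by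
    rw [hg, dist_lineMap_lineMap, Real.dist_eq]
  have hgc : Continuous g := AffineMap.lineMap_continuous
  have hDc : ContinuousOn (fun t => dist (D y) (D (g t))) (Icc 0 1) :=
    continuous_dist.comp_continuousOn
      (continuousOn_const.prodMk (h.continuousOn.comp hgc.continuousOn hgU))
  have key : Icc (0 : ℝ) 1 ⊆ {t | dist (D y) (D (g t)) ≤ t * dist y z} := by
    refine IsClosed.Icc_subset_of_forall_exists_gt ?_ ?_ ?_
    · rw [inter_comm]
      exact isClosed_Icc.isClosed_le hDc (by fun_prop)
    · simp [hg]
    · rintro t ⟨ht, ht0, ht1⟩ s hs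
      obtain ⟨-, δ, hδ, -, hi⟩ := h (g t) (hgU t ⟨ht0, ht1.le⟩)
      have hev : ∀ᶠ u in 𝓝[>] t, g u ∈ ball (g t) δ ∧ u ∈ Ioc t s :=
        ((hgc.continuousAt.eventually (ball_mem_nhds _ hδ)).filter_mono nhdsWithin_le_nhds).and
          (Ioc_mem_nhdsGT hs)
      obtain ⟨u, hu, hus⟩ := hev.exists
      refine ⟨u, ?_, hus⟩
      have h1 := hi (g t) (mem_ball_self hδ) (g u) hu
      have h2 := dist_triangle (D y) (D (g t)) (D (g u))
      have h3 := hgd t u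
      rw [abs_sub_comm, abs_of_pos (by linarith [hus.1])] at h3
      have ht' : dist (D y) (D (g t)) ≤ t * dist y z := ht
      change dist (D y) (D (g u)) ≤ u * dist y z
      nlinarith
  have := key ⟨zero_le_one, le_rfl⟩
  simpa [hg] using this

theorem IsFlatOn.dist_center_lt {D : Plane → C} {c : Plane} {R ρ : ℝ}
    (h : IsFlatOn D (ball c R)) (hρ : ρ ≤ R) {y : Plane} (hy : y ∈ ball c ρ) :
    D y ∈ ball (D c) ρ := by
  have hy' := ball_subset_ball hρ hy
  exact (h.dist_le (convex_ball c R) hy' (mem_ball_self (pos_of_mem_ball hy'))).trans_lt hy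

/-- About each point of the disk `D` continues as a chart composed with a rigid motion on a disk of
radius `ε`. These continuations agree on overlaps by unique continuation, so their union gains `ε`
in radius. -/
theorem exists_isFlatOn_step (hC : IsPositiveEuclideanConeMetric C) {D : Plane → C} {ρ ε : ℝ}
    (hρ : 0 < ρ) (hε : 0 < ε) (hD : IsFlatOn D (ball 0 ρ))
    (hch : ∀ p ∈ ball (D 0) ρ, ∃ ψ : Plane → C, IsChart ψ p ε) :
    ∃ E, IsFlatOn E (ball 0 (ρ + ε)) ∧ EqOn E D (ball 0 ρ) := by
  have hne : Nonempty C := ⟨D 0⟩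
  have hcv := convex_ball (0 : Plane) ρ
  have hDm : ∀ y ∈ ball (0 : Plane) ρ, D y ∈ ball (D 0) ρ := fun y hy =>
    hD.dist_center_lt le_rfl hy
  choose! ψ hψ using hch
  choose! A hA0 hA using fun (y : Plane) (hy : y ∈ ball 0 ρ) =>
    hD.exists_eqOn_chart hC hcv hy (hψ (D y) (hDm y hy))
  have hflat : ∀ y : ball (0 : Plane) ρ, IsFlatOn (ψ (D y) ∘ A y) (ball y.1 ε) := fun y =>
    (hψ (D y) (hDm y y.2)).isFlatOn_comp (hA0 y y.2)
  obtain ⟨E, hE, hED⟩ := exists_isFlatOn_iUnion hflat fun y y' => by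
    intro z hz
    have hz' : z ∈ ball y.1 ε ∩ ball y'.1 ε := hz
    -- If the two small disks meet, the midpoint of their centres lies in both of them and in the
    -- original disk, where both continuations coincide with `D`.
    set m : Plane := midpoint ℝ y.1 y'.1 with hm
    have hyy : dist y.1 y'.1 < 2 * ε := by
      have := dist_triangle_left y.1 y'.1 z
      linarith [mem_ball.1 hz'.1, mem_ball.1 hz'.2]
    have hm0 : m ∈ ball (0 : Plane) ρ := hcv.midpoint_mem y.2 y'.2
    have hm1 : m ∈ ball y.1 ε := by
      rw [mem_ball, dist_comm, hm, dist_left_midpoint]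
      simp; linarith
    have hm2 : m ∈ ball y'.1 ε := by
      rw [mem_ball, hm, dist_midpoint_right]
      simp; linarith
    have ho : IsOpen (ball y.1 ε ∩ ball y'.1 ε) := isOpen_ball.inter isOpen_ball
    refine IsFlatOn.eqOn hC ((convex_ball y.1 ε).inter (convex_ball y'.1 ε)).isPreconnected
      ((hflat y).mono ho inter_subset_left) ((hflat y').mono ho inter_subset_right)
      ⟨hm1, hm2⟩ ?_ hz'
    filter_upwards [isOpen_ball.mem_nhds hm0, ho.mem_nhds ⟨hm1, hm2⟩] with w hw hw'
    rw [← hA y y.2 ⟨hw, hw'.1⟩, ← hA y' y'.2 ⟨hw, hw'.2⟩]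
  refine ⟨E, hE.mono isOpen_ball fun z hz => ?_, fun z hz => ?_⟩
  · rw [mem_iUnion]
    rw [mem_ball_zero_iff] at hz
    have hs : 0 < ρ + ε := by positivity
    -- Radial shrinking brings `z` into the old disk while moving it by less than `ε`.
    refine ⟨⟨(ρ / (ρ + ε)) • z, ?_⟩, ?_⟩
    · rw [mem_ball_zero_iff, norm_smul, Real.norm_of_nonneg (by positivity), div_mul_eq_mul_div,
        div_lt_iff₀ hs]
      exact mul_lt_mul_of_pos_left hz hρ
    · have : z - (ρ / (ρ + ε)) • z = (ε / (ρ + ε)) • z := by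
        rw [← one_smul ℝ z, smul_smul, mul_one, ← sub_smul, one_smul]
        congr 1
        field_simp
        ring
      rw [mem_ball, dist_eq_norm, this, norm_smul, Real.norm_of_nonneg (by positivity),
        div_mul_eq_mul_div, div_lt_iff₀ hs]
      exact mul_lt_mul_of_pos_left hz hε
  · rw [hED ⟨z, hz⟩ (mem_ball_self hε)]
    exact (hA z hz ⟨hz, mem_ball_self hε⟩).symm

/-- For `R' < R` the closed ball of radius `R'` is compact and free of cone points, so charts there
have a common size and finitely many steps reach radius `R'`. The extensions for all `R' < R` are
then glued. -/
theorem IsFlatOn.exists_extension_zero [CompactSpace C] (hC : IsPositiveEuclideanConeMetric C)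
    {ψ : Plane → C} {x : C} {ε₀ R : ℝ} (hψ : IsChart ψ x ε₀)
    (hRV : Disjoint (ball x R) (conePoints C)) :
    ∃ D, IsFlatOn D (ball 0 R) ∧ D =ᶠ[𝓝 0] ψ := by
  have hne : Nonempty C := ⟨x⟩
  have key : ∀ R' : Ioo 0 R, ∃ D, IsFlatOn D (ball 0 R'.1) ∧ D =ᶠ[𝓝 0] ψ := by
    rintro ⟨R', hR0, hR'⟩
    obtain ⟨ε, hε, hch⟩ := exists_uniform_isChart hC (isCompact_closedBall x R')
      (hRV.mono_left (closedBall_subset_ball hR'))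
    have hn : ∀ n : ℕ, ∃ D, IsFlatOn D (ball 0 (min (ε₀ + n * ε) R')) ∧ D =ᶠ[𝓝 0] ψ := by
      intro n
      induction n with
      | zero =>
        exact ⟨ψ, hψ.isFlatOn.mono isOpen_ball (ball_subset_ball (by simp)), EventuallyEq.rfl⟩
      | succ n ih =>
        obtain ⟨D, hD, hDψ⟩ := ih
        have hpos : 0 < min (ε₀ + n * ε) R' :=
          lt_min (by have := hψ.pos; positivity) hR0
        obtain ⟨E, hE, hED⟩ := exists_isFlatOn_step hC hpos hε hD fun p hp => by
          rw [hDψ.eq_of_nhds, hψ.zero] at hp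
          exact hch p (ball_subset_closedBall (ball_subset_ball (min_le_right _ _) hp))
        refine ⟨E, hE.mono isOpen_ball (ball_subset_ball ?_), EventuallyEq.trans ?_ hDψ⟩
        · rw [min_add]
          refine min_le_min ?_ (by linarith)
          push_cast; linarith
        · exact hED.eventuallyEq_of_mem (ball_mem_nhds _ hpos)
    obtain ⟨n, hn'⟩ := exists_nat_gt (R' / ε)
    obtain ⟨D, hD, hDψ⟩ := hn n
    refine ⟨D, ?_, hDψ⟩
    rwa [min_eq_right] at hD
    rw [div_lt_iff₀ hε] at hn'
    linarith [hψ.pos]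
  choose D hD hDψ using key
  obtain ⟨E, hE, hED⟩ := exists_isFlatOn_iUnion hD fun i j => by
    have ho : IsOpen (ball (0 : Plane) i.1 ∩ ball (0 : Plane) j.1) := isOpen_ball.inter isOpen_ball
    exact IsFlatOn.eqOn hC ((convex_ball _ _).inter (convex_ball _ _)).isPreconnected
      ((hD i).mono ho inter_subset_left) ((hD j).mono ho inter_subset_right)
      ⟨mem_ball_self i.2.1, mem_ball_self j.2.1⟩ ((hDψ i).trans (hDψ j).symm)
  by_cases hR : 0 < R
  · refine ⟨E, hE.mono isOpen_ball fun z hz => ?_, ?_⟩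
    · rw [mem_ball_zero_iff] at hz
      obtain ⟨t, ht, ht'⟩ := exists_between hz
      exact mem_iUnion.2 ⟨⟨t, (norm_nonneg z).trans_lt ht, ht'⟩, mem_ball_zero_iff.2 ht⟩
    · let i : Ioo 0 R := ⟨R / 2, by simpa using hR, by simpa using hR⟩
      exact ((hED i).eventuallyEq_of_mem (ball_mem_nhds _ i.2.1)).trans (hDψ i)
  · exact ⟨ψ, fun y hy => absurd (pos_of_mem_ball hy) hR, EventuallyEq.rfl⟩

/-- A germ of a flat map extends to each disk whose radius is at most the distance to the cone
points. -/
theorem IsFlatOn.exists_extension [CompactSpace C] (hC : IsPositiveEuclideanConeMetric C)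
    {D₀ : Plane → C} {U : Set Plane} (hD₀ : IsFlatOn D₀ U) {c : Plane} (hc : c ∈ U) {R : ℝ}
    (hRV : Disjoint (ball (D₀ c) R) (conePoints C)) :
    ∃ D, IsFlatOn D (ball c R) ∧ D =ᶠ[𝓝 c] D₀ := by
  obtain ⟨ψ, ε, hψ⟩ := exists_isChart (locallyEuclideanAt_of_notMem hC (hD₀ c hc).1)
  obtain ⟨A, hA0, hA⟩ := hD₀.exists_eventuallyEq_chart hc hψ
  obtain ⟨E, hE, hEψ⟩ := IsFlatOn.exists_extension_zero hC hψ hRV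
  refine ⟨E ∘ A, ?_, ?_⟩
  · have : ball c R = A ⁻¹' ball 0 R := by
      ext z
      rw [mem_preimage, mem_ball, mem_ball, ← hA0, A.dist_map]
    rw [this]
    exact hE.comp A
  · have ht : Tendsto A (𝓝 c) (𝓝 0) := by simpa [hA0] using A.continuous.tendsto c
    filter_upwards [hA, ht.eventually hEψ] with w h1 h2
    rw [Function.comp, h1, h2, Function.comp]

/-! ### Length metrics -/

/-- A compact length space is geodesically convex. -/
theorem exists_between_of_isLengthMetric [CompactSpace C] (h : IsLengthMetric C) (x q : C) {s : ℝ}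
    (hs : 0 ≤ s) (hsd : s ≤ dist x q) : ∃ z, dist x z = s ∧ dist z q = dist x q - s := by
  -- On a nearly shortest path a point at distance `s` from `x` is found by the intermediate value
  -- theorem; compactness of the sphere about `x` then removes the error `η`.
  have key : ∀ η > 0, ∃ z, dist x z = s ∧ dist z q < dist x q - s + η := by
    intro η hη
    have hlt : ⨅ γ : Path x q, eVariationOn (fun t => γ t) univ < ENNReal.ofReal (dist x q + η) := by
      rw [← h x q, edist_dist]
      exact (ENNReal.ofReal_lt_ofReal_iff (by positivity)).2 (by linarith)
    obtain ⟨γ, hγ⟩ := iInf_lt_iff.1 hlt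
    have hc : Continuous fun t => dist x (γ t) := continuous_const.dist γ.continuous
    obtain ⟨t, ht⟩ : ∃ t, dist x (γ t) = s := by
      refine mem_range_of_exists_le_of_exists_ge hc ⟨0, by simpa using hs⟩ ⟨1, by simpa using hsd⟩
    refine ⟨γ t, ht, ?_⟩
    have h1 : edist x (γ t) + edist (γ t) q ≤ eVariationOn (fun t => γ t) univ := by
      have e1 := eVariationOn.edist_le (fun t => γ t) (s := Iic t) (x := 0) (y := t)
        (by simp) (by simp)
      have e2 := eVariationOn.edist_le (fun t => γ t) (s := Ici t) (x := t) (y := 1)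
        (by simp) (by simp [unitInterval.le_one'])
      simp only [Path.source, Path.target] at e1 e2
      refine (add_le_add e1 e2).trans ?_
      refine (eVariationOn.add_le_union _ (s := Iic t) (t := Ici t)
        fun a ha b hb => le_trans ha hb).trans ?_
      rw [Iic_union_Ici]
    have h2 := h1.trans_lt hγ
    rw [edist_dist, edist_dist, ← ENNReal.ofReal_add dist_nonneg dist_nonneg,
      ENNReal.ofReal_lt_ofReal_iff (by positivity), ht] at h2
    linarith
  have hcpt : IsCompact {z | dist x z = s} :=
    (isClosed_eq (continuous_const.dist continuous_id) continuous_const).isCompact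
  obtain ⟨z₀, hz₀, -⟩ := key 1 one_pos
  obtain ⟨z, hz, hmin⟩ := hcpt.exists_isMinOn ⟨z₀, hz₀⟩
    (f := fun z => dist z q) (by fun_prop : Continuous fun z => dist z q).continuousOn
  have hz : dist x z = s := hz
  refine ⟨z, hz, le_antisymm (le_of_forall_pos_lt_add fun η hη => ?_) ?_⟩
  · obtain ⟨w, hw, hw'⟩ := key η hη
    exact (hmin hw).trans_lt hw'
  · linarith [dist_triangle x z q]

/-- A smaller closed disk has compact image free of cone points, so the charts there have a common
radius, which serves for all `w` at once. -/
theorem IsFlatOn.exists_uniform_isoOn [CompactSpace C] (hC : IsPositiveEuclideanConeMetric C)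
    {D : Plane → C} {c : Plane} {R ρ : ℝ} (hD : IsFlatOn D (ball c R)) (hρ : ρ < R) :
    ∃ δ > 0, ∀ w ∈ closedBall c ρ, ball w δ ⊆ ball c R ∧ IsoOn D (ball w δ) ∧
      ball (D w) δ ⊆ D '' ball w δ := by
  have hsub : closedBall c ρ ⊆ ball c R := closedBall_subset_ball hρ
  have hcpt : IsCompact (D '' closedBall c ρ) :=
    (isCompact_closedBall c ρ).image_of_continuousOn (hD.continuousOn.mono hsub)
  obtain ⟨ε, hε, hch⟩ := exists_uniform_isChart hC hcpt (disjoint_left.2 (by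
    rintro _ ⟨z, hz, rfl⟩
    exact (hD z (hsub hz)).1))
  refine ⟨min ε (R - ρ), lt_min hε (by linarith), fun w hw => ?_⟩
  obtain ⟨ψ, hψ⟩ := hch (D w) (mem_image_of_mem D hw)
  obtain ⟨A, hA0, hA⟩ := hD.exists_eqOn_chart hC (convex_ball c R) (hsub hw) hψ
  have h1 : ball w (min ε (R - ρ)) ⊆ ball c R :=
    ball_subset_ball' (by linarith [min_le_right ε (R - ρ), mem_closedBall.1 hw])
  have h2 : ball w (min ε (R - ρ)) ⊆ ball c R ∩ ball w ε :=
    subset_inter h1 (ball_subset_ball (min_le_left _ _))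
  have hAm : ∀ z δ, z ∈ ball w δ ↔ A z ∈ ball 0 δ := fun z δ => by
    rw [mem_ball, mem_ball, ← hA0, A.dist_map]
  refine ⟨h1, fun z hz z' hz' => ?_, fun q hq => ?_⟩
  · rw [hA (h2 hz), hA (h2 hz'), Function.comp, Function.comp,
      hψ.iso _ ((hAm _ _).1 (h2 hz).2) _ ((hAm _ _).1 (h2 hz').2), A.dist_map]
  · rw [← (hψ.mono (lt_min hε (by linarith)) (min_le_left _ _)).image] at hq
    obtain ⟨u, hu, rfl⟩ := hq
    have hu' : A.symm u ∈ ball w (min ε (R - ρ)) := by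
      rw [hAm, A.apply_symm_apply]; exact hu
    refine ⟨A.symm u, hu', ?_⟩
    rw [hA (h2 hu'), Function.comp, A.apply_symm_apply]

/-- A shortest path from `D y` to `q` is lifted in short steps. The lift is no longer than the path,
so the assumed bound keeps it inside the disk. -/
theorem IsFlatOn.exists_preimage [CompactSpace C] (hC : IsPositiveEuclideanConeMetric C)
    {D : Plane → C} {c : Plane} {R : ℝ} (hD : IsFlatOn D (ball c R)) {y : Plane} {q : C}
    (h : dist y c + dist (D y) q < R) :
    ∃ z ∈ ball c R, D z = q ∧ dist y z ≤ dist (D y) q := by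
  set ρ := dist y c + dist (D y) q with hρ
  obtain ⟨δ, hδ, hunif⟩ := hD.exists_uniform_isoOn hC h
  -- The sum of the distance from the centre and the distance still to be covered never increases;
  -- `n` bounds the number of steps of length at most `δ / 2`.
  have key : ∀ n : ℕ, ∀ w : Plane, dist w c + dist (D w) q ≤ ρ → dist (D w) q ≤ n * (δ / 2) →
      ∃ z, D z = q ∧ dist w z ≤ dist (D w) q := by
    intro n
    induction n with
    | zero =>
      intro w _ hw
      have : dist (D w) q = 0 := le_antisymm (by simpa using hw) dist_nonneg
      exact ⟨w, dist_eq_zero.1 this, by simp⟩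
    | succ n ih =>
      intro w hw hwn
      push_cast at hwn
      obtain ⟨p, hp1, hp2⟩ := exists_between_of_isLengthMetric hC.isLengthMetric (D w) q
        (s := min (dist (D w) q) (δ / 2)) (le_min dist_nonneg (by positivity)) (min_le_left _ _)
      obtain ⟨h1, h2, h3⟩ := hunif w (by
        rw [mem_closedBall]; linarith [dist_nonneg (x := D w) (y := q)])
      have hpm : p ∈ ball (D w) δ := by
        rw [mem_ball, dist_comm, hp1]
        linarith [min_le_right (dist (D w) q) (δ / 2)]
      obtain ⟨w', hw', rfl⟩ := h3 hpm
      have hd : dist w w' = min (dist (D w) q) (δ / 2) := by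
        rw [← hp1, h2 w (mem_ball_self hδ) w' hw']
      obtain ⟨z, hz, hz'⟩ := ih w' (by linarith [dist_triangle_left w' c w]) (by
        rw [hp2]
        rcases min_cases (dist (D w) q) (δ / 2) with ⟨h, -⟩ | ⟨h, -⟩
        · rw [h, sub_self]; positivity
        · rw [h]; linarith)
      exact ⟨z, hz, by linarith [dist_triangle w w' z]⟩
  obtain ⟨n, hn⟩ := exists_nat_gt (dist (D y) q / (δ / 2))
  rw [div_lt_iff₀ (by positivity)] at hn
  obtain ⟨z, hz, hz'⟩ := key n y le_rfl hn.le
  refine ⟨z, ?_, hz, hz'⟩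
  rw [mem_ball]
  linarith [dist_triangle_left z c y]

theorem IsFlatOn.image_ball [CompactSpace C] (hC : IsPositiveEuclideanConeMetric C)
    {D : Plane → C} {c : Plane} {R : ℝ} (hD : IsFlatOn D (ball c R)) :
    D '' ball c R = ball (D c) R := by
  apply Subset.antisymm
  · rintro _ ⟨z, hz, rfl⟩
    exact hD.dist_center_lt le_rfl hz
  · intro q hq
    obtain ⟨z, hz, hzq, -⟩ := hD.exists_preimage hC (y := c) (q := q) (by
      rw [dist_self, zero_add, dist_comm]; exact hq)
    exact ⟨z, hz, hzq⟩

theorem IsFlatOn.disjoint_ball [CompactSpace C] (hC : IsPositiveEuclideanConeMetric C)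
    {D : Plane → C} {c : Plane} {R : ℝ} (hD : IsFlatOn D (ball c R)) :
    Disjoint (ball (D c) R) (conePoints C) := by
  rw [← hD.image_ball hC, disjoint_left]
  rintro _ ⟨z, hz, rfl⟩
  exact (hD z hz).1

/-! ### Delaunay disks -/

theorem coneRadius_le_dist {x v : C} (hv : v ∈ conePoints C) : coneRadius x ≤ dist x v :=
  infDist_le_dist_of_mem hv

theorem disjoint_ball_coneRadius (x : C) : Disjoint (ball x (coneRadius x)) (conePoints C) :=
  disjoint_ball_infDist

theorem coneRadius_le_add (x y : C) : coneRadius x ≤ coneRadius y + dist x y :=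
  infDist_le_infDist_add_dist

theorem coneRadius_pos (hC : IsPositiveEuclideanConeMetric C) (hV : (conePoints C).Nonempty)
    {x : C} (hx : x ∉ conePoints C) : 0 < coneRadius x :=
  ((isClosed_conePoints hC).notMem_iff_infDist_pos hV).1 hx

theorem le_coneRadius (hV : (conePoints C).Nonempty) {x : C} {R : ℝ}
    (h : Disjoint (ball x R) (conePoints C)) : R ≤ coneRadius x :=
  (le_infDist hV).2 fun v hv => by
    by_contra hlt
    exact disjoint_left.1 h (by rw [mem_ball, dist_comm]; exact not_le.1 hlt) hv

theorem exists_dist_eq_coneRadius [CompactSpace C] (hC : IsPositiveEuclideanConeMetric C)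
    (hV : (conePoints C).Nonempty) (x : C) : ∃ v ∈ conePoints C, dist x v = coneRadius x := by
  obtain ⟨v, hv, h⟩ := (isClosed_conePoints hC).isCompact.exists_infDist_eq_dist hV x
  exact ⟨v, hv, h.symm⟩

theorem _root_.IsDelaunayDisk.isFlatOn {c : Plane} {D : Plane → C} (h : IsDelaunayDisk c D) :
    IsFlatOn D (ball c (coneRadius (D c))) := fun y hy => by
  obtain ⟨U, hU, hi⟩ := h.isometric y hy
  rw [isOpen_ball.nhdsWithin_eq hy] at hU
  obtain ⟨δ, hδ, hδU⟩ := Metric.mem_nhds_iff.1 (inter_mem hU (isOpen_ball.mem_nhds hy))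
  exact ⟨h.empty_interior y hy, δ, hδ, hδU.trans inter_subset_right, fun z hz w hw =>
    hi z (hδU hz).1 w (hδU hw).1⟩

theorem IsFlatOn.lipschitzOnWith {D : Plane → C} {U : Set Plane} (h : IsFlatOn D U)
    (hU : Convex ℝ U) : LipschitzOnWith 1 D U :=
  LipschitzOnWith.of_dist_le_mul fun y hy z hz => by
    simpa using h.dist_le hU hy hz

theorem _root_.IsDelaunayDisk.dist_le {c : Plane} {D : Plane → C} (h : IsDelaunayDisk c D)
    {y z : Plane} (hy : y ∈ closedBall c (coneRadius (D c)))
    (hz : z ∈ closedBall c (coneRadius (D c))) : dist (D y) (D z) ≤ dist y z := by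
  have hcl := closure_ball c h.radius_pos.ne'
  have := (h.isFlatOn.lipschitzOnWith (convex_ball _ _)).closure (by
    rw [hcl]; exact h.continuousOn)
  rw [hcl] at this
  simpa using this.dist_le_mul y hy z hz

/-- The distance to the empty set is zero by convention, which a positive radius excludes. -/
theorem _root_.IsDelaunayDisk.conePoints_nonempty {c : Plane} {D : Plane → C}
    (h : IsDelaunayDisk c D) : (conePoints C).Nonempty := by
  by_contra hne
  have := h.radius_pos
  rw [not_nonempty_iff_eq_empty] at hne
  simp [coneRadius, hne] at this

/-- A flat map of the open disk of radius `coneRadius (D c)` extends to a Delaunay disk. -/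
theorem IsFlatOn.exists_isDelaunayDisk_eqOn [CompactSpace C]
    (hC : IsPositiveEuclideanConeMetric C) {E : Plane → C} {c : Plane}
    (hr : 0 < coneRadius (E c)) (hE : IsFlatOn E (ball c (coneRadius (E c)))) :
    ∃ D, IsDelaunayDisk c D ∧ EqOn D E (ball c (coneRadius (E c))) := by
  set r := coneRadius (E c) with hrdef
  have hcl := closure_ball c hr.ne'
  have hlip := hE.lipschitzOnWith (convex_ball c r)
  -- A 1-Lipschitz map to a complete space has limits at the boundary points of its domain.
  set D := extendFrom (ball c r) E with hD
  have hDc : ContinuousOn D (closedBall c r) := by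
    refine continuousOn_extendFrom hcl.ge fun x hx => ?_
    rw [← hcl] at hx
    have := mem_closure_iff_nhdsWithin_neBot.1 hx
    have hca : Cauchy (𝓝[ball c r] x) := cauchy_nhds.mono nhdsWithin_le_nhds
    exact CompleteSpace.complete
      (hca.map_of_le hlip.uniformContinuousOn (le_principal_iff.2 self_mem_nhdsWithin))
  have hDE : EqOn D E (ball c r) := extendFrom_extends hE.continuousOn
  have hcc : D c = E c := hDE (mem_ball_self hr)
  have hrr : coneRadius (D c) = r := by rw [hcc]
  have hflat := hE.congr hDE
  have hDlip : LipschitzOnWith 1 D (closedBall c r) := by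
    rw [← hcl]
    exact (hflat.lipschitzOnWith (convex_ball c r)).closure (by rwa [hcl])
  refine ⟨D, ⟨by rwa [hrr], by rwa [hrr], ?_, ?_, ?_⟩, hDE⟩
  · rw [hrr]
    intro y hy
    obtain ⟨-, δ, hδ, -, hi⟩ := hflat y hy
    exact ⟨ball y δ, mem_nhdsWithin_of_mem_nhds (ball_mem_nhds y hδ), hi⟩
  · rw [hrr]
    apply Subset.antisymm
    · rintro _ ⟨z, hz, rfl⟩
      have := hDlip.dist_le_mul z hz c (mem_closedBall_self hr.le)
      simp only [NNReal.coe_one, one_mul] at this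
      exact this.trans hz
    · have hclosed : IsClosed (D '' closedBall c r) :=
        ((isCompact_closedBall c r).image_of_continuousOn hDc).isClosed
      have hball : ball (D c) r ⊆ D '' closedBall c r := by
        rw [← hflat.image_ball hC]
        exact image_mono ball_subset_closedBall
      intro q hq
      rcases (mem_closedBall.1 hq).lt_or_eq with hlt | heq
      · exact hball hlt
      · rw [← hclosed.closure_eq, Metric.mem_closure_iff]
        intro η hη
        have hm : 0 < min η r := lt_min hη hr
        -- A point at distance exactly `r` is a limit of points closer to the centre, by geodesic
        -- convexity; the image of the closed disk is compact, hence contains it.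
        obtain ⟨z, hz1, hz2⟩ := exists_between_of_isLengthMetric hC.isLengthMetric (D c) q
          (s := r - min η r / 2) (by linarith [min_le_right η r]) (by
            rw [dist_comm, heq]; linarith)
        refine ⟨z, hball ?_, ?_⟩
        · rw [mem_ball, dist_comm, hz1]; linarith
        · rw [dist_comm, hz2, dist_comm, heq]; linarith [min_le_left η r]
  · rw [hrr]
    exact fun y hy => (hflat y hy).1

/-- Each germ of a flat map extends to a Delaunay disk. -/
theorem IsFlatOn.exists_isDelaunayDisk [CompactSpace C] (hC : IsPositiveEuclideanConeMetric C)
    (hV : (conePoints C).Nonempty) {D₀ : Plane → C} {U : Set Plane} (hD₀ : IsFlatOn D₀ U)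
    {c : Plane} (hc : c ∈ U) : ∃ D, IsDelaunayDisk c D ∧ D =ᶠ[𝓝 c] D₀ := by
  obtain ⟨E, hE, hED⟩ := hD₀.exists_extension hC hc (disjoint_ball_coneRadius (D₀ c))
  have hcc : E c = D₀ c := hED.eq_of_nhds
  have hr := coneRadius_pos hC hV (hD₀ c hc).1
  rw [← hcc] at hE hr
  obtain ⟨D, hD, hDE⟩ := hE.exists_isDelaunayDisk_eqOn hC hr
  exact ⟨D, hD, (hDE.eventuallyEq_of_mem (ball_mem_nhds c hr)).trans hED⟩

theorem exists_isDelaunayDisk [CompactSpace C] (hC : IsPositiveEuclideanConeMetric C)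
    (hV : (conePoints C).Nonempty) {x : C} (hx : x ∉ conePoints C) (c : Plane) :
    ∃ D, IsDelaunayDisk c D ∧ D c = x := by
  obtain ⟨ψ, ε, hψ⟩ := exists_isChart (locallyEuclideanAt_of_notMem hC hx)
  have h := hψ.isFlatOn_comp (A := AffineIsometryEquiv.constVAdd ℝ Plane (-c)) (y := c) (by simp)
  obtain ⟨D, hD, hDe⟩ := h.exists_isDelaunayDisk hC hV (mem_ball_self hψ.pos)
  exact ⟨D, hD, by rw [hDe.eq_of_nhds]; simp [hψ.zero]⟩

theorem _root_.IsDelaunayDisk.comp {c : Plane} {D : Plane → C} (h : IsDelaunayDisk c D)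
    (A : Plane ≃ᵃⁱ[ℝ] Plane) : IsDelaunayDisk (A.symm c) (D ∘ A) := by
  have hc : (D ∘ A) (A.symm c) = D c := by simp
  have hb : ∀ r, A ⁻¹' closedBall c r = closedBall (A.symm c) r := fun r => by
    ext z
    rw [mem_preimage, mem_closedBall, mem_closedBall, ← A.dist_map z, A.apply_symm_apply]
  have hb' : ∀ r, A ⁻¹' ball c r = ball (A.symm c) r := fun r => by
    ext z
    rw [mem_preimage, mem_ball, mem_ball, ← A.dist_map z, A.apply_symm_apply]
  have hflat := h.isFlatOn.comp A
  rw [hb'] at hflat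
  refine ⟨by rw [hc]; exact h.radius_pos, ?_, ?_, ?_, ?_⟩
  · rw [hc, ← hb]
    exact h.continuousOn.comp A.continuous.continuousOn (mapsTo_preimage _ _)
  · rw [hc]
    intro y hy
    obtain ⟨-, δ, hδ, -, hi⟩ := hflat y hy
    exact ⟨ball y δ, mem_nhdsWithin_of_mem_nhds (ball_mem_nhds y hδ), hi⟩
  · rw [hc, ← h.image_eq, ← hb, image_comp, image_preimage_eq _ A.surjective]
  · rw [hc]
    exact fun y hy => (hflat y hy).1

theorem mem_markedPoints_comp {c : Plane} {D : Plane → C} (A : Plane ≃ᵃⁱ[ℝ] Plane) {z : Plane} :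
    z ∈ markedPoints (A.symm c) (D ∘ A) ↔ A z ∈ markedPoints c D := by
  simp only [markedPoints, mem_ofPred_eq, mem_sphere, Function.comp, A.apply_symm_apply]
  rw [← A.dist_map z, A.apply_symm_apply]

/-- Two Delaunay disks in the same plane that agree near a point agree where both are defined. -/
theorem _root_.IsDelaunayDisk.eqOn (hC : IsPositiveEuclideanConeMetric C) {c c' : Plane}
    {D E : Plane → C} (hD : IsDelaunayDisk c D) (hE : IsDelaunayDisk c' E) {y : Plane}
    (hy : y ∈ ball c (coneRadius (D c))) (hy' : y ∈ ball c' (coneRadius (E c')))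
    (h : D =ᶠ[𝓝 y] E) :
    EqOn D E (ball c (coneRadius (D c)) ∩ ball c' (coneRadius (E c'))) := by
  have ho := (isOpen_ball (x := c) (ε := coneRadius (D c))).inter
    (isOpen_ball (x := c') (ε := coneRadius (E c')))
  exact IsFlatOn.eqOn hC ((convex_ball _ _).inter (convex_ball _ _)).isPreconnected
    (hD.isFlatOn.mono ho inter_subset_left) (hE.isFlatOn.mono ho inter_subset_right) ⟨hy, hy'⟩ h

/-- A convex set with interior points lies in the closure of its interior. This passes identities
from overlaps of open disks to overlaps of closed ones. -/
theorem closedBall_inter_closedBall_subset_closure {c c' y : Plane} {r r' : ℝ}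
    (hy : y ∈ ball c r) (hy' : y ∈ ball c' r') :
    closedBall c r ∩ closedBall c' r' ⊆ closure (ball c r ∩ ball c' r') := by
  have h1 := (pos_of_mem_ball hy).ne'
  have h2 := (pos_of_mem_ball hy').ne'
  have hi : interior (closedBall c r ∩ closedBall c' r') = ball c r ∩ ball c' r' := by
    rw [interior_inter, interior_closedBall _ h1, interior_closedBall _ h2]
  rw [← hi, ((convex_closedBall c r).inter (convex_closedBall c' r')).closure_interior_eq_closure_of_nonempty_interior
    (by rw [hi]; exact ⟨y, hy, hy'⟩)]
  exact subset_closure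

theorem _root_.IsDelaunayDisk.eqOn_closedBall (hC : IsPositiveEuclideanConeMetric C)
    {c c' : Plane} {D E : Plane → C} (hD : IsDelaunayDisk c D) (hE : IsDelaunayDisk c' E)
    {y : Plane} (hy : y ∈ ball c (coneRadius (D c))) (hy' : y ∈ ball c' (coneRadius (E c')))
    (h : D =ᶠ[𝓝 y] E) :
    EqOn D E (closedBall c (coneRadius (D c)) ∩ closedBall c' (coneRadius (E c'))) :=
  (hD.eqOn hC hE hy hy' h).of_subset_closure (hD.continuousOn.mono inter_subset_left)
    (hE.continuousOn.mono inter_subset_right)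
    (inter_subset_inter ball_subset_closedBall ball_subset_closedBall)
    (closedBall_inter_closedBall_subset_closure hy hy')

/-! ### Delaunay disks near cone points -/

/-- Moving `y` by `t • (a - b)` changes the difference of the squared distances to `b` and `a` by `2
* t * ‖a - b‖ ^ 2`. So the germ of a distance function determines the point from which the distance
is measured. -/
theorem eq_of_eventually_dist_eq {y a b : Plane} (h : ∀ᶠ z in 𝓝 y, dist z a = dist z b) :
    a = b := by
  obtain ⟨δ, hδ, hb⟩ := Metric.eventually_nhds_iff_ball.1 h
  by_contra hne
  have hn : 0 < ‖a - b‖ := norm_pos_iff.2 (sub_ne_zero.2 hne)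
  set t : ℝ := δ / 2 / ‖a - b‖ with ht
  have ht0 : 0 < t := by positivity
  have h1 := hb y (mem_ball_self hδ)
  have h2 := hb (y + t • (a - b)) (by
    rw [mem_ball, dist_eq_norm, add_sub_cancel_left, norm_smul, Real.norm_of_nonneg ht0.le, ht,
      div_mul_cancel₀ _ hn.ne']
    linarith)
  rw [dist_eq_norm, dist_eq_norm] at h1 h2
  have e1 := norm_add_sq_real (y - a) (t • (a - b))
  have e2 := norm_add_sq_real (y - b) (t • (a - b))
  have e3 : y + t • (a - b) - a = y - a + t • (a - b) := by abel
  have e4 : y + t • (a - b) - b = y - b + t • (a - b) := by abel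
  rw [e3, e4] at h2
  rw [h2, e2, h1] at e1
  have e5 : inner ℝ (y - b) (t • (a - b)) - inner ℝ (y - a) (t • (a - b)) = t * ‖a - b‖ ^ 2 := by
    rw [← inner_sub_left, inner_smul_right, ← real_inner_self_eq_norm_sq]
    congr 2; abel
  have : 0 < t * ‖a - b‖ ^ 2 := by positivity
  linarith

/-- Locally the distance to `v` is the distance to a developed apex in the plane. A germ of a
distance function determines this apex, so it is locally constant, and constant by connectedness. -/
theorem IsConeRadius.exists_dist_eq {v : C} {ε : ℝ} (hv : IsConeRadius v ε)
    (hvV : v ∈ conePoints C) {D : Plane → C} {K : Set Plane} (hK : IsPreconnected K)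
    (hne : K.Nonempty) (hD : IsFlatOn D K) (hm : ∀ y ∈ K, D y ∈ ball v ε) :
    ∃ z₀, ∀ y ∈ K, dist (D y) v = dist y z₀ := by
  have hloc : ∀ y ∈ K, ∃ z₀, ∀ᶠ z in 𝓝 y, dist (D z) v = dist z z₀ := by
    intro y hy
    obtain ⟨ψ, δ, z₀, hψ, hd⟩ := hv.exists_chart (D y) (hm y hy) fun h => (hD y hy).1 (h ▸ hvV)
    obtain ⟨A, hA0, hA⟩ := hD.exists_eventuallyEq_chart hy hψ
    have hA' : ∀ᶠ w in 𝓝 y, A w ∈ ball (0 : Plane) δ :=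
      A.continuous.continuousAt.eventually (by rw [hA0]; exact ball_mem_nhds _ hψ.pos)
    refine ⟨A.symm z₀, ?_⟩
    filter_upwards [hA, hA'] with w h1 h2
    rw [h1, Function.comp, hd _ h2, ← A.dist_map w, A.apply_symm_apply]
  obtain ⟨y₀, hy₀⟩ := hne
  obtain ⟨z₀, hz₀⟩ := hloc y₀ hy₀
  have hsub : K ⊆ {y | ∀ᶠ z in 𝓝 y, dist (D z) v = dist z z₀} := by
    refine hK.subset_of_closure_inter_subset ?_ ⟨y₀, hy₀, hz₀⟩ ?_
    · exact isOpen_iff_mem_nhds.2 fun z hz => eventually_eventually_nhds.2 hz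
    · rintro y ⟨hy, hyK⟩
      obtain ⟨z₁, hz₁⟩ := hloc y hyK
      obtain ⟨w, hw, hw'⟩ := ((mem_closure_iff_frequently.1 hy).and_eventually
        (eventually_eventually_nhds.2 hz₁)).exists
      have : z₀ = z₁ := eq_of_eventually_dist_eq (y := w) (by
        filter_upwards [show ∀ᶠ z in 𝓝 w, dist (D z) v = dist z z₀ from hw, hw'] with x h1 h2
        rw [← h1, h2])
      exact this ▸ hz₁
  exact ⟨z₀, fun y hy => Eventually.self_of_nhds (p := fun z => dist (D z) v = dist z z₀) (hsub hy)⟩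

theorem ball_inter_ball_nonempty {c w : Plane} {r η : ℝ} (hr : 0 < r) (hη : 0 < η)
    (hw : w ∈ closedBall c r) : (ball c r ∩ ball w η).Nonempty := by
  rw [← closure_ball c hr.ne'] at hw
  rw [inter_comm]
  exact mem_closure_iff_nhds.1 hw _ (ball_mem_nhds w hη)

/-- Close to a cone point the distance to it is the distance to a point of the plane. -/
theorem _root_.IsDelaunayDisk.exists_dist_eq {c : Plane} {D : Plane → C} (hD : IsDelaunayDisk c D)
    {v : C} {ε : ℝ} (hv : IsConeRadius v ε) (hvV : v ∈ conePoints C) {w : Plane}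
    (hw : w ∈ closedBall c (coneRadius (D c))) {η : ℝ} (hη : 0 < η) (hwη : dist (D w) v + η ≤ ε) :
    ∃ z₀, ∀ y ∈ closedBall c (coneRadius (D c)) ∩ closedBall w η, dist (D y) v = dist y z₀ := by
  set r := coneRadius (D c) with hr
  obtain ⟨y₀, hy₀⟩ := ball_inter_ball_nonempty hD.radius_pos hη hw
  obtain ⟨z₀, hz₀⟩ := hv.exists_dist_eq hvV (K := ball c r ∩ ball w η) (D := D)
    ((convex_ball _ _).inter (convex_ball _ _)).isPreconnected ⟨y₀, hy₀⟩
    (hD.isFlatOn.mono (isOpen_ball.inter isOpen_ball) inter_subset_left) (fun y hy => by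
      have h1 := hD.dist_le (ball_subset_closedBall hy.1) hw
      have h2 := dist_triangle (D y) (D w) v
      have h3 := mem_ball.1 hy.2
      rw [mem_ball]
      linarith)
  refine ⟨z₀, ?_⟩
  have : EqOn (fun y => dist (D y) v) (fun y => dist y z₀) (ball c r ∩ ball w η) := hz₀
  exact this.of_subset_closure
    ((Continuous.dist continuous_id continuous_const).comp_continuousOn
      (hD.continuousOn.mono inter_subset_left))
    (Continuous.dist continuous_id continuous_const).continuousOn
    (inter_subset_inter ball_subset_closedBall ball_subset_closedBall)
    (closedBall_inter_closedBall_subset_closure hy₀.1 hy₀.2)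

/-- The developed apex is `m` itself, since the distance to the cone point vanishes at `m`. -/
theorem _root_.IsDelaunayDisk.dist_eq_of_mem_markedPoints {c : Plane} {D : Plane → C}
    (hD : IsDelaunayDisk c D) {m : Plane} (hm : m ∈ markedPoints c D) {ε : ℝ}
    (hε : IsConeRadius (D m) ε) {y : Plane} (hy : y ∈ closedBall c (coneRadius (D c)))
    (hym : dist y m ≤ ε) : dist (D y) (D m) = dist y m := by
  have hm' := sphere_subset_closedBall hm.1
  obtain ⟨z₀, h⟩ := hD.exists_dist_eq hε hm.2 hm' hε.pos (by simp)
  have h0 := h m ⟨hm', mem_closedBall_self hε.pos.le⟩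
  rw [dist_self] at h0
  rw [h y ⟨hy, hym⟩, ← dist_eq_zero.1 h0.symm]

/-- If they were closer, the image of one would lie in the cone ball of the other, hence be the same
cone point; but distances to a marked point are preserved near it. -/
theorem _root_.IsDelaunayDisk.le_dist_of_mem_markedPoints {c : Plane} {D : Plane → C}
    (hD : IsDelaunayDisk c D) {ε : ℝ} (hε : ∀ v ∈ conePoints C, IsConeRadius v ε)
    {m m' : Plane} (hm : m ∈ markedPoints c D) (hm' : m' ∈ markedPoints c D) (hne : m ≠ m') :
    ε ≤ dist m m' := by
  by_contra! hlt
  have h1 := hD.dist_eq_of_mem_markedPoints hm' (hε _ hm'.2) (sphere_subset_closedBall hm.1) hlt.le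
  have h2 := (hε _ hm'.2).eq_of_mem_conePoints (q := D m) (by rw [mem_ball, h1]; exact hlt) hm.2
  rw [h2, dist_self] at h1
  exact hne (dist_eq_zero.1 h1.symm)

theorem _root_.IsDelaunayDisk.finite_markedPoints [CompactSpace C]
    (hC : IsPositiveEuclideanConeMetric C) {c : Plane} {D : Plane → C}
    (hD : IsDelaunayDisk c D) : (markedPoints c D).Finite := by
  obtain ⟨ε, hε, hεV⟩ := exists_isConeRadius hC
  obtain ⟨t, -, ht, hcov⟩ :=
    (isCompact_sphere c (coneRadius (D c))).finite_cover_balls (half_pos hε)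
  have hex : ∀ m ∈ markedPoints c D, ∃ x ∈ t, dist m x < ε / 2 := fun m hm => by
    simpa using hcov hm.1
  choose! f hf hfd using hex
  refine Set.Finite.of_injOn (f := f) hf (fun m hm m' hm' h => ?_) ht
  by_contra hne
  have h1 := hD.le_dist_of_mem_markedPoints hεV hm hm' hne
  have h2 := hfd m hm
  have h3 := hfd m' hm'
  rw [← h] at h3
  linarith [dist_triangle_right m m' (f m)]

theorem _root_.IsDelaunayDisk.markedPoints_nonempty [CompactSpace C]
    (hC : IsPositiveEuclideanConeMetric C) {c : Plane} {D : Plane → C}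
    (hD : IsDelaunayDisk c D) : (markedPoints c D).Nonempty := by
  obtain ⟨v, hv, hvr⟩ := exists_dist_eq_coneRadius hC hD.conePoints_nonempty (D c)
  have : v ∈ closedBall (D c) (coneRadius (D c)) := by rw [mem_closedBall, dist_comm, hvr]
  rw [← hD.image_eq] at this
  obtain ⟨m, hm, rfl⟩ := this
  refine ⟨m, ?_, hv⟩
  rcases (mem_closedBall.1 hm).lt_or_eq with h | h
  · exact absurd hv (hD.empty_interior m h)
  · exact h

/-- The marked points of the Delaunay disks with centres close to `c` are among those of the disk
with centre `c`. -/
theorem _root_.IsDelaunayDisk.exists_markedPoints_subset [CompactSpace C]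
    (hC : IsPositiveEuclideanConeMetric C) {c : Plane} {D : Plane → C}
    (hD : IsDelaunayDisk c D) :
    ∃ η > 0, η < coneRadius (D c) ∧ ∀ z ∈ ball c η, ∀ E, IsDelaunayDisk z E → E =ᶠ[𝓝 z] D →
      markedPoints z E ⊆ markedPoints c D := by
  obtain ⟨ε, hε, hεV⟩ := exists_isConeRadius hC
  set r := coneRadius (D c) with hr
  have hr0 : 0 < r := hD.radius_pos
  have hK : IsCompact (sphere c r ∩ {y | ∀ m ∈ markedPoints c D, ε / 4 ≤ dist y m}) := by
    refine (isCompact_sphere c r).inter_right ?_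
    simp only [ofPred_forall]
    exact isClosed_biInter fun m _ => isClosed_le continuous_const (by fun_prop)
  have hcc : ContinuousOn (fun y => coneRadius (D y))
      (sphere c r ∩ {y | ∀ m ∈ markedPoints c D, ε / 4 ≤ dist y m}) :=
    (continuous_infDist_pt _).comp_continuousOn
      (hD.continuousOn.mono (inter_subset_left.trans sphere_subset_closedBall))
  -- On the part of the circle away from the marked points the distance to the cone points has a
  -- positive lower bound `κ`, so a boundary point mapped closer than `κ` to a cone point is near a
  -- marked point.
  obtain ⟨κ, hκ, hκK⟩ := hK.exists_forall_le' hcc (a := 0) fun y hy => by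
    refine coneRadius_pos hC hD.conePoints_nonempty fun hyV => ?_
    have := hy.2 y ⟨hy.1, hyV⟩
    rw [dist_self] at this
    linarith
  refine ⟨min (min (κ / 4) (ε / 16)) (r / 4), by positivity,
    (min_le_right _ _).trans_lt (by linarith), fun z hz E hE hED m' hm' => ?_⟩
  obtain ⟨⟨hz1, hz2⟩, hz3⟩ : (dist z c < κ / 4 ∧ dist z c < ε / 16) ∧ dist z c < r / 4 := by
    simpa using hz
  set r' := coneRadius (E z) with hr'
  have hEz : E z = D z := hED.eq_of_nhds
  have hzr : z ∈ ball c r := by rw [mem_ball]; linarith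
  have hDz : dist (D z) (D c) ≤ dist z c :=
    hD.dist_le (ball_subset_closedBall hzr) (mem_closedBall_self hr0.le)
  have hrr1 : r' ≤ r + dist z c := by
    rw [hr', hEz]; linarith [coneRadius_le_add (D z) (D c)]
  have hrr2 : r ≤ r' + dist z c := by
    rw [hr', hEz]; have := coneRadius_le_add (D c) (D z); rw [dist_comm (D c)] at this; linarith
  have heq : EqOn E D (closedBall z r' ∩ closedBall c r) :=
    hE.eqOn_closedBall hC hD (mem_ball_self hE.radius_pos) hzr hED
  have hm'c := sphere_subset_closedBall hm'.1
  have hm'd : dist m' z = r' := hm'.1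
  have hout : r ≤ dist m' c := by
    by_contra! hlt
    have h1 := heq ⟨hm'c, ball_subset_closedBall hlt⟩
    exact hD.empty_interior m' hlt (h1 ▸ hm'.2)
  have hm'0 : 0 < dist m' c := hr0.trans_le hout
  -- The new marked point `m'` is not inside the old disk; `w` is its radial projection to the old
  -- circle, at distance at most `2 * dist z c` from it.
  set w : Plane := AffineMap.lineMap c m' (r / dist m' c) with hw
  have hwc : dist w c = r := by
    rw [hw, dist_lineMap_left, dist_comm c, Real.norm_of_nonneg (by positivity),
      div_mul_cancel₀ _ hm'0.ne']
  have hle1 : r / dist m' c ≤ 1 := (div_le_one hm'0).2 hout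
  have hwm' : dist w m' ≤ 2 * dist z c := by
    rw [hw, dist_lineMap_right, dist_comm c, Real.norm_of_nonneg (by linarith), sub_mul, one_mul,
      div_mul_cancel₀ _ hm'0.ne']
    linarith [dist_triangle m' z c]
  have hwz : w ∈ closedBall z r' :=
    (convex_closedBall z r').lineMap_mem (by rw [mem_closedBall, dist_comm]; linarith) hm'c
      ⟨by positivity, hle1⟩
  have hDw : D w = E w := (heq ⟨hwz, hwc.le⟩).symm
  have hDwv : dist (D w) (E m') ≤ 2 * dist z c := by
    rw [hDw]; exact (hE.dist_le hwz hm'c).trans hwm'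
  obtain ⟨m, hm, hwm⟩ : ∃ m ∈ markedPoints c D, dist w m < ε / 4 := by
    by_contra! hcon
    have h1 := hκK w ⟨hwc, hcon⟩
    have h2 := coneRadius_le_dist (x := D w) hm'.2
    linarith
  have hmc := sphere_subset_closedBall hm.1
  have hDm : D m = E m' := by
    refine (hεV _ hm'.2).eq_of_mem_conePoints ?_ hm.2
    have h1 := hD.dist_le hmc (show w ∈ closedBall c r from hwc.le)
    rw [dist_comm m w] at h1
    have h2 := dist_triangle (D m) (D w) (E m')
    rw [mem_ball]
    linarith
  have hcl := closedBall_inter_closedBall_subset_closure (mem_ball_self hE.radius_pos) hzr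
    (show w ∈ closedBall z r' ∩ closedBall c r from ⟨hwz, hwc.le⟩)
  obtain ⟨y, hyw, hyE, hyD⟩ := mem_closure_iff_nhds.1 hcl _ (ball_mem_nhds w (half_pos hε))
  -- Near `w` the distance to the common cone point is the distance to `m'` and also the distance to
  -- `m`.
  have hmm : m' = m := by
    refine eq_of_eventually_dist_eq (y := y) ?_
    filter_upwards [isOpen_ball.mem_nhds hyw, isOpen_ball.mem_nhds hyE, isOpen_ball.mem_nhds hyD]
      with x hxw hxE hxD
    have hxE := ball_subset_closedBall hxE
    have hxD := ball_subset_closedBall hxD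
    rw [mem_ball] at hxw
    rw [← hE.dist_eq_of_mem_markedPoints hm' (hεV _ hm'.2) hxE
        (by linarith [dist_triangle x w m']),
      ← hD.dist_eq_of_mem_markedPoints hm (hεV _ hm.2) hxD (by linarith [dist_triangle x w m]),
      hDm, heq ⟨hxE, hxD⟩]
  exact hmm ▸ hm

/-! ### Shortest arcs and marked points -/

/-- The image of the radius from the centre `c` to the point `m`. -/
noncomputable def radialArc (c : Plane) (D : Plane → C) (m : Plane) :
    Icc (0 : ℝ) (coneRadius (D c)) → C :=
  fun t => D (AffineMap.lineMap c m (t.1 / coneRadius (D c)))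

/-- The arc is 1-Lipschitz, and its endpoints are at least as far apart as its parameter interval is
long; this leaves no slack in the triangle inequality. -/
theorem radialArc_mem_shortestArcs {c : Plane} {D : Plane → C} (hD : IsDelaunayDisk c D)
    {m : Plane} (hm : m ∈ markedPoints c D) : radialArc c D m ∈ shortestArcs (D c) := by
  set r := coneRadius (D c) with hr
  have hr0 : 0 < r := hD.radius_pos
  have hmd : dist c m = r := by rw [dist_comm]; exact hm.1
  have hin : ∀ t : Icc (0 : ℝ) r, AffineMap.lineMap c m (t.1 / r) ∈ closedBall c r := fun t =>
    (convex_closedBall c r).lineMap_mem (mem_closedBall_self hr0.le)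
      (sphere_subset_closedBall hm.1) ⟨div_nonneg t.2.1 hr0.le, (div_le_one hr0).2 t.2.2⟩
  have hle : ∀ s t : Icc (0 : ℝ) r, dist (radialArc c D m s) (radialArc c D m t) ≤ |s.1 - t.1| := by
    intro s t
    refine (hD.dist_le (hin s) (hin t)).trans_eq ?_
    rw [dist_lineMap_lineMap, hmd, Real.dist_eq, ← sub_div, abs_div, abs_of_pos hr0,
      div_mul_cancel₀ _ hr0.ne']
  have h0 : radialArc c D m ⟨0, le_rfl, hr0.le⟩ = D c := by simp [radialArc]
  have h1 : radialArc c D m ⟨r, hr0.le, le_rfl⟩ = D m := by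
    simp [radialArc, ← hr, div_self hr0.ne']
  refine ⟨Isometry.of_dist_eq fun s t => ?_, h0, h1 ▸ hm.2⟩
  wlog hst : s ≤ t generalizing s t
  · rw [dist_comm, this t s (le_of_not_ge hst), dist_comm]
  have hst' : s.1 ≤ t.1 := hst
  refine le_antisymm (hle s t) ?_
  have e1 := hle ⟨0, le_rfl, hr0.le⟩ s
  have e2 := hle t ⟨r, hr0.le, le_rfl⟩
  have e3 : r ≤ dist (D c) (D m) := coneRadius_le_dist hm.2
  rw [h0] at e1
  rw [h1] at e2
  have e4 := dist_triangle4 (D c) (radialArc c D m s) (radialArc c D m t) (D m)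
  rw [abs_of_nonpos (by simpa using s.2.1)] at e1
  rw [abs_of_nonpos (by simpa using t.2.2)] at e2
  rw [Subtype.dist_eq, Real.dist_eq, abs_of_nonpos (by linarith)]
  simp only at e1 e2
  linarith

/-- `D` is injective near the centre, so radii with the same image have a common point other than
the centre. -/
theorem injOn_radialArc {c : Plane} {D : Plane → C} (hD : IsDelaunayDisk c D) :
    InjOn (radialArc c D) (markedPoints c D) := by
  intro m hm m' hm' h
  set r := coneRadius (D c) with hr
  have hr0 : 0 < r := hD.radius_pos
  obtain ⟨-, δ, hδ, hδr, hi⟩ := hD.isFlatOn c (mem_ball_self hr0)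
  set s := min δ r / 2 with hs
  have hm0 : 0 < min δ r := lt_min hδ hr0
  have hs0 : 0 < s := half_pos hm0
  have hsδ : s < δ := by linarith [min_le_left δ r]
  have hsr : s ≤ r := by linarith [min_le_right δ r]
  have hb : ∀ m ∈ markedPoints c D, AffineMap.lineMap c m (s / r) ∈ ball c δ := fun m hm => by
    have : dist c m = r := by rw [dist_comm]; exact hm.1
    rw [mem_ball, dist_lineMap_left, this, Real.norm_of_nonneg (by positivity),
      div_mul_cancel₀ _ hr0.ne']
    exact hsδ
  have h1 := congrFun h ⟨s, hs0.le, hsr⟩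
  have h2 := hi.injOn (hb m hm) (hb m' hm') h1
  simp only [AffineMap.lineMap_apply_module', add_left_inj] at h2
  exact sub_left_injective (smul_right_injective _ (div_pos hs0 hr0).ne' h2)

theorem eq_lineMap_of_dist {a b z : Plane} {s h : ℝ} (hs : 0 < s)
    (hab : dist a b = s) (hbz : dist b z = h) (haz : dist a z = s + h) :
    z = AffineMap.lineMap a b ((s + h) / s) := by
  have hw : Wbtw ℝ a b z := dist_add_dist_eq_iff.1 (by rw [hab, hbz, haz])
  obtain ⟨τ, ⟨hτ0, -⟩, hτ⟩ := hw
  have hτs : τ * (s + h) = s := by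
    have := dist_lineMap_left a z τ
    rw [hτ, dist_comm b a, hab, haz, Real.norm_of_nonneg hτ0] at this
    exact this.symm
  have hk : (s + h) / s * τ = 1 := by rw [div_mul_eq_mul_div, mul_comm, hτs, div_self hs.ne']
  rw [← hτ, AffineMap.lineMap_apply_module', AffineMap.lineMap_apply_module', add_sub_cancel_right,
    smul_smul, hk, one_smul, sub_add_cancel]

/-- A shortest path from the centre of a flat disk is the image of a radius. -/
theorem IsFlatOn.exists_lineMap_eq [CompactSpace C] (hC : IsPositiveEuclideanConeMetric C)
    {c : Plane} {D : Plane → C} {r : ℝ} (hr0 : 0 < r) (hD : IsFlatOn D (ball c r))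
    (hDc : ContinuousOn D (closedBall c r)) {γ : Icc (0 : ℝ) r → C} (hγi : Isometry γ)
    (hγ0 : γ ⟨0, le_rfl, hr0.le⟩ = D c) :
    ∃ m, dist m c = r ∧ ∀ t : Icc 0 r, γ t = D (AffineMap.lineMap c m (t.1 / r)) := by
  have hγd : ∀ s t (hs : s ∈ Icc 0 r) (ht : t ∈ Icc 0 r), dist (γ ⟨s, hs⟩) (γ ⟨t, ht⟩) = |s - t| :=
    fun s t hs ht => by rw [hγi.dist_eq, Subtype.dist_eq, Real.dist_eq]
  obtain ⟨δ₀, hδ₀, hunif₀⟩ := hD.exists_uniform_isoOn hC hr0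
  obtain ⟨-, hiso₀, hsurj₀⟩ := hunif₀ c (by simp)
  set s₀ := min δ₀ r / 2 with hs₀
  have hm0 : 0 < min δ₀ r := lt_min hδ₀ hr0
  have hs0 : 0 < s₀ := half_pos hm0
  have hsδ : s₀ < δ₀ := by linarith [min_le_left δ₀ r]
  have hsr : s₀ ≤ r := by linarith [min_le_right δ₀ r]
  have hlift : ∀ t (ht : t ∈ Icc 0 r), t ≤ s₀ → ∃ y ∈ ball c δ₀, D y = γ ⟨t, ht⟩ ∧ dist c y = t := by
    intro t ht hts
    have h1 := hγd 0 t ⟨le_rfl, hr0.le⟩ ht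
    rw [hγ0, zero_sub, abs_neg, abs_of_nonneg ht.1] at h1
    obtain ⟨y, hy, hyt⟩ := hsurj₀ (show γ ⟨t, ht⟩ ∈ ball (D c) δ₀ by
      rw [mem_ball, dist_comm, h1]; linarith)
    exact ⟨y, hy, hyt, by rw [← hiso₀ c (mem_ball_self hδ₀) y hy, hyt, h1]⟩
  have hs0m : s₀ ∈ Icc 0 r := ⟨hs0.le, hsr⟩
  obtain ⟨y₀, hy₀, hy₀γ, hy₀d⟩ := hlift s₀ hs0m le_rfl
  -- The unit-speed ray from `c` through the lift `y₀` of the point of `γ` at distance `s₀`, which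
  -- lies in a disk on which `D` is isometric.
  set P : ℝ → Plane := fun t => AffineMap.lineMap c y₀ (t / s₀) with hP
  have hPd : ∀ s t, dist (P s) (P t) = |s - t| := fun s t => by
    rw [hP, dist_lineMap_lineMap, hy₀d, Real.dist_eq, ← sub_div, abs_div, abs_of_pos hs0,
      div_mul_cancel₀ _ hs0.ne']
  have hP0 : P 0 = c := by simp [hP]
  have hPc : ∀ t, 0 ≤ t → dist (P t) c = t := fun t ht => by
    rw [← hP0, hPd, sub_zero, abs_of_nonneg ht]
  have hbase : ∀ t (ht : t ∈ Icc 0 r), t ≤ s₀ → γ ⟨t, ht⟩ = D (P t) := by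
    intro t ht hts
    rcases ht.1.eq_or_lt with rfl | ht0
    · rw [hP0, ← hγ0]
    obtain ⟨y, hy, hyγ, hyd⟩ := hlift t ht hts
    have hyy : dist y y₀ = s₀ - t := by
      rw [← hiso₀ y hy y₀ hy₀, hyγ, hy₀γ, hγd t s₀ ht hs0m, abs_of_nonpos (by linarith)]; ring
    have := eq_lineMap_of_dist ht0 hyd hyy (by rw [hy₀d]; ring)
    rw [← hyγ, hP]
    dsimp only
    rw [this, add_sub_cancel, AffineMap.lineMap_apply_module', AffineMap.lineMap_apply_module',
      add_sub_cancel_right, smul_smul, div_mul_div_cancel₀ hs0.ne', div_self ht0.ne', one_smul,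
      sub_add_cancel]
  have hmain : ∀ t (ht : t ∈ Icc 0 r), t < r → γ ⟨t, ht⟩ = D (P t) := by
    intro t ht htr
    obtain ⟨δ, hδ, hunif⟩ := hD.exists_uniform_isoOn hC htr
    set h := min s₀ δ / 2 with hh
    have hm0 : 0 < min s₀ δ := lt_min hs0 hδ
    have hh0 : 0 < h := half_pos hm0
    have hhs : h ≤ s₀ / 2 := by linarith [min_le_left s₀ δ]
    have hhδ : h < δ := by linarith [min_le_right s₀ δ]
    -- Each step lifts `γ u` near `P (u - h)`. Its distances to two earlier points of the ray give
    -- equality in the triangle inequality, so the lift continues the ray; `h ≤ s₀ / 2` keeps both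
    -- earlier parameters nonnegative.
    have key : ∀ n : ℕ, ∀ u (hu : u ∈ Icc 0 r), u ≤ t → u ≤ s₀ + n * h → γ ⟨u, hu⟩ = D (P u) := by
      intro n
      induction n with
      | zero => exact fun u hu _ hus => hbase u hu (by simpa using hus)
      | succ n ih =>
        intro u hu hut hun
        push_cast at hun
        have hnn : 0 ≤ n * h := by positivity
        by_cases hus : u ≤ s₀
        · exact hbase u hu hus
        have ha : u - h ∈ Icc 0 r := ⟨by linarith, by linarith [hu.2]⟩
        have hb : u - h - h ∈ Icc 0 r := ⟨by linarith, by linarith [hu.2]⟩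
        have iha := ih (u - h) ha (by linarith) (by linarith)
        have ihb := ih (u - h - h) hb (by linarith) (by linarith)
        obtain ⟨-, hiso, hsurj⟩ := hunif (P (u - h)) (by
          rw [mem_closedBall, hPc _ ha.1]; linarith)
        have hd1 := hγd (u - h) u ha hu
        have hd2 := hγd (u - h - h) u hb hu
        rw [abs_of_nonpos (by linarith)] at hd1 hd2
        obtain ⟨y, hy, hyγ⟩ := hsurj (show γ ⟨u, hu⟩ ∈ ball (D (P (u - h))) δ by
          rw [mem_ball, dist_comm, ← iha, hd1]; linarith)
        have hPb : P (u - h - h) ∈ ball (P (u - h)) δ := by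
          rw [mem_ball, hPd, abs_of_nonpos (by linarith)]; linarith
        have e1 : dist (P (u - h)) y = h := by
          rw [← hiso _ (mem_ball_self hδ) y hy, hyγ, ← iha, hd1]; ring
        have e2 : dist (P (u - h - h)) y = h + h := by
          rw [← hiso _ hPb y hy, hyγ, ← ihb, hd2]; ring
        have e3 : dist (P (u - h - h)) (P (u - h)) = h := by
          rw [hPd, abs_of_nonpos (by linarith)]; ring
        have hyP := eq_lineMap_of_dist hh0 e3 e1 e2
        have : (h + h) / h = 2 := by field_simp; ring
        rw [← hyγ, hyP, this]
        congr 1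
        simp only [hP, AffineMap.lineMap_apply_module']
        have e4 : u / s₀ = (u - h - h) / s₀ + 2 * ((u - h) / s₀ - (u - h - h) / s₀) := by
          field_simp; ring
        rw [e4]
        module
    obtain ⟨n, hn⟩ := exists_nat_gt (t / h)
    rw [div_lt_iff₀ hh0] at hn
    exact key n t ht le_rfl (by linarith)
  have hPcont : Continuous P := AffineMap.lineMap_continuous.comp (continuous_id.div_const s₀)
  have hPin : ∀ t ∈ Icc 0 r, P t ∈ closedBall c r := fun t ht => by
    rw [mem_closedBall, hPc t ht.1]; exact ht.2
  -- `D` is flat only on the open disk, so the endpoint `t = r` is reached by continuity.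
  have hall : γ = fun t => D (P t.1) := by
    have hc2 : Continuous fun t : Icc (0 : ℝ) r => D (P t.1) :=
      hDc.comp_continuous (hPcont.comp continuous_subtype_val) fun t => hPin t t.2
    have hd : Dense {t : Icc (0 : ℝ) r | t.1 < r} := by
      intro t
      rw [Metric.mem_closure_iff]
      intro η hη
      have hm : 0 < min η r := lt_min hη hr0
      refine ⟨⟨max 0 (t.1 - min η r / 2), le_max_left _ _, max_le hr0.le (by linarith [t.2.2])⟩,
        max_lt hr0 (by linarith [t.2.2]), ?_⟩
      rw [Subtype.dist_eq, Real.dist_eq, abs_lt]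
      have := min_le_left η r
      have h1 := t.2.1
      constructor
      · have : max 0 (t.1 - min η r / 2) ≤ t.1 := max_le h1 (by linarith)
        simp only
        linarith
      · simp only
        linarith [le_max_right 0 (t.1 - min η r / 2)]
    exact hγi.continuous.ext_on hd hc2 fun t ht => hmain t.1 t.2 ht
  refine ⟨P r, hPc r hr0.le, fun t => ?_⟩
  rw [hall]
  dsimp only
  congr 1
  simp only [hP]
  rw [AffineMap.lineMap_apply_module', AffineMap.lineMap_apply_module',
    AffineMap.lineMap_apply_module', add_sub_cancel_right, smul_smul,
    div_mul_div_cancel₀ hr0.ne']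

theorem exists_radialArc_eq [CompactSpace C] (hC : IsPositiveEuclideanConeMetric C) {c : Plane}
    {D : Plane → C} (hD : IsDelaunayDisk c D) {γ : Icc (0 : ℝ) (coneRadius (D c)) → C}
    (hγ : γ ∈ shortestArcs (D c)) : ∃ m ∈ markedPoints c D, radialArc c D m = γ := by
  obtain ⟨hγi, hγ0, hγ1⟩ := hγ
  obtain ⟨m, hm, h⟩ := hD.isFlatOn.exists_lineMap_eq hC hD.radius_pos hD.continuousOn hγi hγ0
  refine ⟨m, ⟨hm, ?_⟩, funext fun t => (h t).symm⟩
  rw [h] at hγ1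
  simpa [div_self hD.radius_pos.ne'] using hγ1

theorem encard_shortestArcs [CompactSpace C] (hC : IsPositiveEuclideanConeMetric C) {c : Plane}
    {D : Plane → C} (hD : IsDelaunayDisk c D) :
    (shortestArcs (D c)).encard = (markedPoints c D).encard := by
  rw [← (injOn_radialArc hD).encard_image]
  congr 1
  apply Subset.antisymm
  · intro γ hγ
    obtain ⟨m, hm, rfl⟩ := exists_radialArc_eq hC hD hγ
    exact mem_image_of_mem _ hm
  · rintro _ ⟨m, hm, rfl⟩
    exact radialArc_mem_shortestArcs hD hm

/-- A cone point has only one (constant) shortest arc to the set of cone points. -/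
theorem encard_shortestArcs_le_one {x : C} (hx : x ∈ conePoints C) :
    (shortestArcs x).encard ≤ 1 := by
  have h0 : coneRadius x = 0 := infDist_zero_of_mem hx
  rw [encard_le_one_iff]
  rintro γ γ' ⟨-, h, -⟩ ⟨-, h', -⟩
  funext t
  have ht : t = ⟨0, le_rfl, infDist_nonneg⟩ := Subtype.ext (le_antisymm (t.2.2.trans_eq h0) t.2.1)
  rw [ht, h, h']

/-! ### There are cone points -/

/-- A map that is isometric on all balls of a fixed radius, onto balls, is a covering. -/
theorem isCoveringMap_of_isoOn {X Y : Type*} [MetricSpace X] [MetricSpace Y] {f : X → Y} {ε : ℝ}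
    (hε : 0 < ε) (hf : ∀ x, IsoOn f (ball x ε)) (hs : ∀ x, ball (f x) ε ⊆ f '' ball x ε) :
    IsCoveringMap f := by
  have hmaps : ∀ x, ∀ z ∈ ball x ε, f z ∈ ball (f x) ε := fun x z hz => by
    rw [mem_ball, hf x z hz x (mem_ball_self hε)]; exact hz
  have hcont : Continuous f := continuous_iff_continuousAt.2 fun x =>
    (hf x).continuousOn.continuousAt (ball_mem_nhds x hε)
  intro p
  -- The sheet containing `z` is labelled by the point of the fibre over `p` within `ε` of `z`,
  -- which is unique because `f` is injective on the ball about `z`.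
  have hcen : ∀ z : f ⁻¹' ball p ε, ∃ y : f ⁻¹' {p}, y.1 ∈ ball z.1 ε := fun z => by
    obtain ⟨y, hy, hyp⟩ := hs z.1 (show p ∈ ball (f z) ε by rw [mem_ball_comm]; exact z.2)
    exact ⟨⟨y, hyp⟩, hy⟩
  have huniq : ∀ (z : X) (y y' : f ⁻¹' {p}), y.1 ∈ ball z ε → y'.1 ∈ ball z ε → y = y' :=
    fun z y y' hy hy' => Subtype.ext ((hf z).injOn hy hy' (y.2.trans y'.2.symm))
  have hlift : ∀ (u : ball p ε) (y : f ⁻¹' {p}), ∃ z ∈ ball y.1 ε, f z = u := fun u y => by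
    have hy : f y = p := y.2
    exact hs y (by rw [hy]; exact u.2)
  choose cen hcen using hcen
  choose lift hlift hlift' using hlift
  have hdisc : DiscreteTopology (f ⁻¹' {p}) := by
    rw [discreteTopology_subtype_iff']
    intro y hy
    refine ⟨ball y ε, isOpen_ball, Subset.antisymm (fun z hz => ?_) ?_⟩
    · exact congrArg Subtype.val
        (huniq y ⟨z, hz.2⟩ ⟨y, hy⟩ hz.1 (mem_ball_self hε))
    · rintro _ rfl
      exact ⟨mem_ball_self hε, hy⟩
  refine ⟨hdisc, ball p ε, mem_ball_self hε, isOpen_ball, isOpen_ball.preimage hcont,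
    { toFun := fun z => (⟨f z, z.2⟩, cen z)
      invFun := fun w => ⟨lift w.1 w.2, by rw [mem_preimage, hlift' w.1 w.2]; exact w.1.2⟩
      left_inv := fun z => ?_
      right_inv := fun w => ?_
      continuous_toFun := ?_
      continuous_invFun := ?_ }, fun z => rfl⟩
  · refine Subtype.ext ((hf (cen z)).injOn (hlift _ _) ?_ (hlift' _ _))
    rw [mem_ball_comm]; exact hcen z
  · refine Prod.ext (Subtype.ext (hlift' _ _)) ?_
    refine huniq (lift w.1 w.2) _ _ (hcen _) ?_
    rw [mem_ball_comm]; exact hlift w.1 w.2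
  · refine Continuous.prodMk (by fun_prop) ?_
    refine (IsLocallyConstant.iff_eventually_eq cen).2 (fun z => ?_) |>.continuous
    have : ∀ᶠ z' : f ⁻¹' ball p ε in 𝓝 z, z'.1 ∈ ball (cen z).1 ε :=
      continuous_subtype_val.continuousAt.eventually
        (isOpen_ball.mem_nhds (by rw [mem_ball_comm]; exact hcen z))
    filter_upwards [this] with z' hz'
    exact huniq z'.1 _ _ (hcen z') (by rw [mem_ball_comm]; exact hz')
  · refine Continuous.subtype_mk ?_ _
    refine continuous_prod_of_discrete_right.2 fun y => ?_
    refine Isometry.continuous (Isometry.of_dist_eq fun u u' => ?_)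
    rw [← hf y.1 _ (hlift u y) _ (hlift u' y), hlift', hlift', Subtype.dist_eq]

/-- Without cone points the developing map is defined on the whole plane and is a covering of `C`.
As `C` is a sphere, it has a section, whose image is compact and open in the plane, which is
impossible. The section is assembled from lifts of the two stereographic parametrizations, whose
domain is a plane. -/
theorem conePoints_nonempty
    (hsphere : Nonempty (C ≃ₜ Metric.sphere (0 : EuclideanSpace ℝ (Fin 3)) 1))
    (hC : IsPositiveEuclideanConeMetric C) : (conePoints C).Nonempty := by
  by_contra hV
  rw [not_nonempty_iff_eq_empty] at hV
  obtain ⟨h⟩ := hsphere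
  have : CompactSpace C := h.symm.compactSpace
  have hfact : Fact (Module.finrank ℝ (EuclideanSpace ℝ (Fin 3)) = 2 + 1) := ⟨by simp⟩
  let v : sphere (0 : EuclideanSpace ℝ (Fin 3)) 1 := ⟨EuclideanSpace.single 0 1, by simp⟩
  have hne : Nonempty C := ⟨h.symm v⟩
  obtain ⟨ε, hε, hch⟩ := exists_uniform_isChart hC (isCompact_univ (X := C)) (by simp [hV])
  -- the developing map
  have hp := locallyEuclideanAt_of_notMem hC (p := h.symm v) (by simp [hV])
  obtain ⟨ψ, ε₀, hψ⟩ := exists_isChart hp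
  choose D hD hDψ using fun R : ℝ =>
    IsFlatOn.exists_extension_zero hC hψ (R := R) (by simp [hV])
  obtain ⟨E, hE, -⟩ := exists_isFlatOn_iUnion (ι := Ioi (0 : ℝ)) (fun R => hD R.1) fun R R' => by
    have ho := (isOpen_ball (x := (0 : Plane)) (ε := R.1)).inter
      (isOpen_ball (x := (0 : Plane)) (ε := R'.1))
    exact IsFlatOn.eqOn hC ((convex_ball _ _).inter (convex_ball _ _)).isPreconnected
      ((hD R).mono ho inter_subset_left) ((hD R').mono ho inter_subset_right)
      ⟨mem_ball_self R.2, mem_ball_self R'.2⟩ ((hDψ R).trans (hDψ R').symm)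
  have hU : ⋃ R : Ioi (0 : ℝ), ball (0 : Plane) R.1 = univ := eq_univ_of_forall fun z =>
    mem_iUnion.2 ⟨⟨‖z‖ + 1, by simp; positivity⟩, by simp⟩
  rw [hU] at hE
  have hEiso : ∀ y, IsoOn E (ball y ε) ∧ ball (E y) ε ⊆ E '' ball y ε := by
    intro y
    obtain ⟨ψ, hψ⟩ := hch (E y) trivial
    obtain ⟨A, hA0, hA⟩ := hE.exists_eqOn_chart hC convex_univ (mem_univ y) hψ
    rw [univ_inter] at hA
    have hAm : ∀ z, z ∈ ball y ε ↔ A z ∈ ball 0 ε := fun z => by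
      rw [mem_ball, mem_ball, ← hA0, A.dist_map]
    refine ⟨fun z hz w hw => ?_, fun q hq => ?_⟩
    · rw [hA hz, hA hw, Function.comp, Function.comp,
        hψ.iso _ ((hAm z).1 hz) _ ((hAm w).1 hw), A.dist_map]
    · rw [← hψ.image] at hq
      obtain ⟨u, hu, rfl⟩ := hq
      have hu' : A.symm u ∈ ball y ε := by rw [hAm, A.apply_symm_apply]; exact hu
      exact ⟨A.symm u, hu', by rw [hA hu', Function.comp, A.apply_symm_apply]⟩
  have hcov : IsCoveringMap E := isCoveringMap_of_isoOn hε (fun y => (hEiso y).1) fun y => (hEiso y).2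
  have hsurj : Function.Surjective E := fun q => by
    obtain ⟨z, -, hz, -⟩ := (hE.mono (isOpen_ball (x := 0) (ε := dist (E 0) q + 1))
      (subset_univ _)).exists_preimage hC (y := 0) (q := q) (by simp)
    exact ⟨z, hz⟩
  -- lifts of the two stereographic charts
  let φ := stereographic' 2 v
  let φ' := stereographic' 2 (-v)
  have hφs : φ.source = {v}ᶜ := stereographic'_source v
  have hφs' : φ'.source = {-v}ᶜ := stereographic'_source (-v)
  have hφt : φ.target = univ := stereographic'_target v
  have hφt' : φ'.target = univ := stereographic'_target (-v)
  have hvne : -v ≠ v := fun h => by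
    have := congrArg (fun x : sphere (0 : EuclideanSpace ℝ (Fin 3)) 1 => x.1 0) h
    simp [v] at this
    norm_num at this
  have hφc : Continuous φ.symm := continuousOn_univ.1 (hφt ▸ φ.continuousOn_symm)
  have hφc' : Continuous φ'.symm := continuousOn_univ.1 (hφt' ▸ φ'.continuousOn_symm)
  -- A parameter whose point lies in both stereographic charts; both lifts are based over it so that
  -- they agree on the overlap.
  obtain ⟨a, ha⟩ := exists_ne (φ (-v))
  have hsa : φ.symm a ∈ φ.source := φ.map_target (hφt ▸ mem_univ a)
  have hsa' : φ.symm a ∈ φ'.source := by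
    rw [hφs']
    rintro (heq : φ.symm a = -v)
    exact ha (by rw [← heq, φ.right_inv (hφt ▸ mem_univ a)])
  let f : C(Plane, C) := ⟨fun z => h.symm (φ.symm z), h.symm.continuous.comp hφc⟩
  let f' : C(Plane, C) := ⟨fun z => h.symm (φ'.symm z), h.symm.continuous.comp hφc'⟩
  obtain ⟨e, he⟩ := hsurj (f a)
  obtain ⟨F, ⟨hF0, hF⟩, -⟩ := hcov.existsUnique_continuousMap_lifts f a e he
  obtain ⟨F', ⟨hF0', hF'⟩, -⟩ := hcov.existsUnique_continuousMap_lifts f' (φ' (φ.symm a)) e (by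
    rw [he]; simp only [f, f', ContinuousMap.coe_mk]; rw [φ'.left_inv hsa'])
  have hEF : ∀ x ∈ φ.source, E (F (φ x)) = h.symm x := fun x hx => by
    have := congrFun hF (φ x)
    simp only [Function.comp, f, ContinuousMap.coe_mk] at this
    rw [this, φ.left_inv hx]
  have hEF' : ∀ x ∈ φ'.source, E (F' (φ' x)) = h.symm x := fun x hx => by
    have := congrFun hF' (φ' x)
    simp only [Function.comp, f', ContinuousMap.coe_mk] at this
    rw [this, φ'.left_inv hx]
  -- The overlap is a plane minus one point.
  have hconn : IsPreconnected (φ.source ∩ φ'.source) := by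
    have : φ.source ∩ φ'.source = φ.symm '' {φ (-v)}ᶜ := by
      ext x
      constructor
      · rintro ⟨hx, hx'⟩
        refine ⟨φ x, fun heq => ?_, φ.left_inv hx⟩
        rw [hφs'] at hx'
        exact hx' (φ.injOn hx (by rw [hφs]; exact hvne) heq)
      · rintro ⟨z, hz, rfl⟩
        refine ⟨φ.map_target (hφt ▸ mem_univ z), ?_⟩
        rw [hφs']
        rintro (heq : φ.symm z = -v)
        exact hz (by rw [mem_singleton_iff, ← heq, φ.right_inv (hφt ▸ mem_univ z)])
    rw [this]
    exact (isConnected_compl_singleton_of_one_lt_rank (by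
      rw [← Module.finrank_eq_rank]; simp) _).isPreconnected.image _ hφc.continuousOn
  have hagree : EqOn (fun x => F (φ x)) (fun x => F' (φ' x)) (φ.source ∩ φ'.source) := by
    refine hcov.eqOn_of_comp_eqOn hconn
      (F.continuous.comp_continuousOn (φ.continuousOn.mono inter_subset_left))
      (F'.continuous.comp_continuousOn (φ'.continuousOn.mono inter_subset_right))
      (fun x hx => ?_) ⟨hsa, hsa'⟩ ?_
    · simp only [Function.comp]
      rw [hEF x hx.1, hEF' x hx.2]
    · rw [φ.right_inv (hφt ▸ mem_univ a), hF0, hF0']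
  -- a section of the developing map
  classical
  let s : sphere (0 : EuclideanSpace ℝ (Fin 3)) 1 → Plane := fun x =>
    if x = v then F' (φ' x) else F (φ x)
  have hs : EqOn s (fun x => F (φ x)) φ.source := fun x hx => by
    rw [hφs] at hx
    exact if_neg hx
  have hs' : EqOn s (fun x => F' (φ' x)) φ'.source := fun x hx => by
    by_cases hxv : x = v
    · exact if_pos hxv
    · have hx1 : x ∈ φ.source := by rw [hφs]; exact hxv
      rw [hs hx1]
      exact hagree ⟨hx1, hx⟩
  have hor : ∀ x, x ∈ φ.source ∨ x ∈ φ'.source := fun x => by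
    by_cases hxv : x = v
    · right; rw [hφs', hxv]; exact hvne.symm
    · left; rw [hφs]; exact hxv
  have hsc : Continuous s := continuous_iff_continuousAt.2 fun x => by
    rcases hor x with hx | hx
    · refine ContinuousAt.congr ?_ (hs.eventuallyEq_of_mem (φ.open_source.mem_nhds hx)).symm
      exact F.continuous.continuousAt.comp (φ.continuousAt hx)
    · refine ContinuousAt.congr ?_ (hs'.eventuallyEq_of_mem (φ'.open_source.mem_nhds hx)).symm
      exact F'.continuous.continuousAt.comp (φ'.continuousAt hx)
  have hEs : ∀ x, E (s x) = h.symm x := fun x => by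
    rcases hor x with hx | hx
    · rw [hs hx, hEF x hx]
    · rw [hs' hx, hEF' x hx]
  -- Near `s x` the map `s ∘ h ∘ E` is the identity: it is close to the identity, has the same image
  -- under `E`, and `E` is injective on balls of radius `ε`.
  have hopen : IsOpen (range s) := by
    rw [isOpen_iff_mem_nhds]
    rintro _ ⟨x, rfl⟩
    have hx : h (E (s x)) = x := by rw [hEs, h.apply_symm_apply]
    have hc : ContinuousAt (fun w => s (h (E w))) (s x) :=
      (hsc.comp (h.continuous.comp hcov.continuous)).continuousAt
    have hc' : ∀ᶠ w in 𝓝 (s x), s (h (E w)) ∈ ball (s x) ε :=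
      hc.eventually (by dsimp only; rw [hx]; exact ball_mem_nhds _ hε)
    filter_upwards [hc', ball_mem_nhds (s x) hε] with w hw hw'
    refine ⟨h (E w), (hEiso (s x)).1.injOn hw hw' ?_⟩
    rw [hEs, h.symm_apply_apply]
  have hcpt : IsCompact (range s) := isCompact_range hsc
  have huniv : range s = univ :=
    IsClopen.eq_univ ⟨hcpt.isClosed, hopen⟩ ⟨s v, mem_range_self v⟩
  rw [huniv] at hcpt
  exact noncompact_univ Plane hcpt

/-! ### Voronoi vertices -/

/-- The points `a` and `b` coincide when `M` is a single point. -/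
theorem exists_subset_pair {α : Type*} {M : Set α} (hM : M.Nonempty) (h : ¬ 3 ≤ M.encard) :
    ∃ a ∈ M, ∃ b ∈ M, M ⊆ {a, b} := by
  obtain ⟨a, ha⟩ := hM
  by_cases hb : ∃ b ∈ M, b ≠ a
  · obtain ⟨b, hb, hba⟩ := hb
    refine ⟨a, ha, b, hb, fun d hd => ?_⟩
    by_contra hdn
    simp only [mem_insert_iff, mem_singleton_iff, not_or] at hdn
    refine h ?_
    rw [← encard_eq_three.2 ⟨a, b, d, hba.symm, Ne.symm hdn.1, Ne.symm hdn.2, rfl⟩]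
    refine encard_le_encard ?_
    rintro x (rfl | rfl | rfl) <;> assumption
  · push Not at hb
    exact ⟨a, ha, a, ha, fun d hd => by simp [hb d hd]⟩

theorem exists_three_of_le_encard {α : Type*} {M : Set α} (h : 3 ≤ M.encard) :
    ∃ a ∈ M, ∃ b ∈ M, ∃ d ∈ M, a ≠ b ∧ a ≠ d ∧ b ≠ d := by
  obtain ⟨t, htM, ht⟩ := exists_subset_encard_eq h
  obtain ⟨a, b, d, hab, had, hbd, rfl⟩ := encard_eq_three.1 ht
  exact ⟨a, htM (by simp), b, htM (by simp), d, htM (by simp), hab, had, hbd⟩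

/-- Two distinct circles have at most two common points. -/
theorem eq_or_eq_of_dist_eq {c c' p₁ p₂ p : Plane} {r r' : ℝ} (hc : c ≠ c') (hp : p₁ ≠ p₂)
    (h₁ : dist p₁ c = r) (h₂ : dist p₂ c = r) (h : dist p c = r) (h₁' : dist p₁ c' = r')
    (h₂' : dist p₂ c' = r') (h' : dist p c' = r') : p = p₁ ∨ p = p₂ :=
  EuclideanGeometry.eq_of_dist_eq_of_dist_eq_of_finrank_eq_two (by simp) hc hp h₁ h₂ h h₁' h₂' h'

theorem eq_of_three_dist_eq {c c' : Plane} {r r' : ℝ} {M : Set Plane} (hM : 3 ≤ M.encard)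
    (h : ∀ m ∈ M, dist m c = r) (h' : ∀ m ∈ M, dist m c' = r') : c = c' := by
  obtain ⟨a, ha, b, hb, d, hd, hab, had, hbd⟩ := exists_three_of_le_encard hM
  by_contra hc
  rcases eq_or_eq_of_dist_eq hc hab (h a ha) (h b hb) (h d hd) (h' a ha) (h' b hb) (h' d hd)
    with rfl | rfl
  · exact had rfl
  · exact hbd rfl

theorem isVoronoiVertex_iff [CompactSpace C] (hC : IsPositiveEuclideanConeMetric C) {c : Plane}
    {D : Plane → C} (hD : IsDelaunayDisk c D) :
    IsVoronoiVertex (D c) ↔ 3 ≤ (markedPoints c D).encard := by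
  rw [IsVoronoiVertex, encard_shortestArcs hC hD]

theorem isVoronoiEdgePoint_iff [CompactSpace C] (hC : IsPositiveEuclideanConeMetric C) {c : Plane}
    {D : Plane → C} (hD : IsDelaunayDisk c D) :
    IsVoronoiEdgePoint (D c) ↔ (markedPoints c D).encard = 2 := by
  rw [IsVoronoiEdgePoint, encard_shortestArcs hC hD]

theorem _root_.IsVoronoiVertex.notMem_conePoints {x : C} (hx : IsVoronoiVertex x) :
    x ∉ conePoints C := fun h => by
  have := le_trans hx (encard_shortestArcs_le_one h)
  norm_num at this

theorem _root_.IsVoronoiEdgePoint.notMem_conePoints {x : C} (hx : IsVoronoiEdgePoint x) :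
    x ∉ conePoints C := fun h => by
  have := encard_shortestArcs_le_one h
  rw [IsVoronoiEdgePoint] at hx
  rw [hx] at this
  norm_num at this

/-- Voronoi vertices are isolated, and `C` is compact. Near a point that is not a cone point, the
marked points of a nearby disk are among those of the disk there, and three common points force the
centres to coincide. Close to a cone point the disks are too small for two marked points at distance
`ε`. -/
theorem finite_isVoronoiVertex [CompactSpace C] (hC : IsPositiveEuclideanConeMetric C)
    (hV : (conePoints C).Nonempty) : {x : C | IsVoronoiVertex x}.Finite := by
  have key : ∀ x : C, ∃ U ∈ 𝓝 x, ∀ y ∈ U, IsVoronoiVertex y → y = x := by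
    intro x
    by_cases hx : x ∈ conePoints C
    · obtain ⟨ε, hε, hεV⟩ := exists_isConeRadius hC
      refine ⟨ball x (ε / 2), ball_mem_nhds _ (half_pos hε), fun y hy hyv => ?_⟩
      obtain ⟨D, hD, rfl⟩ := exists_isDelaunayDisk hC hV hyv.notMem_conePoints 0
      rw [isVoronoiVertex_iff hC hD] at hyv
      obtain ⟨a, ha, b, hb, -, -, hab, -⟩ := exists_three_of_le_encard hyv
      have h1 := hD.le_dist_of_mem_markedPoints hεV ha hb hab
      have h2 : dist a 0 = coneRadius (D 0) := ha.1
      have h3 : dist b 0 = coneRadius (D 0) := hb.1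
      have h4 := coneRadius_le_dist (x := D 0) hx
      have h5 := mem_ball.1 hy
      linarith [dist_triangle_right a b 0]
    · obtain ⟨D, hD, rfl⟩ := exists_isDelaunayDisk hC hV hx 0
      obtain ⟨η, hη, hηr, hsub⟩ := hD.exists_markedPoints_subset hC
      refine ⟨ball (D 0) η, ball_mem_nhds _ hη, fun y hy hyv => ?_⟩
      rw [← (hD.isFlatOn.mono isOpen_ball (ball_subset_ball hηr.le)).image_ball hC] at hy
      obtain ⟨z, hz, rfl⟩ := hy
      obtain ⟨E, hE, hED⟩ := hD.isFlatOn.exists_isDelaunayDisk hC hV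
        (ball_subset_ball hηr.le hz)
      have hEz := hED.eq_of_nhds
      rw [← hEz, isVoronoiVertex_iff hC hE] at hyv
      have : z = 0 := eq_of_three_dist_eq hyv (fun m hm => hm.1) fun m hm =>
        (hsub z hz E hE hED hm).1
      rw [this]
  choose U hU hUv using key
  obtain ⟨t, -, hcov⟩ := isCompact_univ.elim_nhds_subcover U fun x _ => hU x
  refine t.finite_toSet.subset fun x hx => ?_
  obtain ⟨y, hy, hxy⟩ := mem_iUnion₂.1 (hcov (mem_univ x))
  rwa [hUv y x hxy hx]

/-! ### The Delaunay cells cover -/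

/-- For `m` on the circle about `c` the left side is the negative of the power of the origin, up to
the convention for its sign used below: it is the quantity to be maximized, and it is affine in `c`.
-/
theorem power_eq {m c : Plane} : dist m c ^ 2 - ‖c‖ ^ 2 = ‖m‖ ^ 2 - 2 * inner ℝ m c := by
  rw [dist_eq_norm, norm_sub_sq_real]; ring

theorem exists_forall_inner_pos {M : Set Plane} (hM : M.Finite) (h : (0 : Plane) ∉ convexHull ℝ M) :
    ∃ a : Plane, ∀ m ∈ M, 0 < inner ℝ m a := by
  obtain ⟨f, u, hu, hf⟩ := geometric_hahn_banach_point_closed (convex_convexHull ℝ M)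
    (hM.isClosed_convexHull ℝ) h
  refine ⟨(InnerProductSpace.toDual ℝ Plane).symm f, fun m hm => ?_⟩
  rw [real_inner_comm, InnerProductSpace.toDual_symm_apply]
  rw [map_zero] at hu
  exact hu.trans (hf m (subset_convexHull ℝ M hm))

/-- The quarter turn of `a`; it is orthogonal to `b` as well since `a` and `b` lie on a line through
the origin. -/
theorem exists_inner_eq_zero {a b : Plane} (ha : a ≠ 0) (h : (0 : Plane) ∈ segment ℝ a b) :
    ∃ u : Plane, u ≠ 0 ∧ inner ℝ a u = 0 ∧ inner ℝ b u = 0 := by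
  set u : Plane := !₂[-a 1, a 0] with hu
  have hau : inner ℝ a u = 0 := by
    simp [hu, PiLp.inner_apply, Fin.sum_univ_two]; ring
  refine ⟨u, fun h0 => ha ?_, hau, ?_⟩
  · have e0 := congrArg (fun x : Plane => x 0) h0
    have e1 := congrArg (fun x : Plane => x 1) h0
    simp [hu] at e0 e1
    ext i
    fin_cases i <;> simp [e0, e1]
  · obtain ⟨s, t, hs, ht, hst, hab⟩ := h
    have h1 : t * inner ℝ b u = 0 := by
      have := congrArg (fun x => inner ℝ x u) hab
      simpa [inner_add_left, inner_smul_left, hau] using this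
    rcases mul_eq_zero.1 h1 with h2 | h2
    · rw [h2, add_zero] at hst
      simp [h2, hst] at hab
      exact absurd hab ha
    · exact h2

/-- If the power of the origin does not increase, and the radius does not increase among the
circles for which the power is the same, when the centre moves, then there are at least three
marked points and their convex hull contains the origin. -/
theorem zero_mem_convexHull_and_three_le {M : Set Plane} (hMf : M.Finite) (hMne : M.Nonempty)
    {c : Plane} {r : ℝ} (hMr : ∀ m ∈ M, dist m c = r) (hcr : ‖c‖ < r) {η : ℝ} (hη : 0 < η)
    (hpert : ∀ z ∈ ball c η, ∃ m ∈ M, 0 < inner ℝ m (z - c) ∨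
      inner ℝ m (z - c) = 0 ∧ dist m z ≤ r) :
    (0 : Plane) ∈ convexHull ℝ M ∧ 3 ≤ M.encard := by
  have hsmall : ∀ u : Plane, ∃ t : ℝ, 0 < t ∧ c + t • u ∈ ball c η := fun u => by
    refine ⟨η / 2 / (‖u‖ + 1), by positivity, ?_⟩
    rw [mem_ball, dist_eq_norm, add_sub_cancel_left, norm_smul, Real.norm_of_nonneg (by positivity),
      div_mul_eq_mul_div, div_lt_iff₀ (by positivity)]
    nlinarith [norm_nonneg u]
  have hcell : (0 : Plane) ∈ convexHull ℝ M := by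
    by_contra h0
    -- If the origin is separated from the marked points, moving the centre along `-a` makes all
    -- inner products negative.
    obtain ⟨a, ha⟩ := exists_forall_inner_pos hMf h0
    obtain ⟨t, ht, htm⟩ := hsmall (-a)
    obtain ⟨m, hm, h⟩ := hpert _ htm
    have h1 : inner ℝ m (c + t • -a - c) = - (t * inner ℝ m a) := by
      rw [add_sub_cancel_left, inner_smul_right, inner_neg_right, mul_neg]
    have h2 := mul_pos ht (ha m hm)
    rw [h1] at h
    rcases h with h | ⟨h, -⟩ <;> linarith
  refine ⟨hcell, ?_⟩
  by_contra h3
  obtain ⟨a, ha, b, hb, hab⟩ := exists_subset_pair hMne h3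
  have h0seg : (0 : Plane) ∈ segment ℝ a b := by
    rw [← convexHull_pair]; exact convexHull_mono hab hcell
  have ha0 : a ≠ 0 := by
    rintro rfl
    have := hMr 0 ha
    rw [dist_zero_left] at this
    exact hcr.ne this
  -- With at most two marked points the origin is on their chord. Moving the centre orthogonally to
  -- it, in the sense that does not bring the centre nearer to the origin, leaves the inner products
  -- unchanged and strictly increases the radius.
  obtain ⟨u, hu0, hau, hbu⟩ := exists_inner_eq_zero ha0 h0seg
  wlog hcu : 0 ≤ inner ℝ c u generalizing u
  · exact this (-u) (neg_ne_zero.2 hu0) (by rw [inner_neg_right, hau, neg_zero])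
      (by rw [inner_neg_right, hbu, neg_zero]) (by rw [inner_neg_right]; linarith)
  obtain ⟨t, ht, htm⟩ := hsmall u
  obtain ⟨m, hm, h⟩ := hpert _ htm
  have hmu : inner ℝ m u = 0 := by
    rcases hab hm with rfl | rfl
    · exact hau
    · exact hbu
  rw [add_sub_cancel_left, inner_smul_right, hmu, mul_zero] at h
  have hle : dist m (c + t • u) ≤ r := by
    rcases h with h | h
    · exact absurd h (lt_irrefl 0)
    · exact h.2
  have hmc : dist m c = r := hMr m hm
  have e1 : dist m (c + t • u) ^ 2 = dist m c ^ 2 + (2 * t * inner ℝ c u + t ^ 2 * ‖u‖ ^ 2) := by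
    have : m - (c + t • u) = (m - c) - t • u := by abel
    rw [dist_eq_norm, dist_eq_norm, this, norm_sub_sq_real, inner_smul_right, inner_sub_left, hmu,
      norm_smul, mul_pow, Real.norm_eq_abs, sq_abs]
    ring
  have e2 : dist m (c + t • u) ^ 2 ≤ r ^ 2 := by gcongr
  have e3 : 0 < t ^ 2 * ‖u‖ ^ 2 := by have := norm_pos_iff.2 hu0; positivity
  have e4 : 0 ≤ 2 * t * inner ℝ c u := by positivity
  rw [e1, hmc] at e2
  linarith

/-- The developing map on the union of all disks to which the germ of a chart extends. -/
theorem IsChart.exists_developing (hC : IsPositiveEuclideanConeMetric C) {ψ : Plane → C} {p : C}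
    {ε : ℝ} (hψ : IsChart ψ p ε) : ∃ (E : Plane → C) (Ω : Set Plane), IsFlatOn E Ω ∧
      E =ᶠ[𝓝 0] ψ ∧ ∀ c ρ D, (0 : Plane) ∈ ball c ρ → IsFlatOn D (ball c ρ) → D =ᶠ[𝓝 0] ψ →
        ball c ρ ⊆ Ω := by
  have hne : Nonempty C := ⟨p⟩
  let ι := {x : Plane × ℝ // (0 : Plane) ∈ ball x.1 x.2 ∧
    ∃ D, IsFlatOn D (ball x.1 x.2) ∧ D =ᶠ[𝓝 0] ψ}
  choose D hD hDψ using fun i : ι => i.2.2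
  obtain ⟨E, hE, hED⟩ := exists_isFlatOn_iUnion hD fun i j => by
    have ho := (isOpen_ball (x := i.1.1) (ε := i.1.2)).inter
      (isOpen_ball (x := j.1.1) (ε := j.1.2))
    exact IsFlatOn.eqOn hC ((convex_ball _ _).inter (convex_ball _ _)).isPreconnected
      ((hD i).mono ho inter_subset_left) ((hD j).mono ho inter_subset_right)
      ⟨i.2.1, j.2.1⟩ ((hDψ i).trans (hDψ j).symm)
  refine ⟨E, _, hE, ?_, fun c ρ F h0 hF hFψ =>
    subset_iUnion (fun i : ι => ball i.1.1 i.1.2) ⟨(c, ρ), h0, F, hF, hFψ⟩⟩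
  have h0 : (0 : Plane) ∈ ball (0 : Plane) ε := mem_ball_self hψ.pos
  let i : ι := ⟨(0, ε), h0, ψ, hψ.isFlatOn, EventuallyEq.rfl⟩
  exact ((hED i).eventuallyEq_of_mem (isOpen_ball.mem_nhds h0)).trans (hDψ i)

/-- Among the disks in `Ω` with respect to which the origin has the largest power there is one of
the largest radius. -/
theorem exists_max_power {Ω : Set Plane} {ε B : ℝ} (hε : 0 < ε) (h0 : ball (0 : Plane) ε ⊆ Ω)
    (hB : ∀ c ρ, ball c ρ ⊆ Ω → ‖c‖ < ρ → ρ ≤ B) :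
    ∃ c ρ, ball c ρ ⊆ Ω ∧ ‖c‖ < ρ ∧ ∀ c' ρ', ball c' ρ' ⊆ Ω → 0 ≤ ρ' →
      ρ ^ 2 - ‖c‖ ^ 2 ≤ ρ' ^ 2 - ‖c'‖ ^ 2 →
        ρ' ^ 2 - ‖c'‖ ^ 2 = ρ ^ 2 - ‖c‖ ^ 2 ∧ ρ' ≤ ρ := by
  obtain ⟨f, hf⟩ : ∃ f : Plane × ℝ → ℝ, f = fun x => x.2 ^ 2 - ‖x.1‖ ^ 2 := ⟨_, rfl⟩
  have hfc : Continuous f := by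
    rw [hf]
    exact (continuous_snd.pow 2).sub (continuous_fst.norm.pow 2)
  have hfa : ∀ c ρ, f (c, ρ) = ρ ^ 2 - ‖c‖ ^ 2 := fun c ρ => by rw [hf]
  -- The competitors at least as good as the initial disk. The bound `ε ^ 2` forces `‖c‖ < ρ`, so
  -- that `B` bounds this set, and it is closed, hence compact.
  obtain ⟨S, hS⟩ : ∃ S : Set (Plane × ℝ),
      S = {x | ball x.1 x.2 ⊆ Ω} ∩ ({x | 0 ≤ x.2} ∩ {x | ε ^ 2 ≤ f x}) := ⟨_, rfl⟩
  have hmem : ∀ c ρ, (c, ρ) ∈ S ↔ ball c ρ ⊆ Ω ∧ 0 ≤ ρ ∧ ε ^ 2 ≤ ρ ^ 2 - ‖c‖ ^ 2 :=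
    fun c ρ => by rw [hS, ← hfa]; exact Iff.rfl
  have hε2 : 0 < ε ^ 2 := by positivity
  have hlt : ∀ c ρ, (c, ρ) ∈ S → ‖c‖ < ρ := fun c ρ hx => by
    obtain ⟨-, h1, h2⟩ := (hmem c ρ).1 hx
    exact lt_of_pow_lt_pow_left₀ 2 h1 (by linarith)
  have hScpt : IsCompact S := by
    refine Metric.isCompact_of_isClosed_isBounded ?_ ?_
    · have h1 : IsClosed {x : Plane × ℝ | ball x.1 x.2 ⊆ Ω} := by
        have : {x : Plane × ℝ | ball x.1 x.2 ⊆ Ω} = ⋂ z ∈ Ωᶜ, {x | x.2 ≤ dist z x.1} := by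
          ext x
          simp only [mem_iInter, mem_compl_iff]
          constructor
          · intro h z hz
            by_contra hlt
            exact hz (h (mem_ball.2 (not_le.1 hlt)))
          · intro h z hz
            by_contra hzΩ
            exact not_le.2 (mem_ball.1 hz) (h z hzΩ)
        rw [this]
        exact isClosed_biInter fun z _ =>
          isClosed_le continuous_snd (continuous_const.dist continuous_fst)
      rw [hS]
      exact h1.inter ((isClosed_le continuous_const continuous_snd).inter
        (isClosed_le continuous_const hfc))
    · refine (isBounded_closedBall (x := (0 : Plane × ℝ)) (r := B)).subset ?_
      rintro ⟨c, ρ⟩ hx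
      have hb := hB c ρ ((hmem c ρ).1 hx).1 (hlt c ρ hx)
      rw [mem_closedBall_zero_iff, Prod.norm_def, Real.norm_of_nonneg ((hmem c ρ).1 hx).2.1]
      exact max_le ((hlt c ρ hx).le.trans hb) hb
  have h0mem : ((0 : Plane), ε) ∈ S := (hmem _ _).2 ⟨h0, hε.le, by simp⟩
  obtain ⟨x₁, hx₁, hmax₁⟩ := hScpt.exists_isMaxOn ⟨_, h0mem⟩ hfc.continuousOn
  have hS'cpt : IsCompact (S ∩ {x | f x₁ ≤ f x}) :=
    hScpt.inter_right (isClosed_le continuous_const hfc)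
  -- Lexicographic maximum: the radius is maximized over the compact set of maximizers of `f`.
  obtain ⟨⟨c, ρ⟩, ⟨hxS, hxf⟩, hmax₂⟩ :=
    hS'cpt.exists_isMaxOn ⟨x₁, hx₁, le_refl (f x₁)⟩ continuous_snd.continuousOn
  have hxf' : f x₁ ≤ f (c, ρ) := hxf
  obtain ⟨h4, h5, h6⟩ := (hmem c ρ).1 hxS
  refine ⟨c, ρ, h4, hlt c ρ hxS, fun c' ρ' h1 h2 h3 => ?_⟩
  have hm : (c', ρ') ∈ S := (hmem _ _).2 ⟨h1, h2, h6.trans h3⟩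
  have h7 : f (c', ρ') ≤ f x₁ := hmax₁ hm
  have h8 : f (c, ρ) ≤ f (c', ρ') := by rw [hfa, hfa]; exact h3
  have h9 : ρ' ≤ ρ := hmax₂ (a := (c', ρ')) ⟨hm, hxf'.trans h8⟩
  refine ⟨?_, h9⟩
  rw [← hfa, ← hfa]
  exact le_antisymm (h7.trans hxf') h8

/-- Each point other than a cone point lies in the Delaunay cell of a Voronoi vertex. -/
theorem exists_zero_mem_delaunayCell [CompactSpace C] (hC : IsPositiveEuclideanConeMetric C)
    (hV : (conePoints C).Nonempty) {p : C} (hp : p ∉ conePoints C) :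
    ∃ (c : Plane) (D : Plane → C), IsDelaunayDisk c D ∧ 3 ≤ (markedPoints c D).encard ∧
      D 0 = p ∧ (0 : Plane) ∈ delaunayCell c D := by
  obtain ⟨ψ, ε₀, hψ⟩ := exists_isChart (locallyEuclideanAt_of_notMem hC hp)
  obtain ⟨E, Ω, hE, hEψ, hin⟩ := hψ.exists_developing hC
  have hΩr : ∀ c ρ, ball c ρ ⊆ Ω → ρ ≤ coneRadius (E c) := fun c ρ h =>
    le_coneRadius hV ((hE.mono isOpen_ball h).disjoint_ball hC)
  have h00 : (0 : Plane) ∈ ball (0 : Plane) ε₀ := mem_ball_self hψ.pos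
  obtain ⟨v, hv⟩ := hV
  obtain ⟨B, hB⟩ := (isBounded_of_compactSpace (s := (univ : Set C))).subset_closedBall v
  obtain ⟨c, ρ, hcΩ, hcρ, hmax⟩ := exists_max_power (Ω := Ω) (B := B) hψ.pos
    (hin 0 ε₀ ψ h00 hψ.isFlatOn EventuallyEq.rfl) fun c ρ h _ =>
      (hΩr c ρ h).trans ((coneRadius_le_dist hv).trans (hB (mem_univ _)))
  have hV : (conePoints C).Nonempty := ⟨v, hv⟩
  have hρ0 : 0 ≤ ρ := (norm_nonneg c).trans hcρ.le
  have hcm : c ∈ ball c ρ := mem_ball_self ((norm_nonneg c).trans_lt hcρ)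
  obtain ⟨D, hD, hDE⟩ := (hE.mono isOpen_ball hcΩ).exists_isDelaunayDisk hC hV hcm
  set r := coneRadius (D c) with hr
  have hρr : ρ ≤ r := by rw [hr, hDE.eq_of_nhds]; exact hΩr _ _ hcΩ
  have h0ρ : (0 : Plane) ∈ ball c ρ := by rwa [mem_ball, dist_zero_left]
  have h0r : (0 : Plane) ∈ ball c r := ball_subset_ball hρr h0ρ
  have hDψ : D =ᶠ[𝓝 0] ψ := by
    have h1 : EqOn D E (ball c ρ) := IsFlatOn.eqOn hC (convex_ball c ρ).isPreconnected
      (hD.isFlatOn.mono isOpen_ball (ball_subset_ball hρr)) (hE.mono isOpen_ball hcΩ) hcm hDE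
    exact (h1.eventuallyEq_of_mem (isOpen_ball.mem_nhds h0ρ)).trans hEψ
  -- The Delaunay disk about the same centre is itself a competitor, so the maximal disk cannot be
  -- enlarged.
  have hrρ : r = ρ := by
    refine le_antisymm (hmax c r (hin c r D h0r hD.isFlatOn hDψ) hD.radius_pos.le ?_).2 hρr
    have h2 : ρ ^ 2 ≤ r ^ 2 := by gcongr
    linarith
  have hMfin := hD.finite_markedPoints hC
  -- the marked points in directions close to the centre
  obtain ⟨η, hη, hpert⟩ : ∃ η > 0, ∀ z ∈ ball c η, ∃ m ∈ markedPoints c D,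
      0 < inner ℝ m (z - c) ∨ inner ℝ m (z - c) = 0 ∧ dist m z ≤ r := by
    obtain ⟨η, hη, hηr, hsub⟩ := hD.exists_markedPoints_subset hC
    refine ⟨min η ((r - ‖c‖) / 2), lt_min hη (by linarith), fun z hz => ?_⟩
    have hzη : z ∈ ball c η := ball_subset_ball (min_le_left _ _) hz
    have hzr : dist z c < (r - ‖c‖) / 2 := (mem_ball.1 hz).trans_le (min_le_right _ _)
    have hzcr := ball_subset_ball hηr.le hzη
    obtain ⟨F, hF, hFD⟩ := hD.isFlatOn.exists_isDelaunayDisk hC hV hzcr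
    obtain ⟨m, hm⟩ := hF.markedPoints_nonempty hC
    have hmM := hsub z hzη F hF hFD hm
    have hFr : r ≤ coneRadius (F z) + dist z c := by
      have h1 := coneRadius_le_add (D c) (D z)
      have h2 := hD.dist_le (ball_subset_closedBall hzcr)
        (mem_closedBall_self hD.radius_pos.le)
      rw [dist_comm] at h1
      rw [hFD.eq_of_nhds]
      linarith
    have h0z : (0 : Plane) ∈ ball z (coneRadius (F z)) := by
      have h1 := norm_le_norm_add_norm_sub' z c
      rw [← dist_eq_norm] at h1
      rw [mem_ball, dist_zero_left]
      linarith
    have hFψ : F =ᶠ[𝓝 0] ψ := by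
      have h1 := hF.eqOn hC hD (mem_ball_self hF.radius_pos) hzcr hFD
      exact (h1.eventuallyEq_of_mem
        ((isOpen_ball.inter isOpen_ball).mem_nhds ⟨h0z, h0r⟩)).trans hDψ
    have hmz : dist m z = coneRadius (F z) := hm.1
    have hmc : dist m c = r := hmM.1
    have e1 := power_eq (m := m) (c := z)
    have e2 := power_eq (m := m) (c := c)
    have e3 : inner ℝ m (z - c) = inner ℝ m z - inner ℝ m c := inner_sub_right _ _ _
    refine ⟨m, hmM, ?_⟩
    by_cases hpos : 0 < inner ℝ m (z - c)
    · exact Or.inl hpos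
    · right
      -- When the inner product is not positive, the disk about `z` does at least as well as the
      -- maximal one; maximality then gives equality and bounds its radius.
      obtain ⟨h1, h2⟩ := hmax z _ (hin z _ F h0z hF.isFlatOn hFψ) hF.radius_pos.le (by
        rw [← hrρ, ← hmz, ← hmc]; linarith)
      rw [← hrρ, ← hmz, ← hmc] at h1
      refine ⟨by linarith, ?_⟩
      rw [hmz, hrρ]
      exact h2
  obtain ⟨hcell, h3⟩ := zero_mem_convexHull_and_three_le hMfin (hD.markedPoints_nonempty hC)
    (fun m hm => hm.1) (by rwa [mem_ball, dist_zero_left] at h0r) hη hpert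
  exact ⟨c, D, hD, h3, by rw [hDψ.eq_of_nhds, hψ.zero], hcell⟩

/-! ### Triangles in the plane -/

/-- The affine basis formed by the corners of a triangle. -/
noncomputable def triBasis {p : Fin 3 → Plane} (hp : AffineIndependent ℝ p) :
    AffineBasis (Fin 3) ℝ Plane :=
  ⟨p, hp, by
    rw [hp.affineSpan_eq_top_iff_card_eq_finrank_add_one]
    simp [finrank_euclideanSpace]⟩

@[simp] theorem triBasis_apply {p : Fin 3 → Plane} (hp : AffineIndependent ℝ p) (k : Fin 3) :
    triBasis hp k = p k := rfl

theorem convexHull_eq_coord {p : Fin 3 → Plane} (hp : AffineIndependent ℝ p) :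
    convexHull ℝ (range p) = {z | ∀ k, 0 ≤ (triBasis hp).coord k z} :=
  (triBasis hp).convexHull_eq_nonneg_coord

theorem sum_fin_three (f : Fin 3 → ℝ) (k : Fin 3) : ∑ i, f i = f k + f (k + 1) + f (k + 2) := by
  rw [Fin.sum_univ_three]
  fin_cases k <;> simp <;> ring

theorem affineMap_eq_sum {p : Fin 3 → Plane} (hp : AffineIndependent ℝ p) (l : Plane →ᵃ[ℝ] ℝ)
    (z : Plane) : l z = ∑ k, (triBasis hp).coord k z * l (p k) := by
  have h1 := (triBasis hp).affineCombination_coord_eq_self z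
  have h2 := Finset.univ.map_affineCombination (⇑(triBasis hp))
    (fun k => (triBasis hp).coord k z) ((triBasis hp).sum_coord_apply_eq_one z) l
  rw [h1] at h2
  rw [h2, Finset.affineCombination_eq_linear_combination _ _ _
    ((triBasis hp).sum_coord_apply_eq_one z)]
  simp

theorem eq_lineMap_of_coord_eq_zero {p : Fin 3 → Plane} (hp : AffineIndependent ℝ p) {k : Fin 3}
    {z : Plane} (hz : (triBasis hp).coord k z = 0) :
    z = AffineMap.lineMap (p (k + 1)) (p (k + 2)) ((triBasis hp).coord (k + 2) z) := by
  have h1 := (triBasis hp).linear_combination_coord_eq_self z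
  have h2 := (triBasis hp).sum_coord_apply_eq_one z
  rw [sum_fin_three _ k] at h2
  have h3 : ∑ i, (triBasis hp).coord i z • triBasis hp i = (triBasis hp).coord k z • p k +
      (triBasis hp).coord (k + 1) z • p (k + 1) + (triBasis hp).coord (k + 2) z • p (k + 2) := by
    rw [Fin.sum_univ_three]
    fin_cases k
    · rfl
    · simp only [triBasis_apply, Fin.mk_one, Fin.isValue, Fin.reduceAdd]; abel
    · simp only [triBasis_apply, Fin.reduceFinMk, Fin.isValue, Fin.reduceAdd]; abel
  have h4 : (triBasis hp).coord (k + 1) z = 1 - (triBasis hp).coord (k + 2) z := by linarith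
  rw [hz, zero_smul, zero_add, h4, h1] at h3
  rw [AffineMap.lineMap_apply_module]
  exact h3

theorem eq_corner_of_coord_eq_zero {p : Fin 3 → Plane} (hp : AffineIndependent ℝ p) {k : Fin 3}
    {z : Plane} (hz : (triBasis hp).coord k z = 0) (hz' : (triBasis hp).coord (k + 1) z = 0) :
    z = p (k + 2) := by
  have h2 := (triBasis hp).sum_coord_apply_eq_one z
  rw [sum_fin_three _ k, hz, hz', zero_add, zero_add] at h2
  have := eq_lineMap_of_coord_eq_zero hp hz
  rwa [h2, AffineMap.lineMap_apply_one] at this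

theorem fin_three_add_one_ne (k : Fin 3) : k + 1 ≠ k := by fin_cases k <;> decide

theorem fin_three_add_two_ne (k : Fin 3) : k + 2 ≠ k := by fin_cases k <;> decide

theorem fin_three_add_two_ne_add_one (k : Fin 3) : k + 2 ≠ k + 1 := by fin_cases k <;> decide

theorem fin_three_eq_or (k l : Fin 3) : l = k ∨ l = k + 1 ∨ l = k + 2 := by
  fin_cases k <;> fin_cases l <;> simp

/-- A point of a triangle at which an affine function attains its minimum on the triangle lies on an
edge, if the function vanishes at two corners at most. -/
theorem exists_edge_of_nonneg {p : Fin 3 → Plane} (hp : AffineIndependent ℝ p)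
    {l : Plane →ᵃ[ℝ] ℝ} (hl : ∀ k, 0 ≤ l (p k)) {a b : Plane}
    (hab : ∀ k, l (p k) = 0 → p k = a ∨ p k = b) {y : Plane}
    (hy : y ∈ convexHull ℝ (range p)) (hyp : y ∉ range p) (hly : l y ≤ 0) :
    ∃ k, (p (k + 1) = a ∧ p (k + 2) = b ∨ p (k + 1) = b ∧ p (k + 2) = a) ∧
      ∃ κ : ℝ, 0 < κ ∧ (∀ z, (triBasis hp).coord k z = κ * l z) ∧ l y = 0 := by
  have hinj := hp.injective
  have hw : ∀ k, 0 ≤ (triBasis hp).coord k y := by rwa [convexHull_eq_coord hp] at hy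
  have hwl : ∀ k, (triBasis hp).coord k y * l (p k) = 0 := by
    have h1 := affineMap_eq_sum hp l y
    have h2 : ∀ k ∈ Finset.univ, 0 ≤ (triBasis hp).coord k y * l (p k) :=
      fun k _ => mul_nonneg (hw k) (hl k)
    have h3 : ∑ k, (triBasis hp).coord k y * l (p k) = 0 :=
      le_antisymm (h1 ▸ hly) (Finset.sum_nonneg h2)
    exact fun k => (Finset.sum_eq_zero_iff_of_nonneg h2).1 h3 k (Finset.mem_univ k)
  -- Three distinct corners cannot all be among `a` and `b`.
  obtain ⟨k, hk⟩ : ∃ k, l (p k) ≠ 0 := by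
    by_contra! h
    have e : ∀ i j : Fin 3, i ≠ j → p i ≠ p j := fun i j hij h => hij (hinj h)
    have e1 := e 0 1 (by decide)
    have e2 := e 0 2 (by decide)
    have e3 := e 1 2 (by decide)
    rcases hab 0 (h 0) with h0 | h0 <;> rcases hab 1 (h 1) with h1 | h1 <;>
      rcases hab 2 (h 2) with h2 | h2 <;> simp_all
  have hwk : (triBasis hp).coord k y = 0 := (mul_eq_zero.1 (hwl k)).resolve_right hk
  have h1 : l (p (k + 1)) = 0 := by
    refine (mul_eq_zero.1 (hwl (k + 1))).resolve_left fun h => hyp ?_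
    exact ⟨_, (eq_corner_of_coord_eq_zero hp hwk h).symm⟩
  have h2 : l (p (k + 2)) = 0 := by
    refine (mul_eq_zero.1 (hwl (k + 2))).resolve_left fun h => hyp ?_
    have h3 : k + 2 + 1 = k := by fin_cases k <;> rfl
    exact ⟨_, (eq_corner_of_coord_eq_zero hp h (by rwa [h3])).symm⟩
  -- Since `l` vanishes at the other two corners, it is a positive multiple of the barycentric
  -- coordinate of the corner `k`.
  have hsum : ∀ z, l z = (triBasis hp).coord k z * l (p k) := fun z => by
    rw [affineMap_eq_sum hp l z, sum_fin_three _ k, h1, h2]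
    ring
  refine ⟨k, ?_, (l (p k))⁻¹, inv_pos.2 (lt_of_le_of_ne (hl k) (Ne.symm hk)), fun z => ?_, ?_⟩
  · have hne : p (k + 1) ≠ p (k + 2) := fun h => fin_three_add_two_ne_add_one k (hinj h).symm
    rcases hab _ h1 with h3 | h3 <;> rcases hab _ h2 with h4 | h4
    · exact absurd (h3.trans h4.symm) hne
    · exact Or.inl ⟨h3, h4⟩
    · exact Or.inr ⟨h3, h4⟩
    · exact absurd (h3.trans h4.symm) hne
  · rw [hsum z]
    field_simp
  · rw [hsum, hwk, zero_mul]

/-- The isometry `h` maps the `k`-th edge of the triangle `p` to the `l`-th edge of the triangle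
`q`, and the triangle `p` to the other side of this edge. -/
def EdgeMatch {p q : Fin 3 → Plane} (hp : AffineIndependent ℝ p) (hq : AffineIndependent ℝ q)
    (h : Plane ≃ᵃⁱ[ℝ] Plane) (k l : Fin 3) : Prop :=
  (h (p (k + 1)) = q (l + 1) ∧ h (p (k + 2)) = q (l + 2) ∨
    h (p (k + 1)) = q (l + 2) ∧ h (p (k + 2)) = q (l + 1)) ∧
  ∃ κ : ℝ, 0 < κ ∧ ∀ z, (triBasis hq).coord l (h z) = -κ * (triBasis hp).coord k z

/-- Triangles on different sides of a line meet along a common edge, if the line contains two of the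
corners at most. -/
theorem exists_edgeMatch {p q : Fin 3 → Plane} (hp : AffineIndependent ℝ p)
    (hq : AffineIndependent ℝ q) (h : Plane ≃ᵃⁱ[ℝ] Plane) {l : Plane →ᵃ[ℝ] ℝ}
    (hlp : ∀ k, l (p k) ≤ 0) (hlq : ∀ k, 0 ≤ l (h.symm (q k))) {a b : Plane}
    (hpab : ∀ k, l (p k) = 0 → p k = a ∨ p k = b)
    (hqab : ∀ k, l (h.symm (q k)) = 0 → h.symm (q k) = a ∨ h.symm (q k) = b) {y : Plane}
    (hyp : y ∈ convexHull ℝ (range p)) (hyp' : y ∉ range p)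
    (hyq : h y ∈ convexHull ℝ (range q)) (hyq' : h y ∉ range q) :
    ∃ k j, EdgeMatch hp hq h k j ∧ (triBasis hp).coord k y = 0 := by
  let g : Plane →ᵃ[ℝ] ℝ := l.comp (h.symm.toAffineEquiv : Plane →ᵃ[ℝ] Plane)
  have hg : ∀ z, g z = l (h.symm z) := fun z => rfl
  have hly : 0 ≤ l y := by
    have h1 : convexHull ℝ (range q) ⊆ g ⁻¹' (Ici 0) :=
      convexHull_min (by rintro _ ⟨k, rfl⟩; exact hlq k) ((convex_Ici 0).affine_preimage g)
    have h2 : 0 ≤ g (h y) := h1 hyq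
    rwa [hg, h.symm_apply_apply] at h2
  have hly' : l y ≤ 0 := by
    have h1 : convexHull ℝ (range p) ⊆ l ⁻¹' (Iic 0) :=
      convexHull_min (by rintro _ ⟨k, rfl⟩; exact hlp k) ((convex_Iic 0).affine_preimage l)
    exact h1 hyp
  obtain ⟨k, hk, κ, hκ, hcoord, hy0⟩ := exists_edge_of_nonneg hp (l := -l)
    (fun k => by simpa using hlp k) (a := a) (b := b) (fun k hk => hpab k (by simpa using hk))
    hyp hyp' (by simpa using hly)
  obtain ⟨j, hj, κ', hκ', hcoord', -⟩ := exists_edge_of_nonneg hq (l := g) hlq (a := h a)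
    (b := h b) (fun k hk => by
      rcases hqab k hk with h1 | h1
      · exact Or.inl (by rw [← h1, h.apply_symm_apply])
      · exact Or.inr (by rw [← h1, h.apply_symm_apply])) hyq hyq'
    (by rwa [hg, h.symm_apply_apply])
  refine ⟨k, j, ⟨?_, κ' / κ, by positivity, fun z => ?_⟩, ?_⟩
  · rcases hk with ⟨h1, h2⟩ | ⟨h1, h2⟩ <;> rcases hj with ⟨h3, h4⟩ | ⟨h3, h4⟩ <;>
      simp [h1, h2, h3, h4]
  · rw [hcoord, hcoord', hg, h.symm_apply_apply]
    simp only [AffineMap.coe_neg, Pi.neg_apply]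
    field_simp
  · rw [hcoord, hy0, mul_zero]

/-! ### Triangulating a polygon inscribed in a circle -/

/-- The affine function `z ↦ ⟪w, z⟫ + d`. -/
noncomputable def affineInner (w : Plane) (d : ℝ) : Plane →ᵃ[ℝ] ℝ :=
  (innerSL ℝ w).toLinearMap.toAffineMap + AffineMap.const ℝ Plane d

@[simp] theorem affineInner_apply (w : Plane) (d : ℝ) (z : Plane) :
    affineInner w d z = inner ℝ w z + d := rfl

/-- Two affine coordinates `a` and `b` adapted to the point `m` of a circle: the lines through `m`
are given by constant values of `a / b`, and `b (1 + (a / b) ^ 2)` is constant on the circle. -/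
theorem exists_circle_coords {c m : Plane} {r : ℝ} (hr : 0 < r) (hm : m ∈ sphere c r) :
    ∃ a b : Plane →ᵃ[ℝ] ℝ, a m = 0 ∧ b m = 0 ∧ (∀ z w, a z = a w → b z = b w → z = w) ∧
      (∀ z ∈ closedBall c r, 0 ≤ b z ∧ (b z = 0 → z = m)) ∧
      ∀ z ∈ sphere c r, a z ^ 2 + b z ^ 2 = 2 * r ^ 2 * b z := by
  have hz2 : ∀ z, dist z c ^ 2 = (z 0 - c 0) ^ 2 + (z 1 - c 1) ^ 2 := fun z => by
    rw [EuclideanSpace.dist_eq, Fin.sum_univ_two, Real.sq_sqrt (by positivity)]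
    simp [Real.dist_eq, sq_abs]
  have hm2 : (m 0 - c 0) ^ 2 + (m 1 - c 1) ^ 2 = r ^ 2 := by
    rw [← hz2, mem_sphere.1 hm]
  -- The functions `a` and `b` are the components of `z - m` along the tangent at `m` and along the
  -- inward normal, times `r`. Thus `a ^ 2 + b ^ 2` is `r ^ 2` times the squared distance to `m`,
  -- which on the circle is `2 * b`.
  obtain ⟨a, ha⟩ : ∃ a : Plane →ᵃ[ℝ] ℝ, ∀ z,
      a z = (z 0 - m 0) * (m 1 - c 1) - (z 1 - m 1) * (m 0 - c 0) := by
    refine ⟨affineInner !₂[m 1 - c 1, -(m 0 - c 0)]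
      (-(m 0 * (m 1 - c 1)) + m 1 * (m 0 - c 0)), fun z => ?_⟩
    simp [PiLp.inner_apply, Fin.sum_univ_two]
    ring
  obtain ⟨b, hb⟩ : ∃ b : Plane →ᵃ[ℝ] ℝ, ∀ z,
      b z = -((z 0 - m 0) * (m 0 - c 0) + (z 1 - m 1) * (m 1 - c 1)) := by
    refine ⟨affineInner !₂[-(m 0 - c 0), -(m 1 - c 1)]
      (m 0 * (m 0 - c 0) + m 1 * (m 1 - c 1)), fun z => ?_⟩
    simp [PiLp.inner_apply, Fin.sum_univ_two]
    ring
  refine ⟨a, b, by simp [ha], by simp [hb], fun z w h1 h2 => ?_, fun z hz => ?_, fun z hz => ?_⟩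
  · rw [ha, ha] at h1
    rw [hb, hb] at h2
    have h3 : r ^ 2 * (z 0 - w 0) = 0 := by
      rw [← hm2]
      linear_combination (m 1 - c 1) * h1 - (m 0 - c 0) * h2
    have h4 : r ^ 2 * (z 1 - w 1) = 0 := by
      rw [← hm2]
      linear_combination -(m 0 - c 0) * h1 - (m 1 - c 1) * h2
    have hr2 : r ^ 2 ≠ 0 := by positivity
    ext i
    fin_cases i
    · exact sub_eq_zero.1 ((mul_eq_zero.1 h3).resolve_left hr2)
    · exact sub_eq_zero.1 ((mul_eq_zero.1 h4).resolve_left hr2)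
  · have h1 : dist z c ^ 2 ≤ r ^ 2 := by
      have := mem_closedBall.1 hz
      gcongr
    rw [hz2] at h1
    have h2 : (z 0 - m 0) ^ 2 + (z 1 - m 1) ^ 2 ≤ 2 * b z := by
      rw [hb]
      nlinarith
    refine ⟨by nlinarith [sq_nonneg (z 0 - m 0), sq_nonneg (z 1 - m 1)], fun h => ?_⟩
    rw [h, mul_zero] at h2
    have h3 : z 0 - m 0 = 0 := by nlinarith [sq_nonneg (z 0 - m 0), sq_nonneg (z 1 - m 1)]
    have h4 : z 1 - m 1 = 0 := by nlinarith [sq_nonneg (z 0 - m 0), sq_nonneg (z 1 - m 1)]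
    ext i
    fin_cases i
    · exact sub_eq_zero.1 h3
    · exact sub_eq_zero.1 h4
  · have h1 : dist z c ^ 2 = r ^ 2 := by rw [mem_sphere.1 hz]
    rw [hz2] at h1
    rw [ha, hb]
    have h5 : (z 0 - m 0) ^ 2 + (z 1 - m 1) ^ 2 =
        -2 * ((z 0 - m 0) * (m 0 - c 0) + (z 1 - m 1) * (m 1 - c 1)) := by
      linear_combination h1 - hm2
    linear_combination ((m 0 - c 0) ^ 2 + (m 1 - c 1) ^ 2) * h5 -
      2 * ((z 0 - m 0) * (m 0 - c 0) + (z 1 - m 1) * (m 1 - c 1)) * hm2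

/-- A real number between the extreme elements of a finite set lies between consecutive elements. -/
theorem exists_consecutive {S : Set ℝ} (hS : S.Finite) {s₀ s₁ u : ℝ} (h₀ : s₀ ∈ S) (h₁ : s₁ ∈ S)
    (h₀₁ : s₀ < s₁) (hu₀ : s₀ ≤ u) (hu₁ : u ≤ s₁) :
    ∃ s ∈ S, ∃ s' ∈ S, s < s' ∧ (∀ w ∈ S, w ≤ s ∨ s' ≤ w) ∧ s ≤ u ∧ u ≤ s' := by
  have hfin₁ : {w ∈ S | w ≤ u ∧ w < s₁}.Finite := hS.subset fun w hw => hw.1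
  obtain ⟨s, ⟨hs, hsu, hs1⟩, hmax⟩ := hfin₁.exists_maximal ⟨s₀, h₀, hu₀, h₀₁⟩
  have hfin₂ : {w ∈ S | s < w}.Finite := hS.subset fun w hw => hw.1
  obtain ⟨s', ⟨hs', hss'⟩, hmin⟩ := hfin₂.exists_minimal ⟨s₁, h₁, hs1⟩
  refine ⟨s, hs, s', hs', hss', fun w hw => ?_, hsu, ?_⟩
  · rcases le_or_gt w s with h | h
    · exact Or.inl h
    · right
      by_contra hlt
      exact hlt (hmin ⟨hw, h⟩ (not_le.1 hlt).le)
  · by_contra hlt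
    have h2 := not_le.1 hlt
    exact not_lt.2 (hmax ⟨hs', h2.le, h2.trans_le hu₁⟩ hss'.le) hss'

theorem affineMap_combination (l : Plane →ᵃ[ℝ] ℝ) {α β γ : ℝ} (h : α + β + γ = 1)
    (x y z : Plane) : l (α • x + β • y + γ • z) = α * l x + β * l y + γ * l z := by
  have hl : ∀ w, l w = l.linear w + l 0 := fun w => congrFun l.decomp w
  rw [hl, hl x, hl y, hl z]
  simp only [map_add, map_smul, smul_eq_mul]
  linear_combination -(l 0) * h

/-- The convex hull of a finite set of points of a circle has a triangulation without further
vertices. -/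
theorem exists_fan {M : Set Plane} {c : Plane} {r : ℝ} (hr : 0 < r) (hM : M ⊆ sphere c r)
    (hfin : M.Finite) (h3 : 3 ≤ M.encard) :
    ∃ F : Set (Fin 3 → Plane), F.Finite ∧ (∀ p ∈ F, AffineIndependent ℝ p ∧ ∀ k, p k ∈ M) ∧
      convexHull ℝ M = ⋃ p ∈ F, convexHull ℝ (range p) ∧
      ∀ p ∈ F, ∀ q ∈ F, p ≠ q → ∃ (l : Plane →ᵃ[ℝ] ℝ) (a b : Plane), (∀ k, l (p k) ≤ 0) ∧
        (∀ k, 0 ≤ l (q k)) ∧ (∀ k, l (p k) = 0 → p k = a ∨ p k = b) ∧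
        ∀ k, l (q k) = 0 → q k = a ∨ q k = b := by
  -- The apex of the fan is `m`. The other marked points are parametrized by the slopes `a / b` of
  -- the lines joining them to `m`, and consecutive slopes give the triangles.
  obtain ⟨m, hm, m₁, hm₁, m₂, hm₂, h01, h02, h12⟩ := exists_three_of_le_encard h3
  obtain ⟨a, b, ham, hbm, hinj, hball, hcirc⟩ := exists_circle_coords hr (hM hm)
  have hr2 : 0 < 2 * r ^ 2 := by positivity
  have hslope : ∀ z ∈ M, z ≠ m → 0 < b z ∧ a z = a z / b z * b z ∧
      b z * (1 + (a z / b z) ^ 2) = 2 * r ^ 2 := fun z hz hzm => by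
    obtain ⟨h1, h2⟩ := hball z (sphere_subset_closedBall (hM hz))
    have h4 : b z ≠ 0 := fun h => hzm (h2 h)
    have h5 : 0 < b z := lt_of_le_of_ne h1 (Ne.symm h4)
    refine ⟨h5, (div_mul_cancel₀ _ h4).symm, ?_⟩
    have := hcirc z (hM hz)
    field_simp
    linarith
  have huniq : ∀ z w s, a z = s * b z → a w = s * b w → b z * (1 + s ^ 2) = 2 * r ^ 2 →
      b w * (1 + s ^ 2) = 2 * r ^ 2 → z = w := fun z w s h1 h2 h4 h5 => by
    have h6 : b z = b w := mul_right_cancel₀ (by positivity : 1 + s ^ 2 ≠ 0) (h4.trans h5.symm)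
    exact hinj z w (by rw [h1, h2, h6]) h6
  obtain ⟨S, hS⟩ : ∃ S : Set ℝ, S = (fun z => a z / b z) '' (M \ {m}) := ⟨_, rfl⟩
  have hSfin : S.Finite := hS ▸ (hfin.subset sdiff_subset).image _
  have hpt : ∀ s ∈ S, ∃ z ∈ M, z ≠ m ∧ 0 < b z ∧ a z = s * b z ∧
      b z * (1 + s ^ 2) = 2 * r ^ 2 := by
    rw [hS]
    rintro _ ⟨z, ⟨hz, hzm⟩, rfl⟩
    exact ⟨z, hz, hzm, hslope z hz hzm⟩
  choose! pt hptM hptm hptb hpta hptr using hpt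
  have hMS : ∀ z ∈ M, z ≠ m → a z / b z ∈ S := fun z hz hzm => hS ▸ ⟨z, ⟨hz, hzm⟩, rfl⟩
  obtain ⟨s₀, hs₀, hmin⟩ := hSfin.exists_minimalFor id _ ⟨_, hMS m₁ hm₁ (Ne.symm h01)⟩
  obtain ⟨s₁, hs₁, hmax⟩ := hSfin.exists_maximalFor id _ ⟨_, hMS m₁ hm₁ (Ne.symm h01)⟩
  have hle : ∀ s ∈ S, s₀ ≤ s ∧ s ≤ s₁ := fun s hs =>
    ⟨(le_total s₀ s).elim id fun h => hmin hs h, (le_total s s₁).elim id fun h => hmax hs h⟩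
  have h₀₁ : s₀ < s₁ := by
    refine lt_of_le_of_ne (hle _ hs₁).1 fun heq => h12 ?_
    have e : ∀ s ∈ S, s = s₀ := fun s hs =>
      le_antisymm ((hle s hs).2.trans heq.ge) (hle s hs).1
    obtain ⟨-, h4, h5⟩ := hslope m₁ hm₁ (Ne.symm h01)
    obtain ⟨-, h6, h7⟩ := hslope m₂ hm₂ (Ne.symm h02)
    rw [e _ (hMS m₁ hm₁ (Ne.symm h01))] at h4 h5
    rw [e _ (hMS m₂ hm₂ (Ne.symm h02))] at h6 h7
    exact huniq _ _ _ h4 h6 h5 h7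
  obtain ⟨I, hI⟩ : ∃ I : Set (ℝ × ℝ), ∀ s s', (s, s') ∈ I ↔
      s ∈ S ∧ s' ∈ S ∧ s < s' ∧ ∀ w ∈ S, w ≤ s ∨ s' ≤ w :=
    ⟨{x | x.1 ∈ S ∧ x.2 ∈ S ∧ x.1 < x.2 ∧ ∀ w ∈ S, w ≤ x.1 ∨ x.2 ≤ w}, fun _ _ => Iff.rfl⟩
  have hIfin : I.Finite := (hSfin.prod hSfin).subset fun x hx =>
    ⟨((hI x.1 x.2).1 hx).1, ((hI x.1 x.2).1 hx).2.1⟩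
  have hpne : ∀ s ∈ S, ∀ s' ∈ S, s ≠ s' → pt s ≠ pt s' := fun s hs s' hs' hne h => by
    have h4 := hpta s hs
    rw [h, hpta s' hs'] at h4
    exact hne (mul_right_cancel₀ (hptb s' hs').ne' h4).symm
  refine ⟨(fun x : ℝ × ℝ => ![m, pt x.1, pt x.2]) '' I, hIfin.image _, ?_, ?_, ?_⟩
  · rintro _ ⟨⟨s, s'⟩, hss, rfl⟩
    obtain ⟨hs, hs', hlt, -⟩ := (hI s s').1 hss
    have hmem : ∀ k, (![m, pt s, pt s'] : Fin 3 → Plane) k ∈ M := by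
      simp [Fin.forall_fin_succ, hm, hptM s hs, hptM s' hs']
    refine ⟨?_, hmem⟩
    refine EuclideanGeometry.Cospherical.affineIndependent (s := sphere c r)
      ⟨c, r, fun z hz => mem_sphere.1 hz⟩ (by rintro _ ⟨k, rfl⟩; exact hM (hmem k)) ?_
    have e1 := hptm s hs
    have e2 := hptm s' hs'
    have e3 := hpne s hs s' hs' hlt.ne
    intro i j hij
    fin_cases i <;> fin_cases j <;>
      first
      | rfl
      | exact absurd hij e1
      | exact absurd hij e2
      | exact absurd hij e3
      | exact absurd hij.symm e1
      | exact absurd hij.symm e2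
      | exact absurd hij.symm e3
  · apply subset_antisymm
    · intro y hy
      have haff : ∀ l : Plane →ᵃ[ℝ] ℝ, (∀ z ∈ M, 0 ≤ l z) → 0 ≤ l y := fun l hl =>
        convexHull_min (t := l ⁻¹' (Ici 0)) hl ((convex_Ici 0).affine_preimage l) hy
      have hyb : y ∈ closedBall c r :=
        convexHull_min (hM.trans sphere_subset_closedBall) (convex_closedBall c r) hy
      obtain ⟨u, hu0, hu1, huy⟩ : ∃ u, s₀ ≤ u ∧ u ≤ s₁ ∧ a y = u * b y := by
        rcases eq_or_lt_of_le (hball y hyb).1 with h | h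
        · have hym := (hball y hyb).2 h.symm
          exact ⟨s₀, le_rfl, h₀₁.le, by rw [hym, ham, hbm, mul_zero]⟩
        · refine ⟨a y / b y, ?_, ?_, (div_mul_cancel₀ _ h.ne').symm⟩
          · rw [le_div_iff₀ h]
            have := haff (a - s₀ • b) fun z hz => by
              by_cases hzm : z = m
              · simp [hzm, ham, hbm]
              · obtain ⟨h4, h5, -⟩ := hslope z hz hzm
                have h6 := (hle _ (hMS z hz hzm)).1
                simp only [AffineMap.coe_sub, AffineMap.coe_smul, Pi.sub_apply, Pi.smul_apply,
                  smul_eq_mul, sub_nonneg]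
                rw [h5]
                gcongr
            simpa using this
          · rw [div_le_iff₀ h]
            have := haff (s₁ • b - a) fun z hz => by
              by_cases hzm : z = m
              · simp [hzm, ham, hbm]
              · obtain ⟨h4, h5, -⟩ := hslope z hz hzm
                have h6 := (hle _ (hMS z hz hzm)).2
                simp only [AffineMap.coe_sub, AffineMap.coe_smul, Pi.sub_apply, Pi.smul_apply,
                  smul_eq_mul, sub_nonneg]
                rw [h5]
                gcongr
            simpa using this
      obtain ⟨s, hs, s', hs', hlt, hcons, hsu, hus⟩ :=
        exists_consecutive hSfin hs₀ hs₁ h₀₁ hu0 hu1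
      refine mem_biUnion (mem_image_of_mem _ ((hI s s').2 ⟨hs, hs', hlt, hcons⟩)) ?_
      have hd : 0 < s' - s := sub_pos.2 hlt
      -- The point `y` lies on the same side of the chord from `pt s` to `pt s'` as `m`. It suffices
      -- to check marked points: at one of slope `w` the affine function is `b (s' - s) (w - s) (w -
      -- s')`, nonnegative because no slope lies strictly between `s` and `s'`.
      have hg : 0 ≤ 2 * r ^ 2 * (s' - s) - ((s' * b y - a y) * (1 + s ^ 2) +
          (a y - s * b y) * (1 + s' ^ 2)) := by
        have := haff (AffineMap.const ℝ Plane (2 * r ^ 2 * (s' - s)) -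
          ((1 + s ^ 2) • (s' • b - a) + (1 + s' ^ 2) • (a - s • b))) fun z hz => by
            simp only [AffineMap.coe_sub, AffineMap.coe_smul, Pi.sub_apply, Pi.smul_apply,
              smul_eq_mul, AffineMap.coe_add, Pi.add_apply, AffineMap.coe_const,
              Function.const_apply]
            by_cases hzm : z = m
            · rw [hzm, ham, hbm]
              have := mul_pos hr2 hd
              linarith
            · obtain ⟨h4, h5, h6⟩ := hslope z hz hzm
              have h7 := hcons _ (hMS z hz hzm)
              generalize a z / b z = w at h5 h6 h7
              have h8 : 0 ≤ (w - s) * (w - s') := by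
                rcases h7 with h | h
                · exact mul_nonneg_of_nonpos_of_nonpos (by linarith) (by linarith)
                · exact mul_nonneg (by linarith) (by linarith)
              have h9 : 0 ≤ b z * ((s' - s) * ((w - s) * (w - s'))) := by positivity
              rw [h5]
              linear_combination h9 + (s' - s) * h6
        simp only [AffineMap.coe_sub, AffineMap.coe_smul, Pi.sub_apply, Pi.smul_apply,
          smul_eq_mul, AffineMap.coe_add, Pi.add_apply, AffineMap.coe_const,
          Function.const_apply] at this
        linarith
      have hb0 := (hball y hyb).1
      have hα : 0 ≤ s' * b y - a y := by rw [huy, ← sub_mul]; exact mul_nonneg (by linarith) hb0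
      have hβ : 0 ≤ a y - s * b y := by rw [huy, ← sub_mul]; exact mul_nonneg (by linarith) hb0
      have hQ : 0 < 2 * r ^ 2 * (s' - s) := mul_pos hr2 hd
      -- The barycentric coordinates of `y` in the triangle with corners `m`, `pt s`, `pt s'`, found
      -- by solving for the values of `a` and `b`.
      obtain ⟨α, hαe⟩ : ∃ α, α = (s' * b y - a y) * (1 + s ^ 2) / (2 * r ^ 2 * (s' - s)) :=
        ⟨_, rfl⟩
      obtain ⟨β, hβe⟩ : ∃ β, β = (a y - s * b y) * (1 + s' ^ 2) / (2 * r ^ 2 * (s' - s)) :=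
        ⟨_, rfl⟩
      have hα0 : 0 ≤ α := by rw [hαe]; positivity
      have hβ0 : 0 ≤ β := by rw [hβe]; positivity
      have hγ0 : 0 ≤ 1 - α - β := by
        have h4 : 1 - α - β = (2 * r ^ 2 * (s' - s) - ((s' * b y - a y) * (1 + s ^ 2) +
          (a y - s * b y) * (1 + s' ^ 2))) / (2 * r ^ 2 * (s' - s)) := by
          rw [hαe, hβe]
          field_simp
          ring
        rw [h4]
        positivity
      have hαs : α * b (pt s) = (s' * b y - a y) / (s' - s) := by
        rw [hαe, ← hptr s hs]
        have := hptb s hs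
        field_simp
      have hβs : β * b (pt s') = (a y - s * b y) / (s' - s) := by
        rw [hβe, ← hptr s' hs']
        have := hptb s' hs'
        field_simp
      have hsum : 1 - α - β + α + β = 1 := by ring
      have hy' : y = (1 - α - β) • m + α • pt s + β • pt s' := by
        apply hinj
        · rw [affineMap_combination a hsum, ham, hpta s hs, hpta s' hs', mul_left_comm α,
            mul_left_comm β, hαs, hβs]
          field_simp
          ring
        · rw [affineMap_combination b hsum, hbm, hαs, hβs]
          field_simp
          ring
      rw [hy']
      have hmem : ∀ k, (![m, pt s, pt s'] : Fin 3 → Plane) k ∈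
          convexHull ℝ (range (![m, pt s, pt s'] : Fin 3 → Plane)) :=
        fun k => subset_convexHull ℝ _ (mem_range_self k)
      have := (convex_convexHull ℝ (range (![m, pt s, pt s'] : Fin 3 → Plane))).sum_mem
        (t := Finset.univ) (w := ![1 - α - β, α, β]) (z := ![m, pt s, pt s'])
        (fun k _ => by fin_cases k; exacts [hγ0, hα0, hβ0])
        (by rw [Fin.sum_univ_three]; exact hsum)
        (fun k _ => hmem k)
      simpa [Fin.sum_univ_three] using this
    · refine iUnion₂_subset ?_
      rintro _ ⟨⟨s, s'⟩, hss, rfl⟩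
      obtain ⟨hs, hs', -⟩ := (hI s s').1 hss
      refine convexHull_mono ?_
      rintro _ ⟨k, rfl⟩
      fin_cases k
      exacts [hm, hptM s hs, hptM s' hs']
  · rintro _ ⟨⟨s, s'⟩, hss, rfl⟩ _ ⟨⟨t, t'⟩, htt, rfl⟩ hne
    obtain ⟨hs, hs', hlt, hcons⟩ := (hI s s').1 hss
    obtain ⟨ht, ht', hlt', hcons'⟩ := (hI t t').1 htt
    have hsgn : ∀ w ∈ S, ∀ d, (a - d • b) (pt w) = (w - d) * b (pt w) := fun w hw d => by
      simp only [AffineMap.coe_sub, AffineMap.coe_smul, Pi.sub_apply, Pi.smul_apply, smul_eq_mul]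
      rw [hpta w hw]
      ring
    have hsgnm : ∀ d : ℝ, (a - d • b) m = 0 := fun d => by simp [ham, hbm]
    have hsgn_le : ∀ w ∈ S, ∀ d, w ≤ d → (a - d • b) (pt w) ≤ 0 := fun w hw d h => by
      rw [hsgn w hw]
      exact mul_nonpos_of_nonpos_of_nonneg (by linarith) (hptb w hw).le
    have hsgn_ge : ∀ w ∈ S, ∀ d, d ≤ w → 0 ≤ (a - d • b) (pt w) := fun w hw d h => by
      rw [hsgn w hw]
      exact mul_nonneg (by linarith) (hptb w hw).le
    have hsgn_eq : ∀ w ∈ S, ∀ d, (a - d • b) (pt w) = 0 → pt w = m ∨ pt w = pt d :=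
        fun w hw d h => by
      rw [hsgn w hw] at h
      rw [sub_eq_zero.1 ((mul_eq_zero.1 h).resolve_right (hptb w hw).ne')]
      exact Or.inr rfl
    -- Different intervals between consecutive slopes do not overlap, so a line through `m` whose
    -- slope is an endpoint of one of them separates the triangles.
    have hcases : s' ≤ t ∨ t' ≤ s := by
      rcases hcons t ht with h | h
      · rcases hcons' s hs with h' | h'
        · exfalso
          obtain rfl := le_antisymm h h'
          have h4 : t' ≤ s' := (hcons' s' hs').resolve_left (not_le.2 hlt)
          have h5 : s' ≤ t' := (hcons t' ht').resolve_left (not_le.2 hlt')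
          obtain rfl := le_antisymm h4 h5
          exact hne rfl
        · exact Or.inr h'
      · exact Or.inl h
    rcases hcases with h | h
    · refine ⟨a - t • b, m, pt t, ?_, ?_, ?_, ?_⟩ <;>
        simp only [Fin.forall_fin_succ, Matrix.cons_val_zero, Matrix.cons_val_succ, hsgnm,
          IsEmpty.forall_iff, le_refl, true_or, or_true, implies_true, and_true, true_and]
      · exact ⟨hsgn_le s hs _ (hlt.le.trans h), hsgn_le s' hs' _ h⟩
      · exact ⟨hsgn_ge t ht _ le_rfl, hsgn_ge t' ht' _ hlt'.le⟩
      · exact ⟨hsgn_eq s hs _, hsgn_eq s' hs' _⟩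
      · exact hsgn_eq t' ht' _
    · refine ⟨-(a - s • b), m, pt s, ?_, ?_, ?_, ?_⟩ <;>
        simp only [Fin.forall_fin_succ, Matrix.cons_val_zero, Matrix.cons_val_succ,
          AffineMap.coe_neg, Pi.neg_apply, neg_eq_zero, hsgnm, neg_nonneg, neg_nonpos,
          IsEmpty.forall_iff, le_refl, true_or, or_true, implies_true, and_true, true_and]
      · exact ⟨hsgn_ge s hs _ le_rfl, hsgn_ge s' hs' _ hlt.le⟩
      · exact ⟨hsgn_le t ht _ (hlt'.le.trans h), hsgn_le t' ht' _ h⟩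
      · exact hsgn_eq s' hs' _
      · exact ⟨hsgn_eq t ht _, hsgn_eq t' ht' _⟩

/-! ### Overlaying Delaunay disks -/

/-- By strict convexity, the open disk together with any set of points of its circle is convex. -/
theorem mem_ball_of_mem_convexHull {M : Set Plane} {c : Plane} {r : ℝ} (hr : 0 < r)
    (hM : M ⊆ sphere c r) {y : Plane} (hy : y ∈ convexHull ℝ M) (hyM : y ∉ M) : y ∈ ball c r := by
  have hconv : Convex ℝ (ball c r ∪ M) := by
    rw [convex_iff_openSegment_subset]
    have hcl : ∀ x ∈ ball c r ∪ M, x ∈ closedBall c r := fun x hx =>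
      hx.elim (fun h => ball_subset_closedBall h) fun h => sphere_subset_closedBall (hM h)
    intro x hx z hz
    rcases eq_or_ne x z with rfl | hne
    · simpa using hx
    · intro w hw
      have h := (strictConvex_closedBall ℝ c r).openSegment_subset (hcl x hx) (hcl z hz) hne hw
      rw [interior_closedBall c hr.ne'] at h
      exact Or.inl h
  exact (convexHull_min subset_union_right hconv hy).resolve_right hyM

/-- The difference of the powers with respect to two circles. -/
theorem exists_power_affine (c c' : Plane) (r r' : ℝ) :
    ∃ l : Plane →ᵃ[ℝ] ℝ, ∀ z, l z = (dist z c ^ 2 - r ^ 2) - (dist z c' ^ 2 - r' ^ 2) := by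
  refine ⟨affineInner ((2 : ℝ) • (c' - c)) (‖c‖ ^ 2 - r ^ 2 - (‖c'‖ ^ 2 - r' ^ 2)), fun z => ?_⟩
  rw [affineInner_apply, inner_smul_left, inner_sub_left, dist_eq_norm, dist_eq_norm,
    norm_sub_sq_real, norm_sub_sq_real, real_inner_comm c z, real_inner_comm c' z]
  simp only [RCLike.conj_to_real]
  ring

theorem exists_pair_of_ne {c c' : Plane} (hc : c ≠ c') (r r' : ℝ) :
    ∃ a b, ∀ z, dist z c = r → dist z c' = r' → z = a ∨ z = b := by
  by_cases hne : {z : Plane | dist z c = r ∧ dist z c' = r'}.Nonempty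
  · obtain ⟨a, -, b, -, hab⟩ := exists_subset_pair hne fun h =>
      hc (eq_of_three_dist_eq h (fun m hm => hm.1) fun m hm => hm.2)
    exact ⟨a, b, fun z h1 h2 => by simpa using hab ⟨h1, h2⟩⟩
  · exact ⟨0, 0, fun z h1 h2 => absurd ⟨z, h1, h2⟩ hne⟩

/-- The empty circle property: the maps agree on the overlap of the closed disks, and the interior
of a Delaunay disk contains no preimage of a cone point. -/
theorem _root_.IsDelaunayDisk.le_dist_of_overlay (hC : IsPositiveEuclideanConeMetric C)
    {c c' : Plane} {D E : Plane → C} (hD : IsDelaunayDisk c D) (hE : IsDelaunayDisk c' E)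
    {y : Plane} (hy : y ∈ ball c (coneRadius (D c))) (hy' : y ∈ ball c' (coneRadius (E c')))
    (h : D =ᶠ[𝓝 y] E) {m : Plane} (hm : m ∈ markedPoints c D) :
    coneRadius (E c') ≤ dist m c' ∧ (dist m c' = coneRadius (E c') → m ∈ markedPoints c' E) := by
  have heq := hD.eqOn_closedBall hC hE hy hy' h
  constructor
  · by_contra! hlt
    have h1 := heq ⟨sphere_subset_closedBall hm.1, ball_subset_closedBall hlt⟩
    exact hE.empty_interior m hlt (h1 ▸ hm.2)
  · intro hd
    have h1 := heq ⟨sphere_subset_closedBall hm.1, hd.le⟩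
    exact ⟨hd, h1 ▸ hm.2⟩

/-- The radical axis of two overlapping Delaunay disks separates their marked points. -/
theorem _root_.IsDelaunayDisk.exists_separating (hC : IsPositiveEuclideanConeMetric C)
    {c c' : Plane} {D E : Plane → C} (hD : IsDelaunayDisk c D) (hE : IsDelaunayDisk c' E)
    {y : Plane} (hy : y ∈ ball c (coneRadius (D c))) (hy' : y ∈ ball c' (coneRadius (E c')))
    (h : D =ᶠ[𝓝 y] E) (hcc : c ≠ c') :
    ∃ (l : Plane →ᵃ[ℝ] ℝ) (a b : Plane),
      (∀ m ∈ markedPoints c D, l m ≤ 0 ∧ (l m = 0 → m ∈ markedPoints c' E ∧ (m = a ∨ m = b))) ∧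
      ∀ m ∈ markedPoints c' E, 0 ≤ l m ∧ (l m = 0 → m ∈ markedPoints c D ∧ (m = a ∨ m = b)) := by
  obtain ⟨l, hl⟩ := exists_power_affine c c' (coneRadius (D c)) (coneRadius (E c'))
  obtain ⟨a, b, hab⟩ := exists_pair_of_ne hcc (coneRadius (D c)) (coneRadius (E c'))
  -- A marked point has power zero with respect to its own circle and nonnegative power with respect
  -- to the other. If both vanish it lies on both circles, which have at most two common points.
  refine ⟨l, a, b, fun m hm => ?_, fun m hm => ?_⟩
  · obtain ⟨h1, h2⟩ := hD.le_dist_of_overlay hC hE hy hy' h hm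
    have hmc : dist m c = coneRadius (D c) := hm.1
    rw [hl, hmc]
    have h3 : coneRadius (E c') ^ 2 ≤ dist m c' ^ 2 := by
      have := hE.radius_pos
      gcongr
    refine ⟨by linarith, fun h0 => ?_⟩
    have h4 : dist m c' = coneRadius (E c') :=
      (pow_left_inj₀ dist_nonneg hE.radius_pos.le two_ne_zero).1 (by linarith)
    exact ⟨h2 h4, hab m hmc h4⟩
  · obtain ⟨h1, h2⟩ := hE.le_dist_of_overlay hC hD hy' hy h.symm hm
    have hmc : dist m c' = coneRadius (E c') := hm.1
    rw [hl, hmc]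
    have h3 : coneRadius (D c) ^ 2 ≤ dist m c ^ 2 := by
      have := hD.radius_pos
      gcongr
    refine ⟨by linarith, fun h0 => ?_⟩
    have h4 : dist m c = coneRadius (D c) :=
      (pow_left_inj₀ dist_nonneg hD.radius_pos.le two_ne_zero).1 (by linarith)
    exact ⟨h2 h4, hab m h4 hmc⟩

/-- `D` can be cancelled because it is injective near the common point; the rigid motions then agree
on an open set. -/
theorem _root_.IsDelaunayDisk.eq_of_comp_eventuallyEq {c : Plane} {D : Plane → C}
    (hD : IsDelaunayDisk c D) {A B : Plane ≃ᵃⁱ[ℝ] Plane} {y : Plane} (hAB : A y = B y)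
    (hy : A y ∈ ball c (coneRadius (D c))) (h : D ∘ A =ᶠ[𝓝 y] D ∘ B) : A = B := by
  obtain ⟨-, δ, hδ, -, hi⟩ := hD.isFlatOn _ hy
  refine affineIsometryEquiv_eq_of_eventuallyEq (y := y) ?_
  have h1 : ∀ᶠ z in 𝓝 y, A z ∈ ball (A y) δ :=
    A.continuous.continuousAt.eventually_mem (ball_mem_nhds _ hδ)
  have h2 : ∀ᶠ z in 𝓝 y, B z ∈ ball (A y) δ :=
    B.continuous.continuousAt.eventually_mem (hAB ▸ ball_mem_nhds _ hδ)
  filter_upwards [h, h1, h2] with z hz hz1 hz2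
  exact hi.injOn hz1 hz2 hz

/-- Delaunay disks about the same point differ by an isometry of the plane. -/
theorem _root_.IsDelaunayDisk.exists_isometry (hC : IsPositiveEuclideanConeMetric C)
    {c c' : Plane} {D E : Plane → C} (hD : IsDelaunayDisk c D) (hE : IsDelaunayDisk c' E)
    (h : D c = E c') : ∃ A : Plane ≃ᵃⁱ[ℝ] Plane, A c = c' ∧
      EqOn D (E ∘ A) (closedBall c (coneRadius (D c))) ∧
      A '' markedPoints c D = markedPoints c' E := by
  have hcE : c' ∈ ball c' (coneRadius (E c')) := mem_ball_self hE.radius_pos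
  obtain ⟨A, hA, hDE⟩ :=
    hD.isFlatOn.exists_overlay hC hE.isFlatOn (mem_ball_self hD.radius_pos) hcE h
  have hEA := hE.comp A
  have hAc : A.symm c' = c := by rw [← hA, A.symm_apply_apply]
  rw [hAc] at hEA
  have hr : (E ∘ A) c = D c := hDE.eq_of_nhds.symm
  have heq := hD.eqOn_closedBall hC hEA (mem_ball_self hD.radius_pos)
    (mem_ball_self hEA.radius_pos) hDE
  rw [hr, inter_self] at heq
  refine ⟨A, hA, heq, ?_⟩
  have hmem : ∀ z, z ∈ markedPoints c D ↔ A z ∈ markedPoints c' E := fun z => by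
    simp only [markedPoints, mem_ofPred_eq, mem_sphere, ← hA, A.dist_map]
    rw [hA, ← h]
    refine and_congr_right fun hz => ?_
    rw [heq (mem_closedBall.2 hz.le)]
    rfl
  ext z
  constructor
  · rintro ⟨w, hw, rfl⟩
    exact (hmem w).1 hw
  · intro hz
    exact ⟨A.symm z, (hmem _).2 (by rwa [A.apply_symm_apply]), A.apply_symm_apply z⟩

theorem _root_.IsDelaunayDisk.image_delaunayCell {c c' : Plane} {D E : Plane → C}
    {A : Plane ≃ᵃⁱ[ℝ] Plane} (h : A '' markedPoints c D = markedPoints c' E) :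
    A '' delaunayCell c D = delaunayCell c' E := by
  rw [delaunayCell, delaunayCell, ← h]
  exact (A.toAffineEquiv : Plane →ᵃ[ℝ] Plane).image_convexHull _

theorem _root_.IsDelaunayDisk.mem_ball_of_mem_triangle {c : Plane} {D : Plane → C}
    (hD : IsDelaunayDisk c D) {p : Fin 3 → Plane} (hp : ∀ k, p k ∈ markedPoints c D) {x : Plane}
    (hx : x ∈ convexHull ℝ (range p)) (hxp : x ∉ range p) : x ∈ ball c (coneRadius (D c)) :=
  mem_ball_of_mem_convexHull hD.radius_pos (by rintro _ ⟨k, rfl⟩; exact (hp k).1) hx hxp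

theorem _root_.IsDelaunayDisk.notMem_range {c c' : Plane} {D E : Plane → C}
    (hD : IsDelaunayDisk c D) {q : Fin 3 → Plane} (hq : ∀ k, q k ∈ markedPoints c' E)
    {x y : Plane} (hx : x ∈ ball c (coneRadius (D c))) (h : D x = E y) : y ∉ range q := by
  rintro ⟨k, rfl⟩
  exact hD.empty_interior x hx (h ▸ (hq k).2)

/-- Triangles inscribed in overlapping Delaunay disks with different centres meet along a common
edge. -/
theorem _root_.IsDelaunayDisk.exists_edgeMatch (hC : IsPositiveEuclideanConeMetric C)
    {c c' : Plane} {D E : Plane → C} (hD : IsDelaunayDisk c D) (hE : IsDelaunayDisk c' E)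
    {p q : Fin 3 → Plane} (hp : AffineIndependent ℝ p) (hq : AffineIndependent ℝ q)
    (hpm : ∀ k, p k ∈ markedPoints c D) (hqm : ∀ k, q k ∈ markedPoints c' E)
    (h : Plane ≃ᵃⁱ[ℝ] Plane) {x : Plane} (hx : x ∈ convexHull ℝ (range p)) (hxp : x ∉ range p)
    (hhx : h x ∈ convexHull ℝ (range q)) (heq : D =ᶠ[𝓝 x] E ∘ h) (hcc : c ≠ h.symm c') :
    ∃ k l, EdgeMatch hp hq h k l ∧ (triBasis hp).coord k x = 0 := by
  have hxb := hD.mem_ball_of_mem_triangle hpm hx hxp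
  have hhxn : h x ∉ range q := hD.notMem_range hqm hxb heq.eq_of_nhds
  have hhxb := hE.mem_ball_of_mem_triangle hqm hhx hhxn
  have hxb' : x ∈ ball (h.symm c') (coneRadius ((E ∘ h) (h.symm c'))) := by
    rw [Function.comp, mem_ball, ← h.dist_map, h.apply_symm_apply]
    exact hhxb
  obtain ⟨l, a, b, h1, h2⟩ := hD.exists_separating hC (hE.comp h) hxb hxb' heq hcc
  have hm' : ∀ k, h.symm (q k) ∈ markedPoints (h.symm c') (E ∘ h) := fun k => by
    rw [mem_markedPoints_comp, h.apply_symm_apply]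
    exact hqm k
  exact ConeSphere.exists_edgeMatch hp hq h (fun k => (h1 _ (hpm k)).1)
    (fun k => (h2 _ (hm' k)).1) (fun k hk => ((h1 _ (hpm k)).2 hk).2)
    (fun k hk => ((h2 _ (hm' k)).2 hk).2) hx hxp hhx hhxn

/-- Overlaid disks with a common centre belong to the same point of `C`. This reduces the case
without a radical axis to triangles of one cell. -/
theorem _root_.IsDelaunayDisk.center_eq (hC : IsPositiveEuclideanConeMetric C)
    {c c' : Plane} {D E : Plane → C} (hD : IsDelaunayDisk c D) (hE : IsDelaunayDisk c' E)
    (h : Plane ≃ᵃⁱ[ℝ] Plane) {x : Plane} (hx : x ∈ ball c (coneRadius (D c)))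
    (hhx : h x ∈ ball c' (coneRadius (E c'))) (heq : D =ᶠ[𝓝 x] E ∘ h) (hcc : c = h.symm c') :
    D c = E c' := by
  have hxb' : x ∈ ball (h.symm c') (coneRadius ((E ∘ h) (h.symm c'))) := by
    rw [Function.comp, mem_ball, ← h.dist_map, h.apply_symm_apply]
    exact hhx
  have hE' := hE.comp h
  have h1 := hD.eqOn hC hE' hx hxb' heq ⟨mem_ball_self hD.radius_pos, by
    rw [hcc]; exact mem_ball_self hE'.radius_pos⟩
  rw [h1, hcc, Function.comp, h.apply_symm_apply]

/-! ### The triangles inscribed in the Delaunay disks -/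

/-- Triangles inscribed in Delaunay disks that cover `C` and meet along edges. -/
structure DelaunayFamily (C : Type*) [MetricSpace C] (ι : Type*) where
  /-- the centres of the disks -/
  center : ι → Plane
  /-- the disks -/
  disk : ι → Plane → C
  /-- the corners of the triangles -/
  corner : ι → Fin 3 → Plane
  isDelaunayDisk : ∀ i, IsDelaunayDisk (center i) (disk i)
  affineIndependent : ∀ i, AffineIndependent ℝ (corner i)
  corner_mem : ∀ i k, corner i k ∈ markedPoints (center i) (disk i)
  overlay : ∀ i j (h : Plane ≃ᵃⁱ[ℝ] Plane), ∀ x ∈ convexHull ℝ (range (corner i)),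
    x ∉ range (corner i) → h x ∈ convexHull ℝ (range (corner j)) →
    disk i =ᶠ[𝓝 x] disk j ∘ h → i = j ∧ h = AffineIsometryEquiv.refl ℝ Plane ∨
    ∃ k l, EdgeMatch (affineIndependent i) (affineIndependent j) h k l ∧
      (triBasis (affineIndependent i)).coord k x = 0
  covers : ∀ p ∉ conePoints C, ∃ i, ∃ x ∈ convexHull ℝ (range (corner i)), disk i x = p

/-- The triangles of the subdivided Delaunay cells of the Voronoi vertices. -/
theorem exists_delaunayFamily [CompactSpace C] (hC : IsPositiveEuclideanConeMetric C)
    (hV : (conePoints C).Nonempty) : ∃ (n : ℕ) (F : DelaunayFamily C (Fin n)),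
      (∀ i, IsVoronoiVertex (F.disk i (F.center i))) ∧
      ∀ x, IsVoronoiVertex x → ∃ c D, IsDelaunayDisk c D ∧ D c = x ∧ ∃ I : Set (Fin n),
        delaunayCell c D = ⋃ i ∈ I, convexHull ℝ (range (F.corner i)) ∧
        ∀ i ∈ I, F.center i = c ∧ F.disk i = D := by
  have hdisk : ∀ x : {x : C | IsVoronoiVertex x}, ∃ D : Plane → C, IsDelaunayDisk 0 D ∧ D 0 = x :=
    fun x => exists_isDelaunayDisk hC hV x.2.notMem_conePoints 0
  choose D hD hD0 using hdisk
  have h3 : ∀ x, 3 ≤ (markedPoints 0 (D x)).encard := fun x => by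
    rw [← isVoronoiVertex_iff hC (hD x), hD0]
    exact x.2
  choose T hTfin hT hTcell hTsep using fun x => exists_fan (hD x).radius_pos
    (fun m (hm : m ∈ markedPoints 0 (D x)) => hm.1) ((hD x).finite_markedPoints hC) (h3 x)
  have : Finite {x : C | IsVoronoiVertex x} := finite_isVoronoiVertex hC hV
  have : ∀ x, Finite (T x) := fun x => hTfin x
  obtain ⟨n, ⟨e⟩⟩ := Finite.exists_equiv_fin (Σ x : {x : C | IsVoronoiVertex x}, T x)
  have hmark : ∀ (s : Σ x : {x : C | IsVoronoiVertex x}, T x) k,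
      (s.2 : Fin 3 → Plane) k ∈ markedPoints 0 (D s.1) := fun s => (hT s.1 _ s.2.2).2
  have hover : ∀ (s t : Σ x : {x : C | IsVoronoiVertex x}, T x) (h : Plane ≃ᵃⁱ[ℝ] Plane),
      ∀ x ∈ convexHull ℝ (range (s.2 : Fin 3 → Plane)), x ∉ range (s.2 : Fin 3 → Plane) →
      h x ∈ convexHull ℝ (range (t.2 : Fin 3 → Plane)) → D s.1 =ᶠ[𝓝 x] D t.1 ∘ h →
      s = t ∧ h = AffineIsometryEquiv.refl ℝ Plane ∨
      ∃ k l, EdgeMatch (hT _ _ s.2.2).1 (hT _ _ t.2.2).1 h k l ∧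
        (triBasis (hT _ _ s.2.2).1).coord k x = 0 := by
    rintro ⟨x₁, p, hp⟩ ⟨x₂, q, hq⟩ h x hx hxn hhx heq
    have hpm := hmark ⟨x₁, p, hp⟩
    have hqm := hmark ⟨x₂, q, hq⟩
    simp only at hx hxn hhx heq hpm hqm
    have hxb := (hD _).mem_ball_of_mem_triangle hpm hx hxn
    have hhxn := (hD _).notMem_range hqm hxb heq.eq_of_nhds
    have hhxb := (hD _).mem_ball_of_mem_triangle hqm hhx hhxn
    by_cases hcc : 0 = h.symm 0
    · have h0 := (hD x₁).center_eq hC (hD x₂) h hxb hhxb heq hcc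
      obtain rfl : x₁ = x₂ := Subtype.ext (by rw [← hD0, ← hD0, h0])
      have hh0 : h 0 = 0 := by
        nth_rewrite 1 [hcc]
        exact h.apply_symm_apply 0
      have h0b : (0 : Plane) ∈ ball 0 (coneRadius (D x₁ 0)) := mem_ball_self (hD x₁).radius_pos
      -- Now `D` and `D ∘ h` agree on the disk and `h` fixes its centre, where `D` is injective; so
      -- the overlay has no rotation or reflection.
      have hh : AffineIsometryEquiv.refl ℝ Plane = h := by
        have hE := (hD x₁).comp h
        rw [← hcc] at hE
        have h1 := (hD x₁).eqOn hC hE hxb (by simpa [Function.comp, hh0] using hxb) heq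
        have h2 : (D x₁ ∘ h) 0 = D x₁ 0 := by simp [hh0]
        rw [h2, inter_self] at h1
        exact (hD x₁).eq_of_comp_eventuallyEq (y := 0) (by simp [hh0]) (by simpa using h0b)
          (h1.eventuallyEq_of_mem (isOpen_ball.mem_nhds h0b))
      subst hh
      by_cases hpq : p = q
      · subst hpq
        exact Or.inl ⟨rfl, rfl⟩
      · obtain ⟨l, a, b, h1, h2, h3, h4⟩ := hTsep x₁ p hp q hq hpq
        exact Or.inr (exists_edgeMatch _ _ _ h1 h2 h3 h4 hx hxn hhx hhxn)
    · exact Or.inr ((hD x₁).exists_edgeMatch hC (hD x₂) _ _ hpm hqm h hx hxn hhx heq hcc)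
  let F : DelaunayFamily C (Fin n) :=
    { center := fun _ => 0
      disk := fun i => D (e.symm i).1
      corner := fun i => (e.symm i).2
      isDelaunayDisk := fun i => hD _
      affineIndependent := fun i => (hT _ _ (e.symm i).2.2).1
      corner_mem := fun i => hmark _
      overlay := by
        intro i j h x hx hxn hhx heq
        exact (hover (e.symm i) (e.symm j) h x hx hxn hhx heq).imp_left
          fun h' => ⟨e.symm.injective h'.1, h'.2⟩
      covers := by
        intro p hp
        obtain ⟨c, E, hE, hE3, rfl, h0⟩ := exists_zero_mem_delaunayCell hC hV hp
        have hv : IsVoronoiVertex (E c) := (isVoronoiVertex_iff hC hE).2 hE3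
        obtain ⟨A, hA, hEA, hmarks⟩ := hE.exists_isometry hC (hD ⟨_, hv⟩) (hD0 ⟨_, hv⟩).symm
        have h1 : A 0 ∈ delaunayCell 0 (D ⟨_, hv⟩) := by
          rw [← IsDelaunayDisk.image_delaunayCell hmarks]
          exact mem_image_of_mem _ h0
        rw [delaunayCell, hTcell] at h1
        obtain ⟨q, hq, hq'⟩ := mem_iUnion₂.1 h1
        refine ⟨e ⟨⟨_, hv⟩, q, hq⟩, A 0, by
          rw [Equiv.symm_apply_apply]; exact hq', ?_⟩
        have h2 : (0 : Plane) ∈ closedBall c (coneRadius (E c)) :=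
          convexHull_min (fun m hm => sphere_subset_closedBall hm.1) (convex_closedBall _ _) h0
        rw [hEA h2, Equiv.symm_apply_apply]
        rfl }
  refine ⟨n, F, fun i => ?_, fun x hx => ?_⟩
  · exact (isVoronoiVertex_iff hC (hD _)).2 (h3 _)
  · refine ⟨0, D ⟨x, hx⟩, hD _, hD0 _, {i | (e.symm i).1 = ⟨x, hx⟩}, ?_, ?_⟩
    · rw [delaunayCell, hTcell]
      ext y
      simp only [mem_iUnion]
      constructor
      · rintro ⟨q, hq, hy⟩
        exact ⟨e ⟨⟨x, hx⟩, q, hq⟩, by simp, by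
          simp only [F]; rw [Equiv.symm_apply_apply]; exact hy⟩
      · rintro ⟨i, hi, hy⟩
        have hi' : (e.symm i).1 = ⟨x, hx⟩ := hi
        exact ⟨_, hi' ▸ (e.symm i).2.2, hy⟩
    · intro i hi
      have hi' : (e.symm i).1 = ⟨x, hx⟩ := hi
      exact ⟨rfl, congrArg D hi'⟩

/-! ### Gluing the triangles along their edges -/

theorem coord_lineMap {p : Fin 3 → Plane} (hp : AffineIndependent ℝ p) (k : Fin 3) (t : ℝ) :
    (triBasis hp).coord k (AffineMap.lineMap (p (k + 1)) (p (k + 2)) t) = 0 ∧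
    (triBasis hp).coord (k + 1) (AffineMap.lineMap (p (k + 1)) (p (k + 2)) t) = 1 - t ∧
    (triBasis hp).coord (k + 2) (AffineMap.lineMap (p (k + 1)) (p (k + 2)) t) = t := by
  have h : ∀ i j, (triBasis hp).coord i (p j) = if i = j then 1 else 0 :=
    fun i j => (triBasis hp).coord_apply i j
  have e1 := fin_three_add_one_ne k
  have e2 := fin_three_add_two_ne k
  have e3 := fin_three_add_two_ne_add_one k
  refine ⟨?_, ?_, ?_⟩ <;> rw [AffineMap.apply_lineMap, h, h, AffineMap.lineMap_apply_ring']
  · simp [e1.symm, e2.symm]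
  · simp [e3.symm]
    ring
  · simp [e3]

namespace DelaunayFamily

variable {ι : Type*} (F : DelaunayFamily C ι)

/-- The triangles. -/
def face (i : ι) : Set Plane := convexHull ℝ (range (F.corner i))

/-- The point with parameter `t` on an edge. -/
noncomputable def edgePoint (e : ι × Fin 3) (t : ℝ) : Plane :=
  AffineMap.lineMap (F.corner e.1 (e.2 + 1)) (F.corner e.1 (e.2 + 2)) t

/-- The barycentric coordinates of the triangles. -/
noncomputable def coord (e : ι × Fin 3) : Plane →ᵃ[ℝ] ℝ :=
  (triBasis (F.affineIndependent e.1)).coord e.2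

theorem isCompact_face (i : ι) : IsCompact (F.face i) :=
  (finite_range _).isCompact_convexHull ℝ

theorem corner_mem_face (i : ι) (k : Fin 3) : F.corner i k ∈ F.face i :=
  subset_convexHull ℝ _ (mem_range_self k)

theorem face_subset (i : ι) :
    F.face i ⊆ closedBall (F.center i) (coneRadius (F.disk i (F.center i))) :=
  convexHull_min (by rintro _ ⟨k, rfl⟩; exact sphere_subset_closedBall (F.corner_mem i k).1)
    (convex_closedBall _ _)

theorem continuousOn_face (i : ι) : ContinuousOn (F.disk i) (F.face i) :=
  (F.isDelaunayDisk i).continuousOn.mono (F.face_subset i)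

variable {F}

theorem mem_face_iff {i : ι} {x : Plane} : x ∈ F.face i ↔ ∀ k, 0 ≤ F.coord (i, k) x := by
  rw [face, convexHull_eq_coord (F.affineIndependent i)]
  rfl

theorem mem_ball {i : ι} {x : Plane} (hx : x ∈ F.face i) (hxn : x ∉ range (F.corner i)) :
    x ∈ ball (F.center i) (coneRadius (F.disk i (F.center i))) :=
  (F.isDelaunayDisk i).mem_ball_of_mem_triangle (F.corner_mem i) hx hxn

theorem mem_conePoints_iff {i : ι} {x : Plane} (hx : x ∈ F.face i) :
    F.disk i x ∈ conePoints C ↔ x ∈ range (F.corner i) := by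
  constructor
  · intro h
    by_contra hxn
    exact (F.isDelaunayDisk i).empty_interior x (mem_ball hx hxn) h
  · rintro ⟨k, rfl⟩
    exact (F.corner_mem i k).2

theorem coord_corner (i : ι) (k l : Fin 3) :
    F.coord (i, k) (F.corner i l) = if k = l then 1 else 0 :=
  (triBasis (F.affineIndependent i)).coord_apply k l

theorem coord_edgePoint (e : ι × Fin 3) (t : ℝ) : F.coord e (F.edgePoint e t) = 0 ∧
    F.coord (e.1, e.2 + 1) (F.edgePoint e t) = 1 - t ∧
    F.coord (e.1, e.2 + 2) (F.edgePoint e t) = t :=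
  coord_lineMap (F.affineIndependent e.1) e.2 t

theorem edgePoint_mem_face (e : ι × Fin 3) {t : ℝ} (ht : t ∈ Icc (0 : ℝ) 1) :
    F.edgePoint e t ∈ F.face e.1 := by
  obtain ⟨h1, h2, h3⟩ := F.coord_edgePoint e t
  rw [mem_face_iff]
  intro k
  rcases fin_three_eq_or e.2 k with rfl | rfl | rfl
  · exact h1.ge
  · rw [h2]; linarith [ht.2]
  · rw [h3]; exact ht.1

theorem edgePoint_notMem_range (e : ι × Fin 3) {t : ℝ} (ht : t ∈ Ioo (0 : ℝ) 1) :
    F.edgePoint e t ∉ range (F.corner e.1) := by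
  obtain ⟨h1, h2, h3⟩ := F.coord_edgePoint e t
  rintro ⟨k, hk⟩
  rw [← hk] at h1 h2 h3
  rw [coord_corner] at h2 h3
  have := ht.1
  have := ht.2
  split_ifs at h2 h3 <;> linarith

theorem edgePoint_injective (e : ι × Fin 3) : Function.Injective (F.edgePoint e) :=
  AffineMap.lineMap_injective ℝ
    ((F.affineIndependent e.1).injective.ne (fin_three_add_two_ne_add_one e.2).symm)

theorem continuous_edgePoint (e : ι × Fin 3) : Continuous (F.edgePoint e) :=
  AffineMap.lineMap_continuous

theorem half_mem : (1 / 2 : ℝ) ∈ Ioo (0 : ℝ) 1 := by constructor <;> norm_num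

theorem mid_mem_face (e : ι × Fin 3) : F.edgePoint e (1 / 2) ∈ F.face e.1 :=
  edgePoint_mem_face e (Ioo_subset_Icc_self half_mem)

theorem mid_notMem_range (e : ι × Fin 3) : F.edgePoint e (1 / 2) ∉ range (F.corner e.1) :=
  edgePoint_notMem_range e half_mem

theorem mid_mem_ball (e : ι × Fin 3) : F.edgePoint e (1 / 2) ∈
    ball (F.center e.1) (coneRadius (F.disk e.1 (F.center e.1))) :=
  mem_ball (mid_mem_face e) (mid_notMem_range e)

theorem exists_eq_edgePoint {e : ι × Fin 3} {x : Plane} (hx : x ∈ F.face e.1)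
    (h : F.coord e x = 0) : ∃ t ∈ Icc (0 : ℝ) 1, x = F.edgePoint e t := by
  have h1 : x = F.edgePoint e _ := eq_lineMap_of_coord_eq_zero (F.affineIndependent e.1) h
  rw [mem_face_iff] at hx
  have h2 := hx (e.2 + 1)
  rw [h1, (F.coord_edgePoint e _).2.1] at h2
  exact ⟨_, ⟨hx (e.2 + 2), sub_nonneg.1 h2⟩, h1⟩

/-- The midpoint of an edge is on no other edge, so it identifies the edge. -/
theorem eq_of_coord_mid_eq_zero {e : ι × Fin 3} {k : Fin 3}
    (h : F.coord (e.1, k) (F.edgePoint e (1 / 2)) = 0) : k = e.2 := by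
  obtain ⟨-, h2, h3⟩ := F.coord_edgePoint e (1 / 2)
  rcases fin_three_eq_or e.2 k with rfl | rfl | rfl
  · rfl
  · rw [h] at h2; norm_num at h2
  · rw [h] at h3; norm_num at h3

/-! ### Adjacency of edges -/

variable (F) in
/-- The isometry `h` maps the edge `e` to the edge `e'` compatibly with the maps to `C`, and the two
triangles lie on different sides. -/
structure Adjacent (e e' : ι × Fin 3) (h : Plane ≃ᵃⁱ[ℝ] Plane) : Prop where
  edgeMatch : EdgeMatch (F.affineIndependent e.1) (F.affineIndependent e'.1) h e.2 e'.2
  eventuallyEq : F.disk e.1 =ᶠ[𝓝 (F.edgePoint e (1 / 2))] F.disk e'.1 ∘ h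

theorem edgeMatch_edgePoint {e e' : ι × Fin 3} {h : Plane ≃ᵃⁱ[ℝ] Plane}
    (H : EdgeMatch (F.affineIndependent e.1) (F.affineIndependent e'.1) h e.2 e'.2) :
    (∀ t, h (F.edgePoint e t) = F.edgePoint e' t) ∨
      ∀ t, h (F.edgePoint e t) = F.edgePoint e' (1 - t) := by
  have hmap : ∀ t, h (F.edgePoint e t) = AffineMap.lineMap (h (F.corner e.1 (e.2 + 1)))
      (h (F.corner e.1 (e.2 + 2))) t := fun t =>
    (h.toAffineEquiv : Plane →ᵃ[ℝ] Plane).apply_lineMap _ _ t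
  rcases H.1 with ⟨h1, h2⟩ | ⟨h1, h2⟩
  · exact Or.inl fun t => by rw [hmap, h1, h2]; rfl
  · exact Or.inr fun t => by rw [hmap, h1, h2, edgePoint, AffineMap.lineMap_apply_one_sub]

theorem edgeMatch_mid {e e' : ι × Fin 3} {h : Plane ≃ᵃⁱ[ℝ] Plane}
    (H : EdgeMatch (F.affineIndependent e.1) (F.affineIndependent e'.1) h e.2 e'.2) :
    h (F.edgePoint e (1 / 2)) = F.edgePoint e' (1 / 2) := by
  rcases edgeMatch_edgePoint H with h1 | h1
  · exact h1 _
  · rw [h1]; norm_num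

theorem mem_ball_comp_iff {e' : ι} {h : Plane ≃ᵃⁱ[ℝ] Plane} {z : Plane} :
    z ∈ ball (h.symm (F.center e'))
      (coneRadius ((F.disk e' ∘ h) (h.symm (F.center e')))) ↔
    h z ∈ ball (F.center e') (coneRadius (F.disk e' (F.center e'))) := by
  rw [Function.comp, Metric.mem_ball, Metric.mem_ball, ← h.dist_map, h.apply_symm_apply]

theorem mem_closedBall_comp_iff {e' : ι} {h : Plane ≃ᵃⁱ[ℝ] Plane} {z : Plane} :
    z ∈ closedBall (h.symm (F.center e'))
      (coneRadius ((F.disk e' ∘ h) (h.symm (F.center e')))) ↔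
    h z ∈ closedBall (F.center e') (coneRadius (F.disk e' (F.center e'))) := by
  rw [Function.comp, Metric.mem_closedBall, Metric.mem_closedBall, ← h.dist_map,
    h.apply_symm_apply]

theorem disk_eq_of_eventuallyEq (hC : IsPositiveEuclideanConeMetric C) {i j : ι}
    {h : Plane ≃ᵃⁱ[ℝ] Plane} {x : Plane}
    (hx : x ∈ ball (F.center i) (coneRadius (F.disk i (F.center i))))
    (hhx : h x ∈ ball (F.center j) (coneRadius (F.disk j (F.center j))))
    (heq : F.disk i =ᶠ[𝓝 x] F.disk j ∘ h) {z : Plane}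
    (hz : z ∈ closedBall (F.center i) (coneRadius (F.disk i (F.center i))))
    (hhz : h z ∈ closedBall (F.center j) (coneRadius (F.disk j (F.center j)))) :
    F.disk i z = F.disk j (h z) :=
  (F.isDelaunayDisk i).eqOn_closedBall hC ((F.isDelaunayDisk j).comp h) hx
    (mem_ball_comp_iff.2 hhx) heq ⟨hz, mem_closedBall_comp_iff.2 hhz⟩

theorem eventuallyEq_of_eventuallyEq (hC : IsPositiveEuclideanConeMetric C) {i j : ι}
    {h : Plane ≃ᵃⁱ[ℝ] Plane} {x : Plane}
    (hx : x ∈ ball (F.center i) (coneRadius (F.disk i (F.center i))))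
    (hhx : h x ∈ ball (F.center j) (coneRadius (F.disk j (F.center j))))
    (heq : F.disk i =ᶠ[𝓝 x] F.disk j ∘ h) {z : Plane}
    (hz : z ∈ ball (F.center i) (coneRadius (F.disk i (F.center i))))
    (hhz : h z ∈ ball (F.center j) (coneRadius (F.disk j (F.center j)))) :
    F.disk i =ᶠ[𝓝 z] F.disk j ∘ h :=
  ((F.isDelaunayDisk i).eqOn hC ((F.isDelaunayDisk j).comp h) hx
    (mem_ball_comp_iff.2 hhx) heq).eventuallyEq_of_mem
    ((isOpen_ball.inter isOpen_ball).mem_nhds ⟨hz, mem_ball_comp_iff.2 hhz⟩)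

/-- Points of the triangles with the same image are the same, or lie on adjacent edges. -/
theorem eq_or_adjacent (hC : IsPositiveEuclideanConeMetric C) {i j : ι} {x y : Plane}
    (hx : x ∈ F.face i) (hxn : x ∉ range (F.corner i)) (hy : y ∈ F.face j)
    (hxy : F.disk i x = F.disk j y) :
    ∃ h : Plane ≃ᵃⁱ[ℝ] Plane, h x = y ∧ F.disk i =ᶠ[𝓝 x] F.disk j ∘ h ∧
      (i = j ∧ h = AffineIsometryEquiv.refl ℝ Plane ∨
        ∃ k l, F.Adjacent (i, k) (j, l) h ∧ F.coord (i, k) x = 0) := by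
  have hxb := mem_ball hx hxn
  have hyb := mem_ball hy ((F.isDelaunayDisk i).notMem_range (F.corner_mem j) hxb hxy)
  obtain ⟨h, rfl, heq⟩ := (F.isDelaunayDisk i).isFlatOn.exists_overlay hC
    (F.isDelaunayDisk j).isFlatOn hxb hyb hxy
  refine ⟨h, rfl, heq, ?_⟩
  rcases F.overlay i j h x hx hxn hy heq with h1 | ⟨k, l, h1, h2⟩
  · exact Or.inl h1
  · refine Or.inr ⟨k, l, ⟨h1, ?_⟩, h2⟩
    have h3 : h (F.edgePoint (i, k) (1 / 2)) = F.edgePoint (j, l) (1 / 2) :=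
      edgeMatch_mid (e := (i, k)) (e' := (j, l)) h1
    exact eventuallyEq_of_eventuallyEq hC hxb hyb heq (mid_mem_ball (i, k))
      (h3 ▸ mid_mem_ball (j, l))

theorem Adjacent.mid {e e' : ι × Fin 3} {h : Plane ≃ᵃⁱ[ℝ] Plane} (H : F.Adjacent e e' h) :
    h (F.edgePoint e (1 / 2)) = F.edgePoint e' (1 / 2) := edgeMatch_mid H.edgeMatch

theorem Adjacent.disk_mid {e e' : ι × Fin 3} {h : Plane ≃ᵃⁱ[ℝ] Plane} (H : F.Adjacent e e' h) :
    F.disk e.1 (F.edgePoint e (1 / 2)) = F.disk e'.1 (F.edgePoint e' (1 / 2)) := by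
  rw [← H.mid]
  exact H.eventuallyEq.eq_of_nhds

theorem Adjacent.exists_coord {e e' : ι × Fin 3} {h : Plane ≃ᵃⁱ[ℝ] Plane}
    (H : F.Adjacent e e' h) :
    ∃ κ : ℝ, 0 < κ ∧ ∀ z, F.coord e' (h z) = -κ * F.coord e z := H.edgeMatch.2

theorem coord_self (e : ι × Fin 3) : F.coord e (F.corner e.1 e.2) = 1 := by
  have := F.coord_corner e.1 e.2 e.2
  rwa [if_pos rfl] at this

/-- An edge is not folded onto itself: `h` would fix the midpoint, hence be the identity by local
injectivity of the disk, but it has to exchange the two sides of the edge. -/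
theorem Adjacent.ne {e e' : ι × Fin 3} {h : Plane ≃ᵃⁱ[ℝ] Plane} (H : F.Adjacent e e' h) :
    e' ≠ e := by
  rintro rfl
  obtain ⟨κ, hκ, h1⟩ := H.exists_coord
  have h2 : AffineIsometryEquiv.refl ℝ Plane = h :=
    (F.isDelaunayDisk e'.1).eq_of_comp_eventuallyEq (y := F.edgePoint e' (1 / 2))
      (by rw [H.mid]; rfl) (mid_mem_ball e') H.eventuallyEq
  have h3 := h1 (F.corner e'.1 e'.2)
  rw [← h2, AffineIsometryEquiv.coe_refl, id, coord_self] at h3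
  linarith

/-- Near the midpoint `h'` is `h` followed by `h''`. Two changes of side amount to none, whereas
`h'` has to change the side. -/
theorem Adjacent.not_cyclic {e e' e'' : ι × Fin 3} {h h' h'' : Plane ≃ᵃⁱ[ℝ] Plane}
    (H : F.Adjacent e e' h) (H' : F.Adjacent e e'' h') (H'' : F.Adjacent e' e'' h'') : False := by
  obtain ⟨κ, hκ, h1⟩ := H.exists_coord
  obtain ⟨κ', hκ', h1'⟩ := H'.exists_coord
  obtain ⟨κ'', hκ'', h1''⟩ := H''.exists_coord
  have h2 : h' = h.trans h'' := by
    refine (F.isDelaunayDisk e''.1).eq_of_comp_eventuallyEq (y := F.edgePoint e (1 / 2))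
      (by rw [H'.mid, AffineIsometryEquiv.coe_trans, Function.comp, H.mid, H''.mid])
      (by rw [H'.mid]; exact mid_mem_ball e'') ?_
    have h3 : ∀ᶠ z in 𝓝 (F.edgePoint e (1 / 2)), F.disk e'.1 (h z) = F.disk e''.1 (h'' (h z)) :=
      h.continuous.continuousAt.eventually (by rw [H.mid]; exact H''.eventuallyEq)
    filter_upwards [H.eventuallyEq, H'.eventuallyEq, h3] with z hz hz' hz''
    rw [← hz', hz]
    exact hz''
  have h3 := h1' (F.corner e.1 e.2)
  rw [h2, AffineIsometryEquiv.coe_trans, Function.comp, h1'', h1, coord_self] at h3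
  nlinarith [mul_pos hκ hκ'']

/-- Edges are compared by the images of their midpoints: an overlay at the midpoints is either
trivial, which makes the edges equal, or an adjacency of exactly these edges. -/
theorem exists_adjacent (hC : IsPositiveEuclideanConeMetric C) {e e' : ι × Fin 3} (hne : e ≠ e')
    (h : F.disk e.1 (F.edgePoint e (1 / 2)) = F.disk e'.1 (F.edgePoint e' (1 / 2))) :
    ∃ h, F.Adjacent e e' h := by
  obtain ⟨A, hA, -, h1⟩ := eq_or_adjacent hC (mid_mem_face e) (mid_notMem_range e)
    (mid_mem_face e') h
  obtain ⟨i, k⟩ := e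
  obtain ⟨j, l⟩ := e'
  rcases h1 with ⟨h1, h2⟩ | ⟨k', l', h1, h2⟩
  · simp only at h1
    subst h1
    rw [h2, AffineIsometryEquiv.coe_refl, id] at hA
    have h3 : k = l := eq_of_coord_mid_eq_zero (e := (i, l)) (k := k)
      (by rw [← hA]; exact (F.coord_edgePoint (i, k) _).1)
    exact absurd (by rw [h3]) hne
  · simp only at h1 h2
    have h3 : k' = k := eq_of_coord_mid_eq_zero (e := (i, k)) h2
    subst h3
    have h4 := h1.mid
    rw [hA] at h4
    have h5 : l = l' := eq_of_coord_mid_eq_zero (e := (j, l')) (k := l)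
      (by rw [← h4]; exact (F.coord_edgePoint (j, l) _).1)
    subst h5
    exact ⟨A, h1⟩

/-- At most two edges share the image of their midpoints, since three would be pairwise adjacent.
This is the uniqueness of the partner of an edge. -/
theorem eq_of_disk_mid_eq (hC : IsPositiveEuclideanConeMetric C) {e e' e'' : ι × Fin 3}
    (hne' : e ≠ e') (hne'' : e ≠ e'')
    (h' : F.disk e.1 (F.edgePoint e (1 / 2)) = F.disk e'.1 (F.edgePoint e' (1 / 2)))
    (h'' : F.disk e.1 (F.edgePoint e (1 / 2)) = F.disk e''.1 (F.edgePoint e'' (1 / 2))) :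
    e' = e'' := by
  by_contra hne
  obtain ⟨A, hA⟩ := exists_adjacent hC hne' h'
  obtain ⟨B, hB⟩ := exists_adjacent hC hne'' h''
  obtain ⟨D, hD⟩ := exists_adjacent hC hne (h'.symm.trans h'')
  exact hA.not_cyclic hB hD

/-- Each edge is adjacent to some edge: the points on the other side of the edge are covered. -/
theorem exists_adjacent_edge [Finite ι] (hC : IsPositiveEuclideanConeMetric C) (e : ι × Fin 3) :
    ∃ e' h, F.Adjacent e e' h := by
  obtain ⟨i, k⟩ := e
  set m := F.edgePoint (i, k) (1 / 2) with hm
  -- The line from the opposite corner through the midpoint of the edge; for `s > 1` it has left the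
  -- triangle.
  obtain ⟨γ, hγ⟩ : ∃ γ : ℝ → Plane, γ = AffineMap.lineMap (F.corner i k) m := ⟨_, rfl⟩
  have hγc : Continuous γ := hγ ▸ AffineMap.lineMap_continuous
  have hγ1 : γ 1 = m := by rw [hγ, AffineMap.lineMap_apply_one]
  have hγcoord : ∀ s, F.coord (i, k) (γ s) = 1 - s := fun s => by
    have h1 := F.coord_self (i, k)
    have h2 := (F.coord_edgePoint (i, k) (1 / 2)).1
    simp only at h1
    rw [hγ, AffineMap.apply_lineMap, h1, hm, h2, AffineMap.lineMap_apply_ring']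
    ring
  have hmb := F.mid_mem_ball (i, k)
  have hmf := F.mid_mem_face (i, k)
  have hmn := F.mid_notMem_range (i, k)
  rw [← hm] at hmb hmf hmn
  simp only at hmb hmf hmn
  -- Points just beyond the edge are covered by finitely many triangles. Along an ultrafilter one
  -- triangle serves throughout, and the preimages in it converge by compactness.
  let U : Ultrafilter ℝ := Ultrafilter.of (𝓝[>] 1)
  have hU : (U : Filter ℝ) ≤ 𝓝[>] 1 := Ultrafilter.of_le _
  have hU1 : (U : Filter ℝ) ≤ 𝓝 1 := hU.trans nhdsWithin_le_nhds
  have hγt : Tendsto γ U (𝓝 m) := hγ1 ▸ (hγc.tendsto 1).mono_left hU1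
  have hball : ∀ᶠ s in (U : Filter ℝ),
      γ s ∈ ball (F.center i) (coneRadius (F.disk i (F.center i))) :=
    hγt.eventually_mem (isOpen_ball.mem_nhds hmb)
  have hex : ∀ᶠ s in (U : Filter ℝ), ∃ j, ∃ w ∈ F.face j, F.disk j w = F.disk i (γ s) :=
    hball.mono fun s hs => F.covers _ ((F.isDelaunayDisk i).empty_interior _ hs)
  obtain ⟨j, hj⟩ : ∃ j, ∀ᶠ s in (U : Filter ℝ), ∃ w ∈ F.face j, F.disk j w = F.disk i (γ s) :=
    U.eventually_exists_iff.1 hex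
  obtain ⟨w, hw⟩ : ∃ w : ℝ → Plane, ∀ᶠ s in (U : Filter ℝ),
      w s ∈ F.face j ∧ F.disk j (w s) = F.disk i (γ s) := by
    have h1 : ∀ s, ∃ w, (∃ w ∈ F.face j, F.disk j w = F.disk i (γ s)) →
        w ∈ F.face j ∧ F.disk j w = F.disk i (γ s) := fun s => by
      by_cases h : ∃ w ∈ F.face j, F.disk j w = F.disk i (γ s)
      · exact ⟨h.choose, fun _ => h.choose_spec⟩
      · exact ⟨0, fun h' => absurd h' h⟩
    choose w hw using h1
    exact ⟨w, hj.mono hw⟩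
  obtain ⟨w₀, hw₀, hwt⟩ := (F.isCompact_face j).ultrafilter_le_nhds (U.map w)
    (le_principal_iff.2 (hw.mono fun s hs => hs.1))
  have hwt' : Tendsto w U (𝓝 w₀) := hwt
  have hDm : Tendsto (fun s => F.disk i (γ s)) U (𝓝 (F.disk i m)) :=
    ((F.isDelaunayDisk i).isFlatOn.continuousAt hmb).tendsto.comp hγt
  have hDw : Tendsto (fun s => F.disk j (w s)) U (𝓝 (F.disk j w₀)) :=
    (F.continuousOn_face j w₀ hw₀).tendsto.comp
      (tendsto_nhdsWithin_iff.2 ⟨hwt', hw.mono fun s hs => hs.1⟩)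
  have hlim : F.disk i m = F.disk j w₀ :=
    tendsto_nhds_unique hDm (hDw.congr' (hw.mono fun s hs => hs.2))
  obtain ⟨A, hA, heq, hor⟩ := eq_or_adjacent hC hmf hmn hw₀ hlim
  have hw₀b := mem_ball hw₀ ((F.isDelaunayDisk i).notMem_range (F.corner_mem j) hmb hlim)
  obtain ⟨-, δ, hδ, -, hi⟩ := (F.isDelaunayDisk j).isFlatOn _ hw₀b
  have hAt : Tendsto (fun s => A (γ s)) U (𝓝 w₀) := hA ▸ (A.continuous.tendsto m).comp hγt
  -- Both sides tend to `w₀`, near which `F.disk j` is injective, and have the same image.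
  have hwA : ∀ᶠ s in (U : Filter ℝ), w s = A (γ s) := by
    filter_upwards [hw, hwt'.eventually_mem (ball_mem_nhds _ hδ),
      hAt.eventually_mem (ball_mem_nhds _ hδ), hγt.eventually heq] with s h1 h2 h3 h4
    exact hi.injOn h2 h3 (h1.2.trans h4)
  -- In the trivial case `γ s` itself would lie in the triangle, although its coordinate `1 - s` is
  -- negative.
  rcases hor with ⟨rfl, rfl⟩ | ⟨k', l, hadj, h0⟩
  · exfalso
    obtain ⟨s, h1, h2, h3⟩ := (hwA.and (hw.and (hU self_mem_nhdsWithin))).exists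
    have h4 := mem_face_iff.1 h2.1 k
    rw [h1, AffineIsometryEquiv.coe_refl, id, hγcoord] at h4
    have h5 : (1 : ℝ) < s := h3
    linarith
  · have h3 : k' = k := eq_of_coord_mid_eq_zero (e := (i, k)) h0
    subst h3
    exact ⟨_, A, hadj⟩

/-- The parametrizations of adjacent edges agree, or agree up to reversal. -/
theorem Adjacent.edgePoint_eq (hC : IsPositiveEuclideanConeMetric C) {e e' : ι × Fin 3}
    {h : Plane ≃ᵃⁱ[ℝ] Plane} (H : F.Adjacent e e' h) :
    (∀ t, h (F.edgePoint e t) = F.edgePoint e' t) ∧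
      (∀ t ∈ Icc (0 : ℝ) 1, F.disk e.1 (F.edgePoint e t) = F.disk e'.1 (F.edgePoint e' t)) ∨
    (∀ t, h (F.edgePoint e t) = F.edgePoint e' (1 - t)) ∧
      (∀ t ∈ Icc (0 : ℝ) 1, F.disk e.1 (F.edgePoint e t) = F.disk e'.1 (F.edgePoint e' (1 - t))) ∧
      ¬ ∀ t ∈ Icc (0 : ℝ) 1,
        F.disk e.1 (F.edgePoint e t) = F.disk e'.1 (F.edgePoint e' t) := by
  have hD : ∀ t ∈ Icc (0 : ℝ) 1, h (F.edgePoint e t) ∈ F.face e'.1 →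
      F.disk e.1 (F.edgePoint e t) = F.disk e'.1 (h (F.edgePoint e t)) := fun t ht h1 =>
    disk_eq_of_eventuallyEq hC (mid_mem_ball e) (by rw [H.mid]; exact mid_mem_ball e')
      H.eventuallyEq (F.face_subset _ (edgePoint_mem_face e ht)) (F.face_subset _ h1)
  rcases edgeMatch_edgePoint H.edgeMatch with h1 | h1
  · refine Or.inl ⟨h1, fun t ht => ?_⟩
    have := hD t ht
    rw [h1] at this
    exact this (edgePoint_mem_face e' ht)
  · have h2 : ∀ t ∈ Icc (0 : ℝ) 1,
        F.disk e.1 (F.edgePoint e t) = F.disk e'.1 (F.edgePoint e' (1 - t)) := fun t ht => by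
      have := hD t ht
      rw [h1] at this
      exact this (edgePoint_mem_face e' ⟨by linarith [ht.2], by linarith [ht.1]⟩)
    -- Both parametrizations cannot fit: by injectivity near the midpoint this would give `t = 1 -
    -- t` for some `t > 1 / 2`. Hence the flip can be read off from the maps to `C`.
    refine Or.inr ⟨h1, h2, fun h3 => ?_⟩
    obtain ⟨-, δ, hδ, -, hi⟩ := (F.isDelaunayDisk e'.1).isFlatOn _ (mid_mem_ball e')
    have hc1 : ∀ᶠ t in 𝓝 (1 / 2 : ℝ), F.edgePoint e' t ∈ ball (F.edgePoint e' (1 / 2)) δ :=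
      (continuous_edgePoint e').continuousAt.eventually_mem (ball_mem_nhds _ hδ)
    have hc2 : ∀ᶠ t in 𝓝 (1 / 2 : ℝ), F.edgePoint e' (1 - t) ∈ ball (F.edgePoint e' (1 / 2)) δ := by
      have hc : Continuous fun t : ℝ => F.edgePoint e' (1 - t) :=
        (continuous_edgePoint e').comp (continuous_const.sub continuous_id)
      refine hc.continuousAt.eventually_mem ?_
      norm_num
      exact ball_mem_nhds _ hδ
    obtain ⟨t, ⟨⟨h4, h5⟩, h6⟩, h7⟩ := (((hc1.and hc2).and (Icc_mem_nhds half_mem.1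
      half_mem.2)).filter_mono (nhdsWithin_le_nhds (s := Ioi (1 / 2 : ℝ))) |>.and
      self_mem_nhdsWithin).exists
    have h8 := edgePoint_injective e' (hi.injOn h4 h5 ((h3 t h6).symm.trans (h2 t h6)))
    have h9 : (1 / 2 : ℝ) < t := h7
    linarith

end DelaunayFamily

namespace DelaunayFamily

/-! ### The pairing of the edges -/

section Mate

variable {ι : Type*} [Finite ι] {F : DelaunayFamily C ι}

variable (F) in
/-- The edge adjacent to an edge. -/
noncomputable def mate (hC : IsPositiveEuclideanConeMetric C) (e : ι × Fin 3) : ι × Fin 3 :=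
  (F.exists_adjacent_edge hC e).choose

theorem exists_adjacent_mate (hC : IsPositiveEuclideanConeMetric C) (e : ι × Fin 3) :
    ∃ h, F.Adjacent e (F.mate hC e) h := (F.exists_adjacent_edge hC e).choose_spec

theorem mate_ne (hC : IsPositiveEuclideanConeMetric C) (e : ι × Fin 3) : F.mate hC e ≠ e := by
  obtain ⟨h, H⟩ := F.exists_adjacent_mate hC e
  exact H.ne

theorem Adjacent.eq_mate (hC : IsPositiveEuclideanConeMetric C) {e e' : ι × Fin 3}
    {h : Plane ≃ᵃⁱ[ℝ] Plane} (H : F.Adjacent e e' h) : e' = F.mate hC e := by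
  obtain ⟨h', H'⟩ := F.exists_adjacent_mate hC e
  exact eq_of_disk_mid_eq hC H.ne.symm H'.ne.symm H.disk_mid H'.disk_mid

theorem mate_mate (hC : IsPositiveEuclideanConeMetric C) (e : ι × Fin 3) :
    F.mate hC (F.mate hC e) = e := by
  obtain ⟨h, H⟩ := F.exists_adjacent_mate hC e
  obtain ⟨h', H'⟩ := F.exists_adjacent_mate hC (F.mate hC e)
  exact eq_of_disk_mid_eq hC H'.ne.symm H.ne H'.disk_mid H.disk_mid.symm

theorem mate_length (hC : IsPositiveEuclideanConeMetric C) (e : ι × Fin 3) :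
    dist (F.corner (F.mate hC e).1 ((F.mate hC e).2 + 1))
        (F.corner (F.mate hC e).1 ((F.mate hC e).2 + 2)) =
      dist (F.corner e.1 (e.2 + 1)) (F.corner e.1 (e.2 + 2)) := by
  obtain ⟨h, H⟩ := F.exists_adjacent_mate hC e
  rcases H.edgeMatch.1 with ⟨h1, h2⟩ | ⟨h1, h2⟩
  · rw [← h1, ← h2, h.dist_map]
  · rw [← h1, ← h2, h.dist_map, dist_comm]

open Classical in
variable (F) in
/-- The triangles with the pairing of adjacent edges; the parameter of an edge is reversed if the
parametrizations of the edge and its mate do not agree. -/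
noncomputable def pairing {n : ℕ} (F : DelaunayFamily C (Fin n))
    (hC : IsPositiveEuclideanConeMetric C) : TrianglePairing where
  numFaces := n
  corner := F.corner
  nondegenerate := F.affineIndependent
  mate := F.mate hC
  mate_mate := mate_mate hC
  mate_ne := mate_ne hC
  flip e := decide (¬ ∀ t ∈ Icc (0 : ℝ) 1, F.disk e.1 (F.edgePoint e t) =
    F.disk (F.mate hC e).1 (F.edgePoint (F.mate hC e) t))
  flip_mate e := by
    rw [mate_mate, decide_eq_decide]
    exact not_congr (forall₂_congr fun t _ => eq_comm)
  mate_length := mate_length hC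

end Mate

variable {n : ℕ} {F : DelaunayFamily C (Fin n)}

theorem Adjacent.disk_eq_and_glued (hC : IsPositiveEuclideanConeMetric C) {e e' : Fin n × Fin 3}
    {h : Plane ≃ᵃⁱ[ℝ] Plane} (H : F.Adjacent e e' h) {t : ℝ} (ht : t ∈ Icc (0 : ℝ) 1) :
    (F.pairing hC).Glued (e.1, F.edgePoint e t) (e'.1, h (F.edgePoint e t)) ∧
    F.disk e.1 (F.edgePoint e t) = F.disk e'.1 (F.edgePoint e'
      (if (F.pairing hC).flip e then 1 - t else t)) := by
  obtain rfl := H.eq_mate hC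
  rcases H.edgePoint_eq hC with ⟨h1, h2⟩ | ⟨h1, h2, h3⟩
  · have hf : (F.pairing hC).flip e = false := by
      simp only [pairing, decide_eq_false_iff_not, not_not]
      exact h2
    refine ⟨⟨e, t, ht, rfl, ?_⟩, ?_⟩
    · rw [h1, hf]; rfl
    · rw [hf]; exact h2 t ht
  · have hf : (F.pairing hC).flip e = true := by
      simp only [pairing, decide_eq_true_eq]
      exact h3
    refine ⟨⟨e, t, ht, rfl, ?_⟩, ?_⟩
    · rw [h1, hf]; rfl
    · rw [hf]; exact h2 t ht

theorem disk_eq_of_glued (hC : IsPositiveEuclideanConeMetric C) {p q : Fin n × Plane}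
    (hpq : (F.pairing hC).Glued p q) : F.disk p.1 p.2 = F.disk q.1 q.2 := by
  obtain ⟨e, t, ht, rfl, rfl⟩ := hpq
  obtain ⟨h, H⟩ := F.exists_adjacent_mate hC e
  exact (H.disk_eq_and_glued hC ht).2

theorem Adjacent.glued (hC : IsPositiveEuclideanConeMetric C) {e e' : Fin n × Fin 3}
    {h : Plane ≃ᵃⁱ[ℝ] Plane} (H : F.Adjacent e e' h) {x : Plane} (hx : x ∈ F.face e.1)
    (hx0 : F.coord e x = 0) : (F.pairing hC).Glued (e.1, x) (e'.1, h x) := by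
  obtain ⟨t, ht, rfl⟩ := exists_eq_edgePoint hx hx0
  exact (H.disk_eq_and_glued hC ht).1

/-- Away from the corners one elementary gluing, or none, is enough. -/
theorem eqvGen_of_notMem_range (hC : IsPositiveEuclideanConeMetric C) {i j : Fin n} {x y : Plane}
    (hx : x ∈ F.face i) (hxn : x ∉ range (F.corner i)) (hy : y ∈ F.face j)
    (hxy : F.disk i x = F.disk j y) : Relation.EqvGen (F.pairing hC).Glued (i, x) (j, y) := by
  obtain ⟨h, rfl, -, ⟨rfl, rfl⟩ | ⟨k, l, H, h0⟩⟩ := eq_or_adjacent hC hx hxn hy hxy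
  · exact Relation.EqvGen.refl _
  · exact Relation.EqvGen.rel _ _ (H.glued hC hx h0)

theorem dist_disk_corner {ε : ℝ} (hε : ∀ v ∈ conePoints C, IsConeRadius v ε) {i : Fin n}
    {k : Fin 3} {z : Plane}
    (hz : z ∈ closedBall (F.center i) (coneRadius (F.disk i (F.center i))))
    (hzk : dist z (F.corner i k) ≤ ε) :
    dist (F.disk i z) (F.disk i (F.corner i k)) = dist z (F.corner i k) :=
  (F.isDelaunayDisk i).dist_eq_of_mem_markedPoints (F.corner_mem i k)
    (hε _ (F.corner_mem i k).2) hz hzk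

/-- Triangles that share a point close to a cone point have glued corners there. -/
theorem eqvGen_corner_of_near (hC : IsPositiveEuclideanConeMetric C) {ε : ℝ}
    (hε : ∀ v ∈ conePoints C, IsConeRadius v ε) {i j : Fin n} {k l : Fin 3} {x y : Plane}
    (hx : x ∈ F.face i) (hxn : x ∉ range (F.corner i)) (hy : y ∈ F.face j)
    (hxy : F.disk i x = F.disk j y) (hv : F.disk i (F.corner i k) = F.disk j (F.corner j l))
    (hxk : dist x (F.corner i k) < ε / 2) (hyl : dist y (F.corner j l) < ε / 2) :
    Relation.EqvGen (F.pairing hC).Glued (i, F.corner i k) (j, F.corner j l) := by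
  have hε0 : 0 < ε := (hε _ (F.corner_mem i k).2).pos
  obtain ⟨h, rfl, heq, ⟨rfl, rfl⟩ | ⟨m, m', H, h0⟩⟩ := eq_or_adjacent hC hx hxn hy hxy
  · have hkl : F.corner i k = F.corner i l := by
      -- Different corners of one triangle are marked points of one disk, hence at least `ε` apart.
      by_contra hne
      have h1 := (F.isDelaunayDisk i).le_dist_of_mem_markedPoints hε (F.corner_mem i k)
        (F.corner_mem i l) hne
      have h2 := dist_triangle_left (F.corner i k) (F.corner i l) x
      rw [AffineIsometryEquiv.coe_refl, id] at hyl
      linarith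
    rw [hkl]
    exact Relation.EqvGen.refl _
  · have hxb := mem_ball hx hxn
    have hyb := mem_ball hy ((F.isDelaunayDisk i).notMem_range (F.corner_mem j) hxb hxy)
    -- Near `x` the distances to both points are the distance in `C` to the common cone point.
    have hcor : F.corner i k = h.symm (F.corner j l) := by
      refine eq_of_eventually_dist_eq (y := x) ?_
      have h1 : ∀ᶠ z in 𝓝 x, dist z (F.corner i k) < ε / 2 :=
        (continuous_id.dist continuous_const).continuousAt.eventually_lt continuousAt_const hxk
      have h2 : ∀ᶠ z in 𝓝 x, dist (h z) (F.corner j l) < ε / 2 :=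
        (h.continuous.dist continuous_const).continuousAt.eventually_lt continuousAt_const hyl
      have h3 : ∀ᶠ z in 𝓝 x, h z ∈ ball (F.center j) (coneRadius (F.disk j (F.center j))) :=
        h.continuous.continuousAt.eventually_mem (isOpen_ball.mem_nhds hyb)
      filter_upwards [heq, h1, h2, h3, isOpen_ball.mem_nhds hxb] with z hz hz1 hz2 hz3 hz4
      rw [← h.dist_map z (h.symm _), h.apply_symm_apply,
        ← dist_disk_corner hε (ball_subset_closedBall hz4) (by linarith),
        ← dist_disk_corner hε (ball_subset_closedBall hz3) (by linarith), hv, hz]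
      rfl
    have hh : h (F.corner i k) = F.corner j l := by rw [hcor, h.apply_symm_apply]
    obtain ⟨κ, hκ, h1⟩ := H.exists_coord
    have h2 := h1 (F.corner i k)
    rw [hh, coord_corner, coord_corner] at h2
    -- Coordinates of corners are 0 or 1, and the two coordinates at this corner have opposite
    -- signs, so both vanish: the corner is on the shared edge.
    have h3 : F.coord (i, m) (F.corner i k) = 0 := by
      rw [coord_corner]
      split_ifs at h2 ⊢
      · linarith
      · linarith
      · rfl
      · rfl
    have := H.glued hC (F.corner_mem_face i k) h3
    rw [hh] at this
    exact Relation.EqvGen.rel _ _ this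

theorem exists_near_corner (i : Fin n) (k : Fin 3) {ρ : ℝ} (hρ : 0 < ρ) :
    ∃ z ∈ F.face i, 0 < dist z (F.corner i k) ∧ dist z (F.corner i k) < ρ := by
  have hne := (F.affineIndependent i).injective.ne (fin_three_add_one_ne k)
  have hd : 0 < dist (F.corner i k) (F.corner i (k + 1)) := dist_pos.2 hne.symm
  have hs : 0 < min 1 (ρ / (2 * dist (F.corner i k) (F.corner i (k + 1)))) := by positivity
  refine ⟨AffineMap.lineMap (F.corner i k) (F.corner i (k + 1))
    (min 1 (ρ / (2 * dist (F.corner i k) (F.corner i (k + 1))))), ?_, ?_⟩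
  · exact (convex_convexHull ℝ _).lineMap_mem (F.corner_mem_face i k)
      (F.corner_mem_face i (k + 1)) ⟨hs.le, min_le_left _ _⟩
  · rw [dist_lineMap_left, Real.norm_of_nonneg hs.le]
    refine ⟨by positivity, ?_⟩
    calc _ ≤ ρ / (2 * dist (F.corner i k) (F.corner i (k + 1))) *
        dist (F.corner i k) (F.corner i (k + 1)) := by gcongr; exact min_le_right _ _
      _ = ρ / 2 := by field_simp
      _ < ρ := half_lt_self hρ

/-- A point of a triangle that is mapped close to a cone point is close to a corner mapped to this
cone point. -/
theorem exists_radius (v : C) {ε : ℝ} (hε : 0 < ε) : ∃ ρ > 0, ∀ i, ∀ z ∈ F.face i,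
    F.disk i z ∈ ball v ρ → v ∈ conePoints C →
      ∃ k, F.disk i (F.corner i k) = v ∧ dist z (F.corner i k) < ε := by
  -- The part of each triangle away from its corners over `v`; its image is compact and misses `v`,
  -- hence misses a ball about `v`.
  obtain ⟨K, hK⟩ : ∃ K : Fin n → Set Plane, ∀ i, K i = F.face i ∩
      ⋂ k ∈ {k | F.disk i (F.corner i k) = v}, {z | ε ≤ dist z (F.corner i k)} :=
    ⟨_, fun _ => rfl⟩
  have hcl : IsClosed (⋃ i, F.disk i '' K i) := by
    refine isClosed_iUnion_of_finite fun i => ?_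
    have hKc : IsCompact (K i) := by
      rw [hK]
      exact (F.isCompact_face i).inter_right (isClosed_biInter fun k _ =>
        isClosed_le continuous_const (continuous_id.dist continuous_const))
    exact (hKc.image_of_continuousOn ((F.continuousOn_face i).mono
      (by rw [hK]; exact inter_subset_left))).isClosed
  by_cases hvV : v ∈ conePoints C
  swap
  · exact ⟨1, one_pos, fun _ _ _ _ h => absurd h hvV⟩
  have hv : v ∉ ⋃ i, F.disk i '' K i := by
    simp only [mem_iUnion, mem_image, not_exists, not_and]
    intro i z hz hzv
    rw [hK] at hz
    obtain ⟨k, rfl⟩ := (mem_conePoints_iff hz.1).1 (hzv ▸ hvV)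
    have h1 := mem_iInter₂.1 hz.2 k hzv
    simp only [mem_ofPred_eq, dist_self] at h1
    linarith
  obtain ⟨ρ, hρ, hsub⟩ := Metric.isOpen_iff.1 hcl.isOpen_compl v hv
  refine ⟨ρ, hρ, fun i z hz hzv _ => ?_⟩
  by_contra! hfar
  refine hsub hzv (mem_iUnion.2 ⟨i, z, ?_, rfl⟩)
  rw [hK]
  exact ⟨hz, mem_iInter₂.2 fun k hk => hfar k hk⟩

/-- Corners with the same image are identified by the gluing: the link of a cone point is
connected. -/
theorem eqvGen_corner [CompactSpace C] (hC : IsPositiveEuclideanConeMetric C) {i j : Fin n}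
    {k l : Fin 3} (hv : F.disk i (F.corner i k) = F.disk j (F.corner j l)) :
    Relation.EqvGen (F.pairing hC).Glued (i, F.corner i k) (j, F.corner j l) := by
  obtain ⟨ε, hε0, hε⟩ := exists_isConeRadius hC
  obtain ⟨v, hvi⟩ : ∃ v, v = F.disk i (F.corner i k) := ⟨_, rfl⟩
  have hvV : v ∈ conePoints C := hvi ▸ (F.corner_mem i k).2
  obtain ⟨ρ₀, hρ₀, hnear⟩ := F.exists_radius v (half_pos hε0)
  obtain ⟨ρ, hρ, hρρ, hρε⟩ : ∃ ρ > 0, ρ ≤ ρ₀ ∧ ρ ≤ ε / 2 :=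
    ⟨min ρ₀ (ε / 2), lt_min hρ₀ (half_pos hε0), min_le_left _ _, min_le_right _ _⟩
  have hdist : ∀ (a : Fin n) b, ∀ z ∈ F.face a, F.disk a (F.corner a b) = v →
      dist z (F.corner a b) ≤ ε / 2 → dist (F.disk a z) v = dist z (F.corner a b) :=
    fun a b z hz hab hzb => by
      rw [← hab]
      exact dist_disk_corner hε (F.face_subset a hz) (by linarith)
  -- The images of the parts of the triangles near those corners in `K` that lie over `v`.
  obtain ⟨A, hA⟩ : ∃ A : Set (Fin n × Fin 3) → Set C, ∀ K, A K =
      ⋃ e ∈ K ∩ {e | F.disk e.1 (F.corner e.1 e.2) = v},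
        F.disk e.1 '' (F.face e.1 ∩ closedBall (F.corner e.1 e.2) (ε / 2)) := ⟨_, fun _ => rfl⟩
  have hAcl : ∀ K, IsClosed (A K) := fun K => by
    rw [hA]
    refine (toFinite _).isClosed_biUnion fun e _ => ?_
    exact (((F.isCompact_face e.1).inter_right isClosed_closedBall).image_of_continuousOn
      ((F.continuousOn_face e.1).mono inter_subset_left)).isClosed
  have hAmem : ∀ K q, q ∈ A K ↔ ∃ e ∈ K, F.disk e.1 (F.corner e.1 e.2) = v ∧
      ∃ z ∈ F.face e.1, dist z (F.corner e.1 e.2) ≤ ε / 2 ∧ F.disk e.1 z = q := fun K q => by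
    rw [hA]
    simp only [mem_iUnion, mem_image, mem_inter_iff, Metric.mem_closedBall, exists_prop,
      mem_ofPred_eq, and_assoc]
  have hAne : ∀ K, ∀ e ∈ K, F.disk e.1 (F.corner e.1 e.2) = v →
      ((ball v ρ \ {v}) ∩ A K).Nonempty := fun K e heK hev => by
    obtain ⟨z, hz, h1, h2⟩ := F.exists_near_corner e.1 e.2 hρ
    have h3 := hdist e.1 e.2 z hz hev (h2.le.trans hρε)
    refine ⟨F.disk e.1 z, ⟨?_, ?_⟩, (hAmem _ _).2 ⟨e, heK, hev, z, hz, h2.le.trans hρε, rfl⟩⟩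
    · rw [Metric.mem_ball, h3]; exact h2
    · intro h
      rw [mem_singleton_iff] at h
      rw [h, dist_self] at h3
      exact h1.ne h3
  have hnotV : ∀ q ∈ ball v ρ \ {v}, q ∉ conePoints C := fun q hq hqV =>
    hq.2 ((hε v hvV).eq_of_mem_conePoints (ball_subset_ball (by linarith) hq.1) hqV)
  have hcov : ∀ K, ball v ρ \ {v} ⊆ A K ∪ A Kᶜ := fun K q hq => by
    obtain ⟨a, z, hz, rfl⟩ := F.covers q (hnotV q hq)
    obtain ⟨b, hb, hzb⟩ := hnear a z hz (ball_subset_ball hρρ hq.1) hvV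
    by_cases hK : (a, b) ∈ K
    · exact Or.inl ((hAmem _ _).2 ⟨(a, b), hK, hb, z, hz, hzb.le, rfl⟩)
    · exact Or.inr ((hAmem _ _).2 ⟨(a, b), hK, hb, z, hz, hzb.le, rfl⟩)
  by_contra hcon
  -- For `K` the gluing class of the first corner, `A K` and `A Kᶜ` are closed, cover the connected
  -- punctured ball and both meet it if the second corner is not in the class. At a common point two
  -- triangles meet near `v`, so their corners there are glued, a contradiction.
  obtain ⟨K, hK⟩ : ∃ K : Set (Fin n × Fin 3), ∀ e, e ∈ K ↔
      Relation.EqvGen (F.pairing hC).Glued (i, F.corner i k) (e.1, F.corner e.1 e.2) :=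
    ⟨{e | _}, fun _ => Iff.rfl⟩
  obtain ⟨q, hq, hq1, hq2⟩ := isPreconnected_closed_iff.1
    ((hε v hvV).isPreconnected ρ (by linarith)) _ _ (hAcl K) (hAcl Kᶜ) (hcov K)
    (hAne K (i, k) ((hK _).2 (Relation.EqvGen.refl _)) hvi.symm)
    (hAne Kᶜ (j, l) (fun h => hcon ((hK _).1 h)) (hv ▸ hvi.symm))
  obtain ⟨e, heK, hev, z, hz, hze, rfl⟩ := (hAmem _ _).1 hq1
  obtain ⟨e', heK', hev', z', hz', hze', hzz'⟩ := (hAmem _ _).1 hq2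
  have h1 := hdist e.1 e.2 z hz hev hze
  have h2 := hdist e'.1 e'.2 z' hz' hev' hze'
  have h3 : dist (F.disk e.1 z) v < ρ := hq.1
  rw [hzz'] at h2
  refine heK' ((hK e').2 (Relation.EqvGen.trans _ _ _ ((hK e).1 heK) ?_))
  exact eqvGen_corner_of_near hC hε hz (fun h => hnotV _ hq ((mem_conePoints_iff hz).2 h)) hz'
    hzz'.symm (hev.trans hev'.symm) (by linarith) (by linarith)

theorem disk_eq_iff [CompactSpace C] (hC : IsPositiveEuclideanConeMetric C) {i j : Fin n}
    {x y : Plane} (hx : x ∈ F.face i) (hy : y ∈ F.face j) :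
    F.disk i x = F.disk j y ↔ Relation.EqvGen (F.pairing hC).Glued (i, x) (j, y) := by
  constructor
  · intro h
    by_cases hxn : x ∈ range (F.corner i)
    · obtain ⟨l, rfl⟩ := (mem_conePoints_iff hy).1 (h ▸ (mem_conePoints_iff hx).2 hxn)
      obtain ⟨k, rfl⟩ := hxn
      exact eqvGen_corner hC h
    · exact eqvGen_of_notMem_range hC hx hxn hy h
  · have key : ∀ p q, Relation.EqvGen (F.pairing hC).Glued p q →
        F.disk p.1 p.2 = F.disk q.1 q.2 := fun p q h => by
      induction h with
      | rel p q h => exact disk_eq_of_glued hC h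
      | refl p => rfl
      | symm p q _ ih => exact ih.symm
      | trans p q r _ _ ih ih' => exact ih.trans ih'
    exact key _ _

/-- The triangles cover the complement of the cone points; their images form a closed set, and cone
points are limits of other points. -/
theorem exists_disk_eq [CompactSpace C] (hC : IsPositiveEuclideanConeMetric C) (p : C) :
    ∃ i, ∃ x ∈ F.face i, F.disk i x = p := by
  by_cases hp : p ∈ conePoints C
  swap
  · exact F.covers p hp
  obtain ⟨ε, hε0, hε⟩ := exists_isConeRadius hC
  have hcl : IsClosed (⋃ i, F.disk i '' F.face i) := isClosed_iUnion_of_finite fun i =>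
    ((F.isCompact_face i).image_of_continuousOn (F.continuousOn_face i)).isClosed
  have hmem : p ∈ ⋃ i, F.disk i '' F.face i := by
    rw [← hcl.closure_eq, Metric.mem_closure_iff]
    intro δ hδ
    obtain ⟨q, hq, hqp⟩ := (hε p hp).nonempty (min δ ε) (lt_min hδ hε0)
    have hqV : q ∉ conePoints C := fun h => hqp
      ((hε p hp).eq_of_mem_conePoints (ball_subset_ball (min_le_right _ _) hq) h)
    obtain ⟨i, x, hx, rfl⟩ := F.covers q hqV
    refine ⟨_, mem_iUnion.2 ⟨i, x, hx, rfl⟩, ?_⟩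
    rw [dist_comm]
    exact (Metric.mem_ball.1 hq).trans_le (min_le_left _ _)
  obtain ⟨i, x, hx, h⟩ := mem_iUnion.1 hmem
  exact ⟨i, x, hx, h⟩

/-! ### The triangulation and the duals of the Voronoi edges -/

variable (F) in
/-- The triangulation formed by the triangles of the family. -/
noncomputable def triangulation [CompactSpace C] (hC : IsPositiveEuclideanConeMetric C) :
    GeodesicTriangulation C where
  toTrianglePairing := F.pairing hC
  toFun := F.disk
  continuousOn := F.continuousOn_face
  isometric i x hx hxn := by
    obtain ⟨-, δ, hδ, -, hi⟩ := (F.isDelaunayDisk i).isFlatOn x (mem_ball hx hxn)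
    exact ⟨ball x δ, mem_nhdsWithin_of_mem_nhds (ball_mem_nhds _ hδ), hi⟩
  covers := exists_disk_eq hC
  identifications i x hx j y hy := disk_eq_iff hC hx hy

theorem vertexSet_triangulation [CompactSpace C] (hC : IsPositiveEuclideanConeMetric C) :
    (F.triangulation hC).vertexSet = conePoints C := by
  ext p
  constructor
  · rintro ⟨i, k, rfl⟩
    exact (F.corner_mem i k).2
  · intro hp
    obtain ⟨i, x, hx, rfl⟩ := F.exists_disk_eq hC p
    obtain ⟨k, rfl⟩ := (mem_conePoints_iff hx).1 hp
    exact ⟨i, k, rfl⟩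

/-- The chord dual to a Voronoi edge is an edge of a triangle. -/
theorem exists_edge_dual [CompactSpace C] (hC : IsPositiveEuclideanConeMetric C)
    (hF : ∀ i, IsVoronoiVertex (F.disk i (F.center i))) {c : Plane} {D : Plane → C}
    (hD : IsDelaunayDisk c D) (hx : IsVoronoiEdgePoint (D c)) :
    ∃ e : Fin n × Fin 3, D '' delaunayCell c D =
      F.disk e.1 '' segment ℝ (F.corner e.1 (e.2 + 1)) (F.corner e.1 (e.2 + 2)) := by
  obtain ⟨a, b, hab, hM⟩ := encard_eq_two.1 ((isVoronoiEdgePoint_iff hC hD).1 hx)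
  have haM : a ∈ markedPoints c D := by simp [hM]
  have hbM : b ∈ markedPoints c D := by simp [hM]
  have hMc : ∀ z ∈ ({a, b} : Set Plane), z ∈ sphere c (coneRadius (D c)) := fun z hz => by
    rw [← hM] at hz
    exact hz.1
  obtain ⟨m, hm⟩ : ∃ m, m = midpoint ℝ a b := ⟨_, rfl⟩
  have hmb : m ∈ ball c (coneRadius (D c)) := by
    refine mem_ball_of_mem_convexHull hD.radius_pos hMc
      (by rw [convexHull_pair, hm]; exact midpoint_mem_segment a b) ?_
    rw [hm]
    rintro (h | h)
    · exact hab ((midpoint_eq_left_iff ℝ).1 h)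
    · exact hab ((midpoint_eq_right_iff ℝ).1 h)
  obtain ⟨i, y, hy, hyD⟩ := F.covers _ (hD.empty_interior m hmb)
  have hyn := hD.notMem_range (F.corner_mem i) hmb hyD.symm
  have hyb := mem_ball hy hyn
  obtain ⟨h, rfl, heq⟩ :=
    hD.isFlatOn.exists_overlay hC (F.isDelaunayDisk i).isFlatOn hmb hyb hyD.symm
  -- Otherwise `D c` would be a Voronoi vertex, with three shortest arcs instead of two.
  have hcc : c ≠ h.symm (F.center i) := fun hcc => by
    have h1 := hD.center_eq hC (F.isDelaunayDisk i) h hmb hyb heq hcc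
    have h2 : 3 ≤ (shortestArcs (D c)).encard := h1 ▸ hF i
    rw [show (shortestArcs (D c)).encard = 2 from hx] at h2
    norm_num at h2
  have hE := (F.isDelaunayDisk i).comp h
  have hmb' := mem_ball_comp_iff.2 hyb
  obtain ⟨l, a', b', h1, h2⟩ := hD.exists_separating hC hE hmb hmb' heq hcc
  have hcor : ∀ k, h.symm (F.corner i k) ∈ markedPoints (h.symm (F.center i)) (F.disk i ∘ h) :=
    fun k => by
      rw [mem_markedPoints_comp, h.apply_symm_apply]
      exact F.corner_mem i k
  let g : Plane →ᵃ[ℝ] ℝ := l.comp (h.symm.toAffineEquiv : Plane →ᵃ[ℝ] Plane)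
  have hg : ∀ z, g z = l (h.symm z) := fun z => rfl
  have hlm : l m ≤ 0 := by
    have h3 : segment ℝ a b ⊆ l ⁻¹' (Iic 0) :=
      ((convex_Iic 0).affine_preimage l).segment_subset (h1 a haM).1 (h1 b hbM).1
    exact h3 (hm ▸ midpoint_mem_segment a b)
  -- The triangle lies on one side of the radical axis and meets the chord at `m` on the other, so
  -- it touches the axis along an edge. Its corners there are also marked for `D`, hence are the
  -- endpoints of the chord.
  obtain ⟨k, hk, -⟩ := exists_edge_of_nonneg (F.affineIndependent i) (l := g)
    (fun k => (h2 _ (hcor k)).1) (a := h a) (b := h b) (fun k hk => by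
      have h3 := ((h2 _ (hcor k)).2 hk).1
      rw [hM] at h3
      rcases h3 with h3 | h3
      · exact Or.inl (by rw [← h3, h.apply_symm_apply])
      · rw [mem_singleton_iff] at h3
        exact Or.inr (by rw [← h3, h.apply_symm_apply])) hy hyn
    (by rwa [hg, h.symm_apply_apply])
  have hseg : segment ℝ (F.corner i (k + 1)) (F.corner i (k + 2)) = h '' segment ℝ a b := by
    have h3 : h '' segment ℝ a b = segment ℝ (h a) (h b) :=
      image_segment ℝ (h.toAffineEquiv : Plane →ᵃ[ℝ] Plane) a b
    rw [h3]
    rcases hk with ⟨h4, h5⟩ | ⟨h4, h5⟩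
    · rw [h4, h5]
    · rw [h4, h5, segment_symm]
  refine ⟨(i, k), ?_⟩
  simp only
  rw [delaunayCell, hM, convexHull_pair, hseg, image_image]
  refine image_congr fun z hz => ?_
  have hzi : h z ∈ F.face i := by
    have h3 : segment ℝ (F.corner i (k + 1)) (F.corner i (k + 2)) ⊆ F.face i :=
      (convex_convexHull ℝ _).segment_subset (F.corner_mem_face i _) (F.corner_mem_face i _)
    exact h3 (hseg ▸ mem_image_of_mem _ hz)
  refine hD.eqOn_closedBall hC hE hmb hmb' heq
    ⟨?_, mem_closedBall_comp_iff.2 (F.face_subset i hzi)⟩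
  exact (convex_closedBall c _).segment_subset (sphere_subset_closedBall haM.1)
    (sphere_subset_closedBall hbM.1) hz

end DelaunayFamily

end ConeSphere

/-! ### The main theorem -/

theorem mainTheorem9 (C : Type*) [MetricSpace C]
    (hsphere : Nonempty (C ≃ₜ Metric.sphere (0 : EuclideanSpace ℝ (Fin 3)) 1))
    (hcone : IsPositiveEuclideanConeMetric C) :
    ∃ T : GeodesicTriangulation C, T.vertexSet = conePoints C ∧ T.IsDelaunay := by
  have hV := ConeSphere.conePoints_nonempty hsphere hcone
  obtain ⟨e⟩ := hsphere
  have : CompactSpace C := e.symm.compactSpace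
  obtain ⟨n, F, hF, hcell⟩ := ConeSphere.exists_delaunayFamily hcone hV
  refine ⟨F.triangulation hcone, F.vertexSet_triangulation hcone, ?_, ?_, ?_⟩
  · exact fun i => ⟨F.center i, F.disk i, F.isDelaunayDisk i, hF i, F.corner_mem i,
      fun _ _ => rfl⟩
  · intro x hx
    obtain ⟨c, D, hD, hDx, I, hI, hID⟩ := hcell x hx
    refine ⟨c, D, hD, hDx, I, hI, fun i hi => ?_⟩
    obtain ⟨rfl, rfl⟩ := hID i hi
    exact ⟨F.corner_mem i, fun _ _ => rfl⟩
  · intro x hx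
    obtain ⟨D, hD, rfl⟩ := ConeSphere.exists_isDelaunayDisk hcone hV hx.notMem_conePoints 0
    exact ⟨0, D, hD, rfl, F.exists_edge_dual hcone hF hD hx⟩
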